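/- Let $1/2<p<1$ (equivalently $q>4$, where $\sqrt q=2p/(1-p)$), and let $X=(X_n)_{n\in\mathbb Z}$ be a bi-infinite word whose letters are independent with law $\theta_p(\mathtt a)=\theta_p(\mathtt b)=\frac14$, $\theta_p(\mathtt A)=\theta_p(\mathtt B)=\frac{1-p}4$, $\theta_p(\mathtt F)=\frac p2$. Here $\mathtt a,\mathtt b$ are burgers of two kinds, put on top of a stack when they are produced, and $\mathtt A$, $\mathtt B$, $\mathtt F$ are orders that consume the freshest remaining $\mathtt a$, the freshest remaining $\mathtt b$, and the freshest remaining burger of either kind, respectively. Times $i<j$ are matched if the burger produced at time $i$ is consumed by the order at time $j$. For $s<t$ the word $X(s,t)=X_s\cdots X_t$ is reducible if the relations $\mathtt{aA}=\mathtt{bB}=\mathtt{aF}=\mathtt{bF}=\emptyset$, $\mathtt{aB}=\mathtt{Ba}$, $\mathtt{bA}=\mathtt{Ab}$ reduce it to the empty word. Draw an arc above the real line between $i$ and $j$ for each matched pair $i<j$ with $X_i=\mathtt a$, and an arc below the real line for each matched pair with $X_i=\mathtt b$. The infinite FK planar map $M$ encoded by $X$ has as vertices the faces above the line; let $V(t)$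 be the face above the line adjacent to the segment $[t-1,t]$, and let $o=V(0)$ be the root. The spanning tree $T$ of $M$ has, for each arc above the line, one edge joining the two faces that this arc separates. The edges of $M$ are those of $T$ together with, for each arc below the line between $i$ and $j$, one edge joining $V(i)=V(i+1)$ and $V(j)=V(j+1)$. Let $d_M,d_T$ be the graph distances. For $k\ge1$ the $k$-th pinch point $p_k(o)$ of $o$ is the vertex $V(s)=V(t+1)$, where $[s,t]$ is the $k$-th smallest interval containing $0$ such that $X(s,t)$ is reducible, ordered by length (intervals of equal length give the same vertex, so ties may be broken arbitrarily); put $p_0(o)=o$ and $p(o)=p_1(o)$. Then, almost surely, $p_k(o)$ exists for every $k\ge 1$; the variables $d_T(o,p(o))$ and $d_M(o,p(o))$ are integrable and $\mathbb E\,d_M(o,p(o))>0$, so that $$\mathfrak a:=\frac{\mathbb E\,d_T(o,p(o))}{\mathbb E\,d_M(o,p(o))}$$ is well defined; and for every $\varepsilon>0$, with $x_n:=p_{\lfloor n\varepsilon\rfloor}(o)$, $$\frac{\mathfrak a\,d_M(o,x_n)-d_T(o,x_n)}{n}\longrightarrow 0\qquad\text{almost surely and in }L^1\quad(n\to\infty).$$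 -/

import Mathlib

open MeasureTheory ProbabilityTheory Filter Topology

/-- The five symbols: hamburger `a`, cheeseburger `b`, hamburger order `A`, cheeseburger order `B`,
flexible order `F`. -/
inductive Letter where
  | a | b | A | B | F
  deriving DecidableEq

namespace Letter

instance : MeasurableSpace Letter := ⊤

/-- The letter is a burger (as opposed to an order). -/
def isBurger : Letter → Bool
  | a => true
  | b => true
  | _ => false

/-- `serves x c`: the symbol `x` is a burger that can fulfil the order `c`. -/
def serves : Letter → Letter → Bool
  | a, A => true
  | a, F => true
  | b, B => true
  | b, F => true
  | _, _ => false

/-- The weights of the letter distribution `θ_p`. -/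
noncomputable def prob (p : ℝ) : Letter → ℝ
  | a => 1 / 4
  | b => 1 / 4
  | A => (1 - p) / 4
  | B => (1 - p) / 4
  | F => p / 2

/-- The relations `aA = bB = aF = bF = ∅`, `aB = Ba`, `bA = Ab` between words. -/
inductive Rel : FreeMonoid Letter → FreeMonoid Letter → Prop where
  | aA : Rel (FreeMonoid.of a * FreeMonoid.of A) 1
  | bB : Rel (FreeMonoid.of b * FreeMonoid.of B) 1
  | aF : Rel (FreeMonoid.of a * FreeMonoid.of F) 1
  | bF : Rel (FreeMonoid.of b * FreeMonoid.of F) 1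
  | aB : Rel (FreeMonoid.of a * FreeMonoid.of B) (FreeMonoid.of B * FreeMonoid.of a)
  | bA : Rel (FreeMonoid.of b * FreeMonoid.of A) (FreeMonoid.of A * FreeMonoid.of b)

end Letter

namespace BurgerWord

/-- The subword `X(s,t) = X_s X_{s+1} ⋯ X_t`. -/
def subword (X : ℤ → Letter) (s t : ℤ) : FreeMonoid Letter :=
  FreeMonoid.ofList ((List.range (t + 1 - s).toNat).map fun k => X (s + k))

/-- The nonempty word `X(s,t)` is reducible: the relations reduce it to the empty word. -/
def Reducible (X : ℤ → Letter) (s t : ℤ) : Prop :=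
  s < t ∧ PresentedMonoid.mk Letter.Rel (subword X s t) = 1

/-- The burgers produced during the times `s, …, s + n - 1` that are still unconsumed just before
time `s + n`, given by their production times, freshest first. A burger goes on top of the stack;
an order takes the freshest burger that can fulfil it (an order that no burger of the stack
fulfils is served by a burger older than `s`, and leaves this stack unchanged). -/
def stack (X : ℤ → Letter) (s : ℤ) : ℕ → List ℤ
  | 0 => []
  | n + 1 =>
    if (X (s + n)).isBurger then (s + n) :: stack X s n
    else (stack X s n).eraseP fun i => (X i).serves (X (s + n))

/-- The burger produced at time `i` is consumed by the order placed at time `j`: at time `j` it is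
the freshest burger that can fulfil the order. (Burgers older than `i` do not matter, by the
last-in-first-out rule.) -/
def Matched (X : ℤ → Letter) (i j : ℤ) : Prop :=
  i < j ∧ (stack X i (j - i).toNat).find? (fun k => (X k).serves (X j)) = some i

/-- In the arc map, the hamburger arcs are drawn above the real line, one joining `i` to `j` for
each hamburger produced at time `i` and consumed at time `j`. -/
def HamburgerArc (X : ℤ → Letter) (i j : ℤ) : Prop := Matched X i j ∧ X i = Letter.a

/-- The cheeseburger arcs, drawn below the real line. -/
def CheeseburgerArc (X : ℤ → Letter) (i j : ℤ) : Prop := Matched X i j ∧ X i = Letter.b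

/-- The integer `t` stands for the segment `[t-1, t]` of the real line. Two segments lie on the
boundary of the same face above the real line iff every hamburger arc passes either above both of
them or above neither. -/
def faceSetoid (X : ℤ → Letter) : Setoid ℤ where
  r s t := ∀ i j, HamburgerArc X i j → ((i < s ∧ s ≤ j) ↔ (i < t ∧ t ≤ j))
  iseqv :=
    { refl := fun _ _ _ _ => Iff.rfl
      symm := fun h i j hij => (h i j hij).symm
      trans := fun h h' i j hij => (h i j hij).trans (h' i j hij) }

/-- The vertices of the planar map: the faces of the arc map above the real line. -/
def Vertex (X : ℤ → Letter) : Type := Quotient (faceSetoid X)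

/-- `V X t` is the vertex of the map on the Tutte edge that crosses the segment `[t-1, t]`. -/
def V (X : ℤ → Letter) (t : ℤ) : Vertex X := Quotient.mk (faceSetoid X) t

/-- The canonical spanning tree `T`: each hamburger arc `(i, j)` is crossed by one edge, joining the
face just outside the arc to the face just inside it. -/
def treeGraph (X : ℤ → Letter) : SimpleGraph (Vertex X) :=
  SimpleGraph.fromRel fun x y => ∃ i j, HamburgerArc X i j ∧ x = V X i ∧ y = V X (i + 1)

/-- The map `M` (as a graph; loops and multiplicities of edges do not affect distances): the edges
of `T` and the duals of the edges crossing the cheeseburger arcs. The triangles of the times `i` and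
`j` of a cheeseburger arc `(i, j)` form a quadrangle whose diagonal in `M` joins `V i = V (i+1)` to
`V j = V (j+1)`. -/
def mapGraph (X : ℤ → Letter) : SimpleGraph (Vertex X) :=
  treeGraph X ⊔
    SimpleGraph.fromRel fun x y => ∃ i j, CheeseburgerArc X i j ∧ x = V X i ∧ y = V X j

/-- The graph distance `d_T`. -/
noncomputable def dT (X : ℤ → Letter) (x y : Vertex X) : ℝ := ((treeGraph X).dist x y : ℝ)

/-- The graph distance `d_M`. -/
noncomputable def dM (X : ℤ → Letter) (x y : Vertex X) : ℝ := ((mapGraph X).dist x y : ℝ)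

/-- The intervals `[s, t]` containing `u` such that `X(s,t)` is reducible. -/
def reducibleAround (X : ℤ → Letter) (u : ℤ) : Set (ℤ × ℤ) :=
  {I | I.1 ≤ u ∧ u ≤ I.2 ∧ Reducible X I.1 I.2}

/-- The interval `I` is smaller than `J`: it is shorter, or of the same length and further to the
left. (Reducible intervals of the same length around the same time have the same vertex
`V s = V (t+1)`, so the choice made for ties has no influence on the pinch points.) -/
def Smaller (I J : ℤ × ℤ) : Prop :=
  I.2 - I.1 < J.2 - J.1 ∨ (I.2 - I.1 = J.2 - J.1 ∧ I.1 < J.1)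

/-- `I` is the `k`-th smallest reducible interval containing `u` (for `k ≥ 1`). -/
def IsKthReducible (X : ℤ → Letter) (u : ℤ) (k : ℕ) (I : ℤ × ℤ) : Prop :=
  I ∈ reducibleAround X u ∧ {J ∈ reducibleAround X u | Smaller J I}.ncard + 1 = k

open Classical in
/-- The `k`-th pinch point of `V u`: the vertex `V s = V (t+1)` for the `k`-th smallest reducible
interval `[s, t]` containing `u`. The zeroth one is `V u` itself (also the value used when there is
no `k`-th reducible interval). -/
noncomputable def pinchPoint (X : ℤ → Letter) (u : ℤ) (k : ℕ) : Vertex X :=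
  if h : ∃ I, IsKthReducible X u k I then V X h.choose.1 else V X u

/-- The root vertex `o`. -/
def root (X : ℤ → Letter) : Vertex X := V X 0

/-- The constant `𝔞 = 𝔼 d_T(o, p(o)) / 𝔼 d_M(o, p(o))` of a random word. -/
noncomputable def distortion {Ω : Type*} [MeasurableSpace Ω] (P : Measure Ω)
    (X : Ω → ℤ → Letter) : ℝ :=
  (∫ ω, dT (X ω) (root (X ω)) (pinchPoint (X ω) 0 1) ∂P) /
    (∫ ω, dM (X ω) (root (X ω)) (pinchPoint (X ω) 0 1) ∂P)

/-- `D(x, y) = 𝔞 d_M(x, y) - d_T(x, y)` for the word `X`. -/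
noncomputable def D (𝔞 : ℝ) (X : ℤ → Letter) (x y : Vertex X) : ℝ := 𝔞 * dM X x y - dT X x y

/-- The random bi-infinite word `X` has law `θ_p^{⊗ℤ}`: its letters are independent samples
from `θ_p`. -/
structure IsRandomWord {Ω : Type*} [MeasurableSpace Ω] (P : Measure Ω) (p : ℝ)
    (X : Ω → ℤ → Letter) : Prop where
  measurable : ∀ n, Measurable fun ω => X ω n
  indep : iIndepFun (fun (n : ℤ) ω => X ω n) P
  law : ∀ n c, P {ω | X ω n = c} = ENNReal.ofReal (Letter.prob p c)

end BurgerWord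

/-! Pinch points are cut vertices, which makes both distances additive. A reducible interval $[s,t]$
is attached to the rest of the map only through the vertex $V(s)=V(t+1)$. So in either graph the
distance from the root to a face outside the interval is the distance to the pinch point plus a
distance in the map of the word with the interval deleted (`gdist_emb`). The smallest reducible
interval around $0$ is recognised from its own letters, so deleting it (`shrink`) leaves a word with
the original law, independent of the two distances read off (`wordLaw_inter_shrink`). The distances
to the pinch points are therefore partial sums of pairwise independent, identically distributed
pairs (`Good.pinchDist_eq_sum`), and $\mathfrak a$ is the constant that centres $\mathfrak
a\,d_M-d_T$. The strong law of large numbers gives the limit. Reducible intervals with the same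
right end share a pinch point, so the $k$-th pinch point is reached after some $j\le k$ increments;
since the limit is $0$, the bound on $j$ is enough.

The main work is to show that a reducible interval around $0$ exists and that $d_T(o,p(o))$ is
integrable. Read from the left end of a reducible interval, the tree distance is at most the height
of the stack (`gdist_false_le`), so it suffices to find some reducible interval whose past leaves an
integrable number of burgers at time $0$ (`lintegral_firstCost_lt_top`). Such an interval is found
by alternating two searches, keeping a word of $x$ letters $\mathtt A$ and $y$ letters $\mathtt B$,
possibly followed by $\mathtt F$. When there is a final $\mathtt F$, the past is read backwards
until a burger survives; it comes with $N$ orders that it cannot serve. Otherwise the future is read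
until an unserved $\mathtt F$ appears. A backward search raises the burger count by at most one, and
the exploration ends when the word becomes empty.

The condition $p>1/2$ enters through $\mathbb E N\le 1/p-1<1$. With the discrepancy between the two
kinds as a martingale-like quantity, its second moment grows at each step by at most $1-p\,\chi$,
where $\chi$ is the mean of $N+1$ (truncated); as a second moment is nonnegative, $\chi\le1/p$
(`Ew_blkLen_le`). The same bound gives a negative drift that makes the mean number of orders
collected by a forward search finite (`openTime_le`, `Ew_foreLen_le`). A Lyapunov function of linear
growth (`exists_lyapunov`) then bounds the mean number of backward searches, because the total $x+y$
decreases in the interior while at the boundary the difference $|y-x|$ decreases. -/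

open scoped ENNReal
namespace BurgerWord

/-! ### Reduction of words -/

/-- A reduced word: its unfulfilled orders from left to right, and its remaining burgers, freshest
first. -/
abbrev RWord := List Letter × List Letter

/-- Multiplication of a reduced word by a letter on the left. -/
def consStep (c : Letter) (r : RWord) : RWord :=
  if c.isBurger then
    if r.1.any c.serves then (r.1.eraseP c.serves, r.2) else (r.1, r.2 ++ [c])
  else (c :: r.1, r.2)

/-- Multiplication of a reduced word by a letter on the right. -/
def snocStep (r : RWord) (c : Letter) : RWord :=
  if c.isBurger then (r.1, c :: r.2)
  else if r.2.any (fun x => x.serves c) then (r.1, r.2.eraseP fun x => x.serves c)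
  else (r.1 ++ [c], r.2)

/-- Multiplication of a reduced word by a word on the left. -/
def act (w : List Letter) (r : RWord) : RWord := w.foldr consStep r

/-- The reduced form of a word. -/
def red (w : List Letter) : RWord := act w ([], [])

@[simp] lemma act_nil (r : RWord) : act [] r = r := rfl
@[simp] lemma act_cons (c : Letter) (w : List Letter) (r : RWord) :
    act (c :: w) r = consStep c (act w r) := rfl
lemma act_append (u v : List Letter) (r : RWord) : act (u ++ v) r = act u (act v r) := by
  simp [act, List.foldr_append]
@[simp] lemma red_nil : red [] = ([], []) := rfl
lemma red_cons (c : Letter) (w : List Letter) : red (c :: w) = consStep c (red w) := rfl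
lemma red_append (u v : List Letter) : red (u ++ v) = act u (red v) := act_append u v _

lemma eraseP_append_any {α : Type*} (p : α → Bool) (l₁ l₂ : List α) :
    (l₁ ++ l₂).eraseP p = if l₁.any p then l₁.eraseP p ++ l₂ else l₁ ++ l₂.eraseP p := by
  split_ifs with h
  · obtain ⟨x, hx, hpx⟩ := List.any_eq_true.1 h
    exact List.eraseP_append_left hpx l₂ hx
  · exact List.eraseP_append_right l₂ (fun b hb hp => h (List.any_eq_true.2 ⟨b, hb, hp⟩))

lemma eraseP_of_not_any {α : Type*} (p : α → Bool) (l : List α) (h : ¬ l.any p) :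
    l.eraseP p = l :=
  List.eraseP_of_forall_not fun b hb hp => h (List.any_eq_true.2 ⟨b, hb, hp⟩)

/-- Associativity at the level of normal forms. The only delicate case is a burger on the left and
an order on the right: if the order finds a burger of `S` it never sees `d`, and if `d` finds an
order of `O` it never sees `c`. -/
lemma consStep_snocStep (d c : Letter) (r : RWord) :
    consStep d (snocStep r c) = snocStep (consStep d r) c := by
  obtain ⟨O, S⟩ := r
  by_cases hd : d.isBurger <;> by_cases hc : c.isBurger
  · simp only [consStep, snocStep, hd, hc, if_true]
    split_ifs <;> simp
  · by_cases h1 : S.any (fun x => x.serves c) <;> by_cases h2 : O.any d.serves <;>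
      by_cases h3 : d.serves c
    all_goals simp only [consStep, snocStep, hd, hc, if_true, h1, h2, h3, eraseP_append_any,
      List.any_append, List.any_cons, List.any_nil, Bool.or_false, Bool.or_true,
      List.eraseP_cons, List.eraseP_nil, cond_true, cond_false,
      List.append_nil, if_false, Bool.false_eq_true]
  · simp [consStep, snocStep, hd, hc]
  · simp only [consStep, snocStep, hd, hc]
    split_ifs <;> simp_all

lemma act_snocStep (u : List Letter) (r : RWord) (c : Letter) :
    act u (snocStep r c) = snocStep (act u r) c := by
  induction u with
  | nil => rfl
  | cons d u ih => rw [act_cons, ih, consStep_snocStep, act_cons]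

lemma red_singleton (c : Letter) : red [c] = snocStep ([], []) c := by
  cases c <;> rfl

lemma red_concat (u : List Letter) (c : Letter) : red (u ++ [c]) = snocStep (red u) c := by
  rw [red_append, red_singleton, act_snocStep, red]

/-- The class of a word in the presented monoid. -/
def cls (w : List Letter) : PresentedMonoid Letter.Rel :=
  PresentedMonoid.mk Letter.Rel (FreeMonoid.ofList w)

@[simp] lemma cls_nil : cls [] = 1 := map_one _
lemma cls_append (u v : List Letter) : cls (u ++ v) = cls u * cls v := by
  simp [cls, FreeMonoid.ofList_append]
lemma cls_cons (c : Letter) (v : List Letter) : cls (c :: v) = cls [c] * cls v := by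
  rw [← cls_append]; rfl

/-- Left multiplication by a letter, as an element of the monoid of self-maps. -/
def consEnd (c : Letter) : Function.End RWord := consStep c

lemma consEnd_mul (c d : Letter) (r : RWord) :
    (consEnd c * consEnd d) r = consStep c (consStep d r) := rfl

/-- The action of the presented monoid on reduced words. -/
def clsAct : PresentedMonoid Letter.Rel →* Function.End RWord :=
  PresentedMonoid.lift consEnd (by
    intro a b h
    cases h
    all_goals
      simp only [map_mul, map_one, FreeMonoid.lift_eval_of]
      funext r
      obtain ⟨O, S⟩ := r
      simp only [consEnd_mul, Function.End.one_def, id, consStep,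
        Letter.isBurger, if_true, List.any_cons, Letter.serves, Bool.true_or, Bool.false_or,
        List.eraseP_cons, cond_true, cond_false, Bool.false_eq_true, if_false]
      try (split_ifs <;> rfl))

lemma clsAct_cls (w : List Letter) (r : RWord) : clsAct (cls w) r = act w r := by
  induction w with
  | nil => simp [Function.End.one_def]
  | cons c w ih =>
    rw [cls_cons, map_mul, act_cons, ← ih]
    rfl

lemma act_eq_of_cls_eq {u v : List Letter} (h : cls u = cls v) (r : RWord) : act u r = act v r := by
  rw [← clsAct_cls, h, clsAct_cls]

lemma red_eq_of_cls_eq {u v : List Letter} (h : cls u = cls v) : red u = red v :=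
  act_eq_of_cls_eq h _

/-- The letters of the first part are orders, those of the second part are burgers. -/
def WF (r : RWord) : Prop := (∀ o ∈ r.1, o.isBurger = false) ∧ ∀ x ∈ r.2, x.isBurger = true

lemma WF.consStep {r : RWord} (h : WF r) (c : Letter) : WF (consStep c r) := by
  unfold BurgerWord.consStep
  split_ifs with h1 h2
  · exact ⟨fun o ho => h.1 o (List.mem_of_mem_eraseP ho), h.2⟩
  · refine ⟨h.1, fun x hx => ?_⟩
    rcases List.mem_append.1 hx with hx | hx
    · exact h.2 x hx
    · rw [List.mem_singleton.1 hx]; exact h1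
  · refine ⟨fun o ho => ?_, h.2⟩
    rcases List.mem_cons.1 ho with rfl | ho
    · simpa using h1
    · exact h.1 o ho

lemma WF.act {r : RWord} (h : WF r) (u : List Letter) : WF (act u r) := by
  induction u with
  | nil => exact h
  | cons c u ih => exact ih.consStep c

lemma wf_red (w : List Letter) : WF (red w) := WF.act ⟨by simp, by simp⟩ w

lemma cls_burger_order {c o : Letter} (hc : c.isBurger = true) (ho : o.isBurger = false) :
    cls [c] * cls [o] = if c.serves o then 1 else cls [o] * cls [c] := by
  have key : ∀ {u v}, Letter.Rel u v → PresentedMonoid.mk Letter.Rel u =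
    PresentedMonoid.mk Letter.Rel v := fun h => PresentedMonoid.mk_eq_mk_of_rel h
  have h1 := key Letter.Rel.aA
  have h2 := key Letter.Rel.bB
  have h3 := key Letter.Rel.aF
  have h4 := key Letter.Rel.bF
  have h5 := key Letter.Rel.aB
  have h6 := key Letter.Rel.bA
  rw [map_mul] at h1 h2 h3 h4 h5 h6
  rw [map_mul] at h5 h6
  rw [map_one] at h1 h2 h3 h4
  cases c <;> cases o <;> simp_all [Letter.isBurger, Letter.serves] <;> assumption

lemma cls_burger_mul {c : Letter} (hc : c.isBurger = true) (O : List Letter)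
    (hO : ∀ o ∈ O, o.isBurger = false) :
    cls [c] * cls O = if O.any c.serves then cls (O.eraseP c.serves) else cls O * cls [c] := by
  induction O with
  | nil => simp
  | cons o O ih =>
    have ih := ih fun o' h => hO o' (List.mem_cons_of_mem _ h)
    rw [cls_cons o O, ← mul_assoc, cls_burger_order hc (hO o List.mem_cons_self)]
    by_cases h : c.serves o
    · simp [h]
    · simp only [h, List.any_cons, Bool.false_or, List.eraseP_cons, cond_false, if_false,
        Bool.false_eq_true]
      rw [mul_assoc, ih]
      split_ifs
      · rw [← cls_cons]
      · rw [mul_assoc]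

/-- A word is equal to its reduced form. -/
lemma cls_eq_red (w : List Letter) : cls w = cls (red w).1 * cls (red w).2.reverse := by
  induction w with
  | nil => simp
  | cons c w ih =>
    rw [cls_cons, ih, red_cons, ← mul_assoc, consStep]
    split_ifs with h1 h2
    · rw [cls_burger_mul h1 _ (wf_red w).1, if_pos h2]
    · rw [cls_burger_mul h1 _ (wf_red w).1, if_neg h2, mul_assoc]
      simp only [List.reverse_append, List.reverse_singleton]
      rw [cls_append]
    · simp only; rw [cls_cons c (red w).1]

/-- The monoid acts on reduced words, so the normal form depends only on the class; conversely each
word equals its normal form in the monoid. Hence reducibility can be tested by computing `red`. -/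
lemma cls_eq_one_iff (w : List Letter) : cls w = 1 ↔ red w = ([], []) := by
  constructor
  · intro h
    exact red_eq_of_cls_eq (h.trans cls_nil.symm)
  · intro h
    rw [cls_eq_red, h]; simp

/-- The number of burgers minus the number of orders. -/
def netCount (w : List Letter) : ℤ := (w.map fun c => if c.isBurger then (1 : ℤ) else -1).sum

@[simp] lemma netCount_nil : netCount [] = 0 := rfl
lemma netCount_cons (c : Letter) (w : List Letter) :
    netCount (c :: w) = (if c.isBurger then 1 else -1) + netCount w := by simp [netCount]
lemma netCount_append (u v : List Letter) : netCount (u ++ v) = netCount u + netCount v := by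
  simp [netCount]

lemma netCount_eq (w : List Letter) :
    netCount w = ((red w).2.length : ℤ) - (red w).1.length := by
  induction w with
  | nil => simp
  | cons c w ih =>
    rw [netCount_cons, ih, red_cons, consStep]
    split_ifs with h1 h2
    · obtain ⟨x, hx, hpx⟩ := List.any_eq_true.1 h2
      have := List.length_eraseP_of_mem hx hpx
      have h3 := List.length_pos_of_mem hx
      simp only; omega
    · simp; ring
    · simp; ring

/-! Monotonicity of the two parts. -/

lemma consStep_snd (c : Letter) (r : RWord) : ∃ T, (consStep c r).2 = r.2 ++ T := by
  unfold consStep; split_ifs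
  exacts [⟨[], by simp⟩, ⟨[c], rfl⟩, ⟨[], by simp⟩]

lemma act_snd (u : List Letter) (r : RWord) : ∃ T, (act u r).2 = r.2 ++ T := by
  induction u with
  | nil => exact ⟨[], by simp⟩
  | cons c u ih =>
    obtain ⟨T, hT⟩ := ih
    obtain ⟨T', hT'⟩ := consStep_snd c (act u r)
    exact ⟨T ++ T', by rw [act_cons, hT', hT, List.append_assoc]⟩

lemma snocStep_fst (r : RWord) (c : Letter) : ∃ T, (snocStep r c).1 = r.1 ++ T := by
  unfold snocStep; split_ifs
  exacts [⟨[], by simp⟩, ⟨[], by simp⟩, ⟨[c], rfl⟩]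

lemma red_append_fst (u v : List Letter) : ∃ T, (red (u ++ v)).1 = (red u).1 ++ T := by
  induction v using List.reverseRecOn with
  | nil => exact ⟨[], by simp⟩
  | append_singleton v c ih =>
    obtain ⟨T, hT⟩ := ih
    obtain ⟨T', hT'⟩ := snocStep_fst (red (u ++ v)) c
    exact ⟨T ++ T', by rw [← List.append_assoc, red_concat, hT', hT, List.append_assoc]⟩

lemma red_append_snd (u v : List Letter) : ∃ T, (red (u ++ v)).2 = (red v).2 ++ T := by
  rw [red_append]; exact act_snd u _

/-- If two words overlap and reduce to the empty word, so do their intersection and the rests. -/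
lemma red_overlap {u v w : List Letter} (h1 : red (u ++ v) = ([], []))
    (h2 : red (v ++ w) = ([], [])) : red v = ([], []) ∧ red u = ([], []) ∧ red w = ([], []) := by
  obtain ⟨T, hT⟩ := red_append_snd u v
  obtain ⟨T', hT'⟩ := red_append_fst v w
  rw [h1] at hT
  rw [h2] at hT'
  -- Burgers left over in `v` survive any word put on its left, and orders left over survive any
  -- word put on its right.
  have hv : red v = ([], []) := by
    simp only [List.nil_eq, List.append_eq_nil_iff] at hT hT'
    exact Prod.ext hT'.1 hT.1
  refine ⟨hv, ?_, ?_⟩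
  · rw [red_append, hv] at h1; exact h1
  · rw [← cls_eq_one_iff] at *
    rw [cls_append, hv, one_mul] at h2; exact h2

end BurgerWord

namespace BurgerWord

/-! ### Stacks and matchings -/

/-- The word `X_s X_{s+1} ⋯ X_{s+n-1}`. -/
def wd (X : ℤ → Letter) (s : ℤ) (n : ℕ) : List Letter := (List.range n).map fun k : ℕ => X (s + k)

@[simp] lemma wd_zero (X : ℤ → Letter) (s : ℤ) : wd X s 0 = [] := rfl

lemma wd_succ (X : ℤ → Letter) (s : ℤ) (n : ℕ) : wd X s (n + 1) = wd X s n ++ [X (s + n)] := by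
  simp [wd, List.range_succ]

lemma wd_add (X : ℤ → Letter) (s : ℤ) (m n : ℕ) :
    wd X s (m + n) = wd X s m ++ wd X (s + m) n := by
  induction n with
  | zero => simp
  | succ n ih => rw [← add_assoc, wd_succ, ih, wd_succ, List.append_assoc]; push_cast; ring_nf

lemma wd_congr {X X' : ℤ → Letter} {s s' : ℤ} {n : ℕ} (h : ∀ k : ℕ, k < n → X (s + k) = X' (s' + k)) :
    wd X s n = wd X' s' n :=
  List.map_congr_left fun k hk => h k (List.mem_range.1 hk)

lemma red_wd_succ (X : ℤ → Letter) (s : ℤ) (n : ℕ) :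
    red (wd X s (n + 1)) = snocStep (red (wd X s n)) (X (s + n)) := by
  rw [wd_succ, red_concat]

lemma subword_eq (X : ℤ → Letter) (s t : ℤ) :
    subword X s t = FreeMonoid.ofList (wd X s (t + 1 - s).toNat) := by
  rw [subword, wd]
  congr 1
  simp only [List.bind_eq_flatMap, List.pure_def, List.map_flatMap]
  exact List.map_eq_flatMap.symm

lemma reducible_iff {X : ℤ → Letter} {s t : ℤ} :
    Reducible X s t ↔ s < t ∧ red (wd X s (t + 1 - s).toNat) = ([], []) := by
  rw [← cls_eq_one_iff, cls, ← subword_eq]; rfl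

lemma stack_map (X : ℤ → Letter) (s : ℤ) (n : ℕ) :
    (stack X s n).map X = (red (wd X s n)).2 := by
  induction n with
  | zero => rfl
  | succ n ih =>
    rw [red_wd_succ, stack, snocStep, ← ih]
    by_cases h : (X (s + n)).isBurger
    · simp [h]
    · simp only [h, Bool.false_eq_true, if_false, List.any_map]
      split_ifs with h2
      · rw [List.eraseP_map]; rfl
      · rw [eraseP_of_not_any _ _ (by simpa [Function.comp_def] using h2)]

lemma stack_length (X : ℤ → Letter) (s : ℤ) (n : ℕ) :
    (stack X s n).length = (red (wd X s n)).2.length := by rw [← stack_map, List.length_map]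

lemma mem_stack {X : ℤ → Letter} {s i : ℤ} {n : ℕ} (h : i ∈ stack X s n) :
    s ≤ i ∧ i < s + n ∧ (X i).isBurger = true := by
  induction n with
  | zero => simp [stack] at h
  | succ n ih =>
    rw [stack] at h
    split_ifs at h with h1
    · rcases List.mem_cons.1 h with rfl | h
      · exact ⟨by omega, by push_cast; omega, h1⟩
      · have := ih h; exact ⟨this.1, by push_cast; omega, this.2.2⟩
    · have := ih (List.mem_of_mem_eraseP h); exact ⟨this.1, by push_cast; omega, this.2.2⟩

lemma stack_nodup (X : ℤ → Letter) (s : ℤ) (n : ℕ) : (stack X s n).Nodup := by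
  induction n with
  | zero => simp [stack]
  | succ n ih =>
    rw [stack]
    split_ifs with h1
    · refine List.nodup_cons.2 ⟨fun h => ?_, ih⟩
      have := mem_stack h; omega
    · exact ih.sublist List.eraseP_sublist

/-- Recent burgers lie on top of what is left of the old stack: an order reaches an old burger only
if no recent one serves it. -/
lemma stack_split (X : ℤ → Letter) (s : ℤ) (n m : ℕ) :
    ∃ R, R.Sublist (stack X s n) ∧ stack X s (n + m) = stack X (s + n) m ++ R := by
  induction m with
  | zero => exact ⟨_, List.Sublist.refl _, rfl⟩
  | succ m ih =>
    obtain ⟨R, hR, h⟩ := ih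
    have e : s + ((n + m : ℕ) : ℤ) = s + n + m := by push_cast; ring
    rw [← add_assoc, stack, stack, h, e]
    split_ifs with h1
    · exact ⟨R, hR, rfl⟩
    · rw [eraseP_append_any]
      split_ifs with h2
      · exact ⟨R, hR, rfl⟩
      · exact ⟨_, List.eraseP_sublist.trans hR, by rw [eraseP_of_not_any _ _ h2]⟩

lemma any_stack_of_fst_nil {X : ℤ → Letter} {s : ℤ} {m : ℕ} (h : (red (wd X s (m + 1))).1 = [])
    (h1 : ¬ (X (s + m)).isBurger = true) :
    (stack X s m).any fun k => (X k).serves (X (s + m)) := by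
  have h3 : (red (wd X s m)).2.any fun x => x.serves (X (s + m)) := by
    by_contra h3
    rw [red_wd_succ, snocStep, if_neg h1, if_neg h3] at h
    simp at h
  rwa [← stack_map, List.any_map] at h3

lemma fst_nil_of_le {X : ℤ → Letter} {s : ℤ} {m n : ℕ} (hmn : m ≤ n)
    (h : (red (wd X s n)).1 = []) : (red (wd X s m)).1 = [] := by
  obtain ⟨k, rfl⟩ := Nat.exists_eq_add_of_le hmn
  obtain ⟨T, hT⟩ := red_append_fst (wd X s m) (wd X (s + m) k)
  rw [← wd_add, h] at hT
  exact (List.append_eq_nil_iff.1 hT.symm).1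

lemma stack_split_eq {X : ℤ → Letter} {s : ℤ} {n m : ℕ}
    (h : (red (wd X (s + n) m)).1 = []) :
    stack X s (n + m) = stack X (s + n) m ++ stack X s n := by
  induction m with
  | zero => rfl
  | succ m ih =>
    have e : s + ((n + m : ℕ) : ℤ) = s + n + m := by push_cast; ring
    have h0 := fst_nil_of_le (Nat.le_succ m) h
    rw [← add_assoc, stack, stack, ih h0, e]
    split_ifs with h1
    · rfl
    · rw [eraseP_append_any, if_pos (any_stack_of_fst_nil h h1)]

/-! ### Uniqueness and nesting of the matching -/

lemma matched_iff {X : ℤ → Letter} {i : ℤ} {n : ℕ} :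
    Matched X i (i + n) ↔
      0 < n ∧ (stack X i n).find? (fun k => (X k).serves (X (i + n))) = some i := by
  simp [Matched]

lemma Matched.exists_nat {X : ℤ → Letter} {i j : ℤ} (h : Matched X i j) :
    ∃ n : ℕ, 0 < n ∧ j = i + n :=
  ⟨(j - i).toNat, by have := h.1; omega, by have := h.1; omega⟩

lemma serves_right {x c : Letter} (h : x.serves c = true) : c.isBurger = false := by
  cases x <;> cases c <;> simp_all [Letter.serves, Letter.isBurger]

lemma Matched.serves {X : ℤ → Letter} {i j : ℤ} (h : Matched X i j) :
    (X i).serves (X j) = true := List.find?_some (p := fun k => (X k).serves (X j)) h.2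

lemma Matched.mem {X : ℤ → Letter} {i : ℤ} {n : ℕ} (h : Matched X i (i + n)) :
    i ∈ stack X i n := List.mem_of_find?_eq_some (matched_iff.1 h).2

/-- A burger which has been consumed is no longer in the stack. -/
lemma Matched.not_mem {X : ℤ → Letter} {i : ℤ} {n : ℕ} (h : Matched X i (i + n)) (m : ℕ) :
    i ∉ stack X i (n + 1 + m) := by
  intro hm
  obtain ⟨R, hR, e⟩ := stack_split X i (n + 1) m
  rw [e] at hm
  rcases List.mem_append.1 hm with hm | hm
  · have := mem_stack hm; push_cast at this; omega
  · have h2 := hR.subset hm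
    have hs := serves_right h.serves
    rw [stack, if_neg (by simp [hs])] at h2
    obtain ⟨p, q, e2⟩ := (List.find?_eq_some_iff_append.1 (matched_iff.1 h).2).2
    have hnd := stack_nodup X i n
    rw [e2.1] at h2 hnd
    rw [List.eraseP_append_right] at h2
    · rw [List.eraseP_cons_of_pos (by exact h.serves)] at h2
      rw [List.nodup_append] at hnd
      rcases List.mem_append.1 h2 with h3 | h3
      · exact hnd.2.2 _ h3 _ List.mem_cons_self rfl
      · exact (List.nodup_cons.1 hnd.2.1).1 h3
    · intro b hb; simpa using e2.2 b hb

lemma Matched.right_unique {X : ℤ → Letter} {i j j' : ℤ} (h : Matched X i j)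
    (h' : Matched X i j') : j = j' := by
  have key : ∀ {j j' : ℤ}, Matched X i j → Matched X i j' → ¬ j < j' := by
    intro j j' h h' hlt
    obtain ⟨n, hn, rfl⟩ := h.exists_nat
    obtain ⟨n', hn', rfl⟩ := h'.exists_nat
    obtain ⟨m, rfl⟩ := Nat.exists_eq_add_of_le (show n + 1 ≤ n' by omega)
    exact h.not_mem m h'.mem
  have h1 := key h h'
  have h2 := key h' h
  omega

/-- A burger that is fresher than the one matched to `j` and still present at time `j` does not
serve the order at time `j`. -/
lemma Matched.not_serves {X : ℤ → Letter} {i i' j : ℤ} (h : Matched X i j) (h1 : i < i')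
    (h2 : i' < j) (hm : i' ∈ stack X i' (j - i').toNat) : (X i').serves (X j) = false := by
  obtain ⟨n, hn, rfl⟩ := h.exists_nat
  obtain ⟨k, rfl⟩ : ∃ k : ℕ, i' = i + k := ⟨(i' - i).toNat, by omega⟩
  obtain ⟨m, rfl⟩ := Nat.exists_eq_add_of_le (show k ≤ n by omega)
  have e0 : (i + ((k + m : ℕ) : ℤ) - (i + k)).toNat = m := by omega
  rw [e0] at hm
  obtain ⟨R, hR, e⟩ := stack_split X i k m
  have h3 := (matched_iff.1 h).2
  rw [e, List.find?_append] at h3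
  by_contra hs
  simp only [Bool.not_eq_false] at hs
  rcases hf : (stack X (i + k) m).find? fun l => (X l).serves (X (i + (k + m : ℕ))) with _ | y
  · exact List.find?_eq_none.1 hf _ hm hs
  · rw [hf] at h3
    simp only [Option.some_or, Option.some.injEq] at h3
    have := mem_stack (List.mem_of_find?_eq_some hf)
    omega

lemma Matched.left_unique {X : ℤ → Letter} {i i' j : ℤ} (h : Matched X i j)
    (h' : Matched X i' j) : i = i' := by
  have key : ∀ {i i' : ℤ}, Matched X i j → Matched X i' j → ¬ i < i' := by
    intro i i' h h' hlt
    have := h.not_serves hlt h'.1 (List.mem_of_find?_eq_some h'.2)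
    rw [h'.serves] at this
    exact absurd this (by simp)
  have h1 := key h h'
  have h2 := key h' h
  omega

lemma Matched.mem_of_le {X : ℤ → Letter} {i j k : ℤ} (h : Matched X i j) (h1 : i < k)
    (h2 : k ≤ j) : i ∈ stack X i (k - i).toNat := by
  obtain ⟨n, hn, rfl⟩ := h.exists_nat
  obtain ⟨l, rfl⟩ : ∃ l : ℕ, k = i + l := ⟨(k - i).toNat, by omega⟩
  obtain ⟨m, rfl⟩ := Nat.exists_eq_add_of_le (show l ≤ n by omega)
  have e0 : (i + (l : ℤ) - i).toNat = l := by omega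
  rw [e0]
  have hm := h.mem
  obtain ⟨R, hR, e⟩ := stack_split X i l m
  rw [e] at hm
  rcases List.mem_append.1 hm with hm | hm
  · have := mem_stack hm; omega
  · exact hR.subset hm

/-- Hamburger arcs do not cross. -/
lemma HamburgerArc.nested {X : ℤ → Letter} {i j i' j' : ℤ} (h : HamburgerArc X i j)
    (h' : HamburgerArc X i' j') (h1 : i < i') (h2 : i' ≤ j) : j' < j := by
  have hne : i' ≠ j := by
    rintro rfl
    have := serves_right h.1.serves
    rw [h'.2] at this
    simp [Letter.isBurger] at this
  have hne' : j' ≠ j := by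
    rintro rfl
    exact h1.ne (h.1.left_unique h'.1)
  by_contra hlt
  have := h.1.not_serves h1 (by omega) (h'.1.mem_of_le (k := j) (by omega) (by omega))
  rw [h'.2, ← h.2, h.1.serves] at this
  simp at this

/-! ### Reducible intervals and the matching -/

lemma Reducible.fst_nil {X : ℤ → Letter} {s t : ℤ} (h : Reducible X s t) {n : ℕ}
    (hn : s + n ≤ t + 1) : (red (wd X s n)).1 = [] :=
  fst_nil_of_le (n := (t + 1 - s).toNat) (by omega) (by rw [(reducible_iff.1 h).2])

lemma Reducible.stack_eq {X : ℤ → Letter} {s t : ℤ} (h : Reducible X s t) :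
    stack X s (t + 1 - s).toNat = [] := by
  have := stack_map X s (t + 1 - s).toNat
  rw [(reducible_iff.1 h).2] at this
  exact List.map_eq_nil_iff.1 this

lemma Reducible.stack_across {X : ℤ → Letter} {s t : ℤ} (h : Reducible X s t) (r : ℤ)
    (hr : r ≤ s) : stack X r (t + 1 - r).toNat = stack X r (s - r).toNat := by
  have hst := h.1
  have e : (t + 1 - r).toNat = (s - r).toNat + (t + 1 - s).toNat := by omega
  have e2 : r + ((s - r).toNat : ℤ) = s := by omega
  rw [e, stack_split_eq, e2, h.stack_eq, List.nil_append]
  rw [e2]; exact h.fst_nil (by omega)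

/-- A matched pair does not cross the boundary of a reducible interval. -/
lemma Reducible.matched_iff {X : ℤ → Letter} {s t : ℤ} (h : Reducible X s t) {i j : ℤ}
    (hm : Matched X i j) : (s ≤ i ∧ i ≤ t) ↔ (s ≤ j ∧ j ≤ t) := by
  have hij := hm.1
  constructor
  · rintro ⟨h1, h2⟩
    refine ⟨by omega, ?_⟩
    by_contra h3
    have h4 := hm.mem_of_le (k := t + 1) (by omega) (by omega)
    obtain ⟨R, hR, e⟩ := stack_split X s (i - s).toNat (t + 1 - i).toNat
    rw [show s + ((i - s).toNat : ℤ) = i by omega,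
      show (i - s).toNat + (t + 1 - i).toNat = (t + 1 - s).toNat by omega, h.stack_eq] at e
    rw [(List.append_eq_nil_iff.1 e.symm).1] at h4
    simp at h4
  · rintro ⟨h1, h2⟩
    refine ⟨?_, by omega⟩
    by_contra h3
    have hj := serves_right hm.serves
    have h4 := any_stack_of_fst_nil (X := X) (s := s) (m := (j - s).toNat)
      (h.fst_nil (by push_cast; omega)) (by rw [show s + ((j - s).toNat : ℤ) = j by omega]; simp [hj])
    rw [show s + ((j - s).toNat : ℤ) = j by omega] at h4
    obtain ⟨x, hx, hpx⟩ := List.any_eq_true.1 h4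
    obtain ⟨R, hR, e⟩ := stack_split X i (s - i).toNat (j - s).toNat
    rw [show i + ((s - i).toNat : ℤ) = s by omega,
      show (s - i).toNat + (j - s).toNat = (j - i).toNat by omega] at e
    have h5 := hm.2
    rw [e, List.find?_append] at h5
    rcases hf : (stack X s (j - s).toNat).find? fun l => (X l).serves (X j) with _ | y
    · exact List.find?_eq_none.1 hf _ hx hpx
    · rw [hf] at h5
      simp only [Option.some_or, Option.some.injEq] at h5
      have := mem_stack (List.mem_of_find?_eq_some hf)
      omega

lemma eraseP_congr_mem {α : Type*} {p q : α → Bool} {l : List α} (h : ∀ x ∈ l, p x = q x) :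
    l.eraseP p = l.eraseP q := by
  induction l with
  | nil => rfl
  | cons x l ih =>
    rw [List.eraseP_cons, List.eraseP_cons, h x List.mem_cons_self,
      ih fun y hy => h y (List.mem_cons_of_mem _ hy)]

lemma stack_congr {X X' : ℤ → Letter} {s : ℤ} {n : ℕ}
    (h : ∀ k, s ≤ k → k < s + n → X k = X' k) : stack X s n = stack X' s n := by
  induction n with
  | zero => rfl
  | succ n ih =>
    have ih := ih fun k h1 h2 => h k h1 (by push_cast; omega)
    have e := h (s + n) (by omega) (by push_cast; omega)
    rw [stack, stack, ih, e]
    split_ifs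
    · rfl
    · refine eraseP_congr_mem fun k hk => ?_
      have := mem_stack hk
      rw [h k this.1 (by push_cast; omega)]

lemma find?_congr_mem {α : Type*} {p q : α → Bool} {l : List α} (h : ∀ x ∈ l, p x = q x) :
    l.find? p = l.find? q := by
  induction l with
  | nil => rfl
  | cons x l ih =>
    rw [List.find?_cons, List.find?_cons, h x List.mem_cons_self,
      ih fun y hy => h y (List.mem_cons_of_mem _ hy)]

/-- The matching of `i` and `j` depends only on the letters between them. -/
lemma Matched.congr {X X' : ℤ → Letter} {i j : ℤ} (h : ∀ k, i ≤ k → k ≤ j → X k = X' k)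
    (hm : Matched X i j) : Matched X' i j := by
  have hij := hm.1
  refine ⟨hij, ?_⟩
  rw [← hm.2, stack_congr (X := X) (X' := X') fun k h1 h2 => h k h1 (by omega)]
  refine find?_congr_mem fun k hk => ?_
  have := mem_stack hk
  rw [h k this.1 (by omega), h j (by omega) le_rfl]

end BurgerWord

namespace BurgerWord

/-! ### Faces and the two graphs -/

lemma V_eq_iff {X : ℤ → Letter} {u v : ℤ} :
    V X u = V X v ↔ ∀ i j, HamburgerArc X i j → ((i < u ∧ u ≤ j) ↔ (i < v ∧ v ≤ j)) :=
  Quotient.eq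

lemma HamburgerArc.lt {X : ℤ → Letter} {i j : ℤ} (h : HamburgerArc X i j) : i < j := h.1.1

lemma HamburgerArc.right_unique {X : ℤ → Letter} {i j j' : ℤ} (h : HamburgerArc X i j)
    (h' : HamburgerArc X i j') : j = j' := h.1.right_unique h'.1

lemma HamburgerArc.inner {X : ℤ → Letter} {i j : ℤ} (h : HamburgerArc X i j) :
    V X (i + 1) = V X j := by
  refine V_eq_iff.2 fun i' j' h' => ?_
  have := h.lt
  have := h'.lt
  rcases lt_trichotomy i' i with h1 | rfl | h1
  · have := fun h2 => h'.nested h h1 h2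
    omega
  · have := h.right_unique h'
    omega
  · have := fun h2 => h.nested h' h1 h2
    omega

lemma HamburgerArc.outer {X : ℤ → Letter} {i j : ℤ} (h : HamburgerArc X i j) :
    V X i = V X (j + 1) := by
  refine V_eq_iff.2 fun i' j' h' => ?_
  have := h.lt
  have := h'.lt
  rcases lt_trichotomy i' i with h1 | rfl | h1
  · have := fun h2 => h'.nested h h1 h2
    omega
  · have := h.right_unique h'
    omega
  · have := fun h2 => h.nested h' h1 h2
    omega

lemma V_succ_eq {X : ℤ → Letter} {u : ℤ} (h1 : ∀ j, ¬ HamburgerArc X u j)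
    (h2 : ∀ i, ¬ HamburgerArc X i u) : V X u = V X (u + 1) := by
  refine V_eq_iff.2 fun i j h => ?_
  have h3 : i ≠ u := by rintro rfl; exact h1 _ h
  have h4 : j ≠ u := by rintro rfl; exact h2 _ h
  omega

/-- The edges of the spanning tree, together with those crossing the cheeseburger arcs if `b` is
true, as pairs of times. -/
def Edge (b : Bool) (X : ℤ → Letter) (u v : ℤ) : Prop :=
  (∃ j, HamburgerArc X u j ∧ v = u + 1) ∨ (b = true ∧ CheeseburgerArc X u v)

/-- The spanning tree (`b = false`) or the map (`b = true`). -/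
def graph (b : Bool) (X : ℤ → Letter) : SimpleGraph (Vertex X) :=
  SimpleGraph.fromRel fun x y => ∃ u v, Edge b X u v ∧ x = V X u ∧ y = V X v

lemma graph_false (X : ℤ → Letter) : graph false X = treeGraph X := by
  unfold graph treeGraph
  congr 1
  ext x y
  constructor
  · rintro ⟨u, v, ⟨j, h, rfl⟩ | ⟨h, -⟩, hx, hy⟩
    · exact ⟨u, j, h, hx, hy⟩
    · simp at h
  · rintro ⟨i, j, h, hx, hy⟩
    exact ⟨i, i + 1, Or.inl ⟨j, h, rfl⟩, hx, hy⟩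

lemma graph_true (X : ℤ → Letter) : graph true X = mapGraph X := by
  rw [mapGraph, ← graph_false]
  ext x y
  simp only [graph, SimpleGraph.sup_adj, SimpleGraph.fromRel_adj, Edge, Bool.false_eq_true,
    false_and, or_false, true_and]
  constructor
  · rintro ⟨hne, ⟨u, v, h | h, hx, hy⟩ | ⟨u, v, h | h, hx, hy⟩⟩
    · exact Or.inl ⟨hne, Or.inl ⟨u, v, h, hx, hy⟩⟩
    · exact Or.inr ⟨hne, Or.inl ⟨u, v, h, hx, hy⟩⟩
    · exact Or.inl ⟨hne, Or.inr ⟨u, v, h, hx, hy⟩⟩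
    · exact Or.inr ⟨hne, Or.inr ⟨u, v, h, hx, hy⟩⟩
  · rintro (⟨hne, ⟨u, v, h, hx, hy⟩ | ⟨u, v, h, hx, hy⟩⟩ |
      ⟨hne, ⟨u, v, h, hx, hy⟩ | ⟨u, v, h, hx, hy⟩⟩)
    · exact ⟨hne, Or.inl ⟨u, v, Or.inl h, hx, hy⟩⟩
    · exact ⟨hne, Or.inr ⟨u, v, Or.inl h, hx, hy⟩⟩
    · exact ⟨hne, Or.inl ⟨u, v, Or.inr h, hx, hy⟩⟩
    · exact ⟨hne, Or.inr ⟨u, v, Or.inr h, hx, hy⟩⟩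

/-- The graph distance between the faces above two segments. -/
noncomputable def gdist (b : Bool) (X : ℤ → Letter) (u v : ℤ) : ℕ :=
  (graph b X).dist (V X u) (V X v)

lemma Edge.reachable {b : Bool} {X : ℤ → Letter} {u v : ℤ} (h : Edge b X u v) :
    (graph b X).Reachable (V X u) (V X v) := by
  by_cases hne : V X u = V X v
  · rw [hne]
  · exact SimpleGraph.Adj.reachable ((SimpleGraph.fromRel_adj _ _ _).2
      ⟨hne, Or.inl ⟨u, v, h, rfl, rfl⟩⟩)

/-- Consecutive segments lie in the same face or are separated by a single hamburger arc.
Connectedness is needed because `SimpleGraph.dist` is $0$ between unreachable vertices, which would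
break the triangle inequality. -/
lemma graph_preconnected (b : Bool) (X : ℤ → Letter) : (graph b X).Preconnected := by
  have key : ∀ u, (graph b X).Reachable (V X u) (V X (u + 1)) := by
    intro u
    by_cases h1 : ∃ j, HamburgerArc X u j
    · obtain ⟨j, h⟩ := h1
      exact Edge.reachable (Or.inl ⟨j, h, rfl⟩)
    by_cases h2 : ∃ i, HamburgerArc X i u
    · obtain ⟨i, h⟩ := h2
      rw [← h.inner, ← h.outer]
      exact (Edge.reachable (Or.inl ⟨u, h, rfl⟩)).symm
    · push Not at h1 h2
      rw [V_succ_eq h1 h2]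
  have key2 : ∀ (n : ℕ) u, (graph b X).Reachable (V X u) (V X (u + n)) := by
    intro n u
    induction n with
    | zero => simp
    | succ n ih => push_cast; rw [← add_assoc]; exact ih.trans (key _)
  intro x y
  induction x using Quotient.inductionOn with | h u => ?_
  induction y using Quotient.inductionOn with | h v => ?_
  change (graph b X).Reachable (V X u) (V X v)
  rcases le_total u v with h | h
  · obtain ⟨n, rfl⟩ : ∃ n : ℕ, v = u + n := ⟨(v - u).toNat, by omega⟩
    exact key2 n u
  · obtain ⟨n, rfl⟩ : ∃ n : ℕ, u = v + n := ⟨(u - v).toNat, by omega⟩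
    exact (key2 n v).symm

lemma graph_connected (b : Bool) (X : ℤ → Letter) : (graph b X).Connected :=
  (SimpleGraph.connected_iff _).2 ⟨graph_preconnected b X, ⟨V X 0⟩⟩

lemma gdist_triangle (b : Bool) (X : ℤ → Letter) (u v w : ℤ) :
    gdist b X u w ≤ gdist b X u v + gdist b X v w := (graph_connected b X).dist_triangle

lemma gdist_comm (b : Bool) (X : ℤ → Letter) (u v : ℤ) : gdist b X u v = gdist b X v u :=
  SimpleGraph.dist_comm

@[simp] lemma gdist_self (b : Bool) (X : ℤ → Letter) (u : ℤ) : gdist b X u u = 0 :=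
  SimpleGraph.dist_self

lemma gdist_congr {b : Bool} {X : ℤ → Letter} {u v u' v' : ℤ} (h : V X u = V X u')
    (h' : V X v = V X v') : gdist b X u v = gdist b X u' v' := by
  rw [gdist, h, h']; rfl

lemma gdist_eq_zero {b : Bool} {X : ℤ → Letter} {u v : ℤ} (h : V X u = V X v) :
    gdist b X u v = 0 := by
  rw [gdist_congr h rfl, gdist_self]

lemma Edge.gdist_le {b : Bool} {X : ℤ → Letter} {u v : ℤ} (h : Edge b X u v) :
    gdist b X u v ≤ 1 := by
  by_cases hne : V X u = V X v
  · rw [gdist_eq_zero hne]; exact zero_le_one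
  · exact (SimpleGraph.dist_eq_one_iff_adj.2 ((SimpleGraph.fromRel_adj _ _ _).2
      ⟨hne, Or.inl ⟨u, v, h, rfl, rfl⟩⟩)).le

lemma gdist_true_le (X : ℤ → Letter) (u v : ℤ) : gdist true X u v ≤ gdist false X u v := by
  refine SimpleGraph.Reachable.dist_anti ?_ (graph_preconnected false X _ _)
  rw [graph_true, graph_false]
  exact le_sup_left

/-- A function of the faces that changes by at most one along the edges is `1`-Lipschitz. -/
lemma le_add_gdist {b : Bool} {X : ℤ → Letter} (f : ℤ → ℕ)
    (hV : ∀ u v, V X u = V X v → f u = f v)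
    (hE : ∀ u v, Edge b X u v → f u ≤ f v + 1 ∧ f v ≤ f u + 1) (u v : ℤ) :
    f v ≤ f u + gdist b X u v := by
  let F : Vertex X → ℕ := Quotient.lift f fun u v h => hV u v (Quotient.sound h)
  have hF : ∀ u, F (V X u) = f u := fun _ => rfl
  obtain ⟨p, hp⟩ := (graph_preconnected b X (V X u) (V X v)).exists_walk_length_eq_dist
  have key : ∀ {x y : Vertex X} (p : (graph b X).Walk x y), F y ≤ F x + p.length := by
    intro x y p
    induction p with
    | nil => simp
    | cons h p ih =>
      rw [SimpleGraph.Walk.length_cons]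
      obtain ⟨-, ⟨u, v, he, rfl, rfl⟩ | ⟨u, v, he, rfl, rfl⟩⟩ := (SimpleGraph.fromRel_adj _ _ _).1 h
      · have := hE u v he
        rw [hF] at ih ⊢
        omega
      · have := hE u v he
        rw [hF] at ih ⊢
        omega
  have := key p
  rwa [hp, hF, hF] at this

/-! ### Height bound -/

/-- While the hamburger of time $s+k$ is in the stack, no hamburger below it can be consumed, since
every order that accepts a hamburger would take the fresher one first. Cheeseburgers below may
disappear, so only the hamburger count is preserved. -/
lemma stack_filter_restored {X : ℤ → Letter} {s : ℤ} {k : ℕ} (hk : X (s + k) = Letter.a) (m : ℕ)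
    (hm : s + k ∈ stack X s (k + 1 + m)) : ∃ pre post,
      stack X s (k + 1 + m) = pre ++ (s + k : ℤ) :: post ∧
      post.countP (fun i => X i = Letter.a) = (stack X s k).countP (fun i => X i = Letter.a) := by
  induction m with
  | zero =>
    refine ⟨[], stack X s k, ?_, rfl⟩
    rw [add_zero, stack, if_pos (by rw [hk]; rfl)]; rfl
  | succ m ih =>
    have hnd := stack_nodup X s (k + 1 + m)
    rw [← add_assoc, stack] at hm ⊢
    split_ifs at hm ⊢ with h1
    · obtain ⟨pre, post, e, h⟩ := ih (by
        rcases List.mem_cons.1 hm with h | h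
        · push_cast at h; omega
        · exact h)
      exact ⟨_ :: pre, post, by rw [e]; rfl, h⟩
    · obtain ⟨pre, post, e, h⟩ := ih (List.mem_of_mem_eraseP hm)
      rw [e] at hm ⊢ hnd
      rw [eraseP_append_any] at hm ⊢
      split_ifs at hm ⊢ with h2
      · exact ⟨_, post, rfl, h⟩
      · rw [List.eraseP_cons] at hm ⊢
        rw [List.nodup_append, List.nodup_cons] at hnd
        by_cases h3 : (X (s + k)).serves (X (s + (k + 1 + m : ℕ)))
        · rw [h3, cond_true] at hm
          rcases List.mem_append.1 hm with h4 | h4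
          · exact absurd rfl (hnd.2.2 _ h4 _ List.mem_cons_self)
          · exact absurd h4 hnd.2.1.1
        · simp only [h3, cond_false]
          refine ⟨pre, _, rfl, ?_⟩
          rw [← h, List.countP_eq_length_filter, List.countP_eq_length_filter]
          congr 1
          by_cases h5 : post.any fun i => (X i).serves (X (s + (k + 1 + m : ℕ)))
          · obtain ⟨z, hz, hpz⟩ := List.any_eq_true.1 h5
            obtain ⟨y, l₁, l₂, -, hy, e1, e2⟩ := List.exists_of_eraseP
              (p := fun i => (X i).serves (X (s + (k + 1 + m : ℕ)))) hz hpz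
            rw [e2, e1, List.filter_append, List.filter_append, List.filter_cons_of_neg]
            simp only [decide_eq_true_eq]
            intro hy2
            rw [hk] at h3
            rw [hy2] at hy
            exact h3 hy
          · rw [eraseP_of_not_any _ _ h5]

/-- The distance in the tree from the beginning of a word without unfulfilled orders is at most the
number of hamburgers in the stack. -/
lemma gdist_false_le_countP {X : ℤ → Letter} {s : ℤ} (n : ℕ) (h : (red (wd X s n)).1 = []) :
    gdist false X s (s + n) ≤ (stack X s n).countP fun i => X i = Letter.a := by
  induction n using Nat.strong_induction_on with | _ n ih => ?_
  rcases n with _ | n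
  · simp
  have h0 := fst_nil_of_le (Nat.le_succ n) h
  have ih0 := ih n (Nat.lt_succ_self n) h0
  push_cast
  rw [← add_assoc]
  by_cases h1 : (X (s + n)).isBurger
  · have e : stack X s (n + 1) = (s + n : ℤ) :: stack X s n := by rw [stack, if_pos h1]
    have h2 : ∀ i, ¬ HamburgerArc X i (s + n) := by
      intro i hi
      have := serves_right hi.1.serves
      rw [h1] at this; simp at this
    by_cases h3 : ∃ j, HamburgerArc X (s + n) j
    · obtain ⟨j, hj⟩ := h3
      have h4 : gdist false X (s + n) (s + n + 1) ≤ 1 := Edge.gdist_le (Or.inl ⟨j, hj, rfl⟩)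
      have h5 := gdist_triangle false X s (s + n) (s + n + 1)
      rw [e, List.countP_cons_of_pos (by simp [hj.2])]
      omega
    · push Not at h3
      rw [gdist_congr rfl (V_succ_eq h3 h2).symm, e, List.countP_cons]
      omega
  · have h2 := any_stack_of_fst_nil h h1
    obtain ⟨y, hy⟩ : ∃ y, (stack X s n).find? (fun i => (X i).serves (X (s + n))) = some y := by
      rw [← Option.isSome_iff_exists, List.find?_isSome]
      simpa using List.any_eq_true.1 h2
    have hys := mem_stack (List.mem_of_find?_eq_some hy)
    obtain ⟨k, rfl⟩ : ∃ k : ℕ, y = s + k := ⟨(y - s).toNat, by omega⟩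
    obtain ⟨m, rfl⟩ : ∃ m : ℕ, n = k + 1 + m := ⟨n - (k + 1), by omega⟩
    have hM : Matched X (s + k) (s + (k + 1 + m : ℕ)) := by
      refine ⟨by push_cast; omega, ?_⟩
      obtain ⟨R, hR, e⟩ := stack_split X s k (1 + m)
      rw [← add_assoc] at e
      rw [show (s + ((k + 1 + m : ℕ) : ℤ) - (s + k)).toNat = 1 + m by push_cast; omega]
      rw [e, List.find?_append] at hy
      rcases hf : (stack X (s + k) (1 + m)).find? fun l =>
        (X l).serves (X (s + (k + 1 + m : ℕ))) with _ | z
      · rw [hf, Option.none_or] at hy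
        have := mem_stack (hR.subset (List.mem_of_find?_eq_some hy))
        omega
      · rw [hf] at hy; simpa using hy
    have e : stack X s (k + 1 + m + 1) =
      (stack X s (k + 1 + m)).eraseP fun i => (X i).serves (X (s + (k + 1 + m : ℕ))) := by
      rw [stack, if_neg h1]
    by_cases ha : X (s + k) = Letter.a
    · have hA : HamburgerArc X (s + k) (s + (k + 1 + m : ℕ)) := ⟨hM, ha⟩
      obtain ⟨pre, post, e1, e2⟩ := stack_filter_restored ha m (List.mem_of_find?_eq_some hy)
      rw [gdist_congr rfl hA.outer.symm]
      refine (ih k (by omega) (fst_nil_of_le (by omega) h0)).trans ?_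
      rw [e, e1, ← e2, List.eraseP_append_right, List.countP_append,
        List.eraseP_cons_of_pos (by exact hM.serves)]
      · omega
      · intro b hb hb2
        rw [e1, List.find?_eq_some_iff_append] at hy
        obtain ⟨-, as, bs, e3, h4⟩ := hy
        have hnd := stack_nodup X s (k + 1 + m)
        rw [e1] at hnd
        have hp : pre = as := by
          have h5 : (s + k : ℤ) ∉ pre := fun h6 =>
            (List.nodup_append.1 hnd).2.2 _ h6 _ List.mem_cons_self rfl
          have h6 : (s + k : ℤ) ∉ post :=
            (List.nodup_cons.1 (List.nodup_append.1 hnd).2.1).1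
          exact (List.append_cons_inj_of_notMem h5 h6).1 e3 |>.1
        have := h4 b (hp ▸ hb)
        rw [hb2] at this; simp at this
    · have h3 : ∀ i, ¬ HamburgerArc X i (s + (k + 1 + m : ℕ)) := by
        intro i hi
        have := hi.1.left_unique hM
        subst this
        exact ha hi.2
      have h4 : ∀ j, ¬ HamburgerArc X (s + (k + 1 + m : ℕ)) j := by
        intro j hj
        rw [hj.2] at h1
        exact h1 rfl
      rw [gdist_congr rfl (V_succ_eq h4 h3).symm]
      refine ih0.trans (le_of_eq ?_)
      obtain ⟨l₁, l₂, e1, h5⟩ := (List.find?_eq_some_iff_append.1 hy).2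
      rw [e, e1, List.eraseP_append_right, List.eraseP_cons_of_pos (by exact hM.serves),
        List.countP_append, List.countP_append, List.countP_cons_of_neg (by simpa using ha)]
      intro b hb; simpa using h5 b hb

lemma gdist_false_le {X : ℤ → Letter} {s : ℤ} (n : ℕ) (h : (red (wd X s n)).1 = []) :
    (gdist false X s (s + n) : ℤ) ≤ netCount (wd X s n) := by
  rw [netCount_eq, h, ← stack_length]
  simpa using (gdist_false_le_countP n h).trans List.countP_le_length

end BurgerWord

namespace BurgerWord

/-! ### Deleting a reducible interval -/

/-- The increasing enumeration of the complement of `[-m, n-1]`. -/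
def emb (m n : ℕ) (k : ℤ) : ℤ := if 0 ≤ k then k + n else k - m

/-- The word obtained by deleting the letters in `[-m, n-1]`. -/
def collapse (m n : ℕ) (X : ℤ → Letter) : ℤ → Letter := fun k => X (emb m n k)

/-- The left inverse of `emb` that sends the deleted interval to `0`. -/
def unemb (m n : ℕ) (u : ℤ) : ℤ := if (n : ℤ) ≤ u then u - n else if u ≤ -m then u + m else 0

lemma emb_of_nonneg {m n : ℕ} {k : ℤ} (h : 0 ≤ k) : emb m n k = k + n := if_pos h
lemma emb_of_neg {m n : ℕ} {k : ℤ} (h : k < 0) : emb m n k = k - m := if_neg (not_le.2 h)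

lemma unemb_emb (m n : ℕ) (k : ℤ) : unemb m n (emb m n k) = k := by
  unfold emb unemb; split_ifs <;> omega

lemma emb_lt_iff {m n : ℕ} {k l : ℤ} : emb m n k < emb m n l ↔ k < l := by
  unfold emb; split_ifs <;> omega

lemma emb_injective (m n : ℕ) : Function.Injective (emb m n) := fun k l h => by
  rw [← unemb_emb m n k, h, unemb_emb]

lemma exists_emb {m n : ℕ} {u : ℤ} (h : u < -m ∨ (n : ℤ) ≤ u) : ∃ k, u = emb m n k := by
  rcases h with h | h
  · exact ⟨u + m, by rw [emb_of_neg (by omega)]; omega⟩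
  · exact ⟨u - n, by rw [emb_of_nonneg (by omega)]; omega⟩

lemma emb_outside (m n : ℕ) (k : ℤ) : emb m n k < -m ∨ (n : ℤ) ≤ emb m n k := by
  unfold emb; split_ifs <;> omega

/-- A reducible interval leaves the stack below it untouched, so the stacks of the two words
correspond at all times outside it. -/
lemma stack_collapse {X : ℤ → Letter} {m n : ℕ} (h : Reducible X (-m) (n - 1)) (i : ℤ) (k : ℕ) :
    (stack (collapse m n X) i k).map (emb m n) =
      stack X (emb m n i) (emb m n (i + k) - emb m n i).toNat := by
  induction k with
  | zero => simp [stack]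
  | succ k ih =>
    have e1 : stack X (emb m n i) (emb m n (i + (k + 1 : ℕ)) - emb m n i).toNat =
        stack X (emb m n i) ((emb m n (i + k) - emb m n i).toNat + 1) := by
      have hle : emb m n i ≤ emb m n (i + k) := by
        by_contra hh
        have := emb_lt_iff.1 (not_le.1 hh)
        omega
      -- The step from $-1$ to $0$ is the only one at which the original word also has to cross the
      -- deleted interval.
      by_cases hk : i + k = -1
      · have := h.stack_across (emb m n i) (by rw [emb_of_neg (by omega)]; omega)
        rw [show i + ((k + 1 : ℕ) : ℤ) = 0 by push_cast; omega, hk, emb_of_nonneg le_rfl]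
        rw [show (n : ℤ) - 1 + 1 = 0 + n by ring] at this
        rw [this, emb_of_neg (k := -1) (by norm_num)]
        congr 1
        rw [hk, emb_of_neg (k := -1) (by norm_num)] at hle
        omega
      · congr 1
        have : emb m n (i + (k + 1 : ℕ)) = emb m n (i + k) + 1 := by
          unfold emb; push_cast; split_ifs <;> omega
        omega
    have e2 : emb m n i + ((emb m n (i + k) - emb m n i).toNat : ℤ) = emb m n (i + k) := by
      have hle : emb m n i ≤ emb m n (i + k) := by
        by_contra hh
        have := emb_lt_iff.1 (not_le.1 hh)
        omega
      omega
    rw [e1, stack, stack, e2, ← ih]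
    change _ = if (collapse m n X (i + k)).isBurger = true then _ else _
    split_ifs with h1
    · rfl
    · rw [List.eraseP_map]; rfl

lemma matched_collapse {X : ℤ → Letter} {m n : ℕ} (h : Reducible X (-m) (n - 1)) {i j : ℤ} :
    Matched (collapse m n X) i j ↔ Matched X (emb m n i) (emb m n j) := by
  unfold Matched
  rw [emb_lt_iff]
  refine and_congr_right fun hij => ?_
  have := stack_collapse h i (j - i).toNat
  rw [show i + ((j - i).toNat : ℤ) = j by omega] at this
  rw [← this, List.find?_map, Option.map_eq_some_iff]
  constructor
  · intro hf
    exact ⟨i, hf, rfl⟩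
  · rintro ⟨k, hf, hk⟩
    obtain rfl := emb_injective m n hk
    exact hf

lemma hamburgerArc_collapse {X : ℤ → Letter} {m n : ℕ} (h : Reducible X (-m) (n - 1)) {i j : ℤ} :
    HamburgerArc (collapse m n X) i j ↔ HamburgerArc X (emb m n i) (emb m n j) :=
  and_congr (matched_collapse h) Iff.rfl

lemma cheeseburgerArc_collapse {X : ℤ → Letter} {m n : ℕ} (h : Reducible X (-m) (n - 1))
    {i j : ℤ} :
    CheeseburgerArc (collapse m n X) i j ↔ CheeseburgerArc X (emb m n i) (emb m n j) :=
  and_congr (matched_collapse h) Iff.rfl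

/-- A map of times that pulls back hamburger arcs to hamburger arcs, or to trivial conditions, acts
on the faces. -/
lemma V_map {X X' : ℤ → Letter} (f : ℤ → ℤ)
    (h : ∀ i j, HamburgerArc X' i j →
      (∃ i' j', HamburgerArc X i' j' ∧ ∀ u, (i < f u ∧ f u ≤ j) ↔ (i' < u ∧ u ≤ j')) ∨
      ∀ u v, (i < f u ∧ f u ≤ j) → (i < f v ∧ f v ≤ j)) {u v : ℤ} (huv : V X u = V X v) :
    V X' (f u) = V X' (f v) := by
  refine V_eq_iff.2 fun i j hij => ?_
  rcases h i j hij with ⟨i', j', h', hf⟩ | hf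
  · rw [hf, hf]; exact V_eq_iff.1 huv i' j' h'
  · exact ⟨hf u v, hf v u⟩

lemma Reducible.V_eq {X : ℤ → Letter} {s t : ℤ} (h : Reducible X s t) : V X s = V X (t + 1) := by
  refine V_eq_iff.2 fun i j hij => ?_
  have := h.matched_iff hij.1
  have := hij.lt
  have := h.1
  omega

lemma Reducible.congr {X X' : ℤ → Letter} {s t : ℤ} (h : Reducible X s t)
    (hX : ∀ k, s ≤ k → k ≤ t → X k = X' k) : Reducible X' s t := by
  have := h.1
  refine reducible_iff.2 ⟨h.1, ?_⟩
  rw [← (reducible_iff.1 h).2]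
  congr 1
  exact wd_congr fun k hk => (hX _ (by omega) (by omega)).symm

/-- The projection of the line onto the segments adjacent to `[s, t]`. -/
def clamp (s t u : ℤ) : ℤ := if s ≤ u ∧ u ≤ t + 1 then u else s

lemma clamp_cases (s t u : ℤ) :
    (s ≤ u ∧ u ≤ t + 1 ∧ clamp s t u = u) ∨ ((u < s ∨ t + 1 < u) ∧ clamp s t u = s) := by
  unfold clamp; split_ifs <;> omega

/-! ### Distances inside a reducible interval -/

section Clamp
variable {X X' : ℤ → Letter} {s t : ℤ} 

/-- An arc with an end in $[s,t]$ has both ends there and depends only on the letters between them,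
so it is an arc of both words. Any other arc passes above all of the segments $s,\dots,t+1$ or above
none, and does not separate points in the image of `clamp`. -/
lemma V_clamp (h : Reducible X s t) (hX : ∀ k, s ≤ k → k ≤ t → X k = X' k) {u v : ℤ}
    (huv : V X u = V X v) : V X' (clamp s t u) = V X' (clamp s t v) := by
  have h' := h.congr hX
  refine V_map _ (fun i j hij => ?_) huv
  have hm := h'.matched_iff hij.1
  have := hij.lt
  by_cases hi : s ≤ i ∧ i ≤ t
  · refine Or.inl ⟨i, j, ⟨hij.1.congr fun k h1 h2 => (hX k (by omega) (by omega)).symm, ?_⟩,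
      fun u => ?_⟩
    · rw [hX i hi.1 hi.2]; exact hij.2
    · have := clamp_cases s t u
      omega
  · refine Or.inr fun u v => ?_
    have := clamp_cases s t u
    have := clamp_cases s t v
    have := h.1
    omega

lemma V_clamp_outside (h : Reducible X' s t) {u v : ℤ} (hu : u ≤ s ∨ t < u) (hv : v ≤ s ∨ t < v) :
    V X' (clamp s t u) = V X' (clamp s t v) := by
  have key : ∀ u, u ≤ s ∨ t < u → V X' (clamp s t u) = V X' s := by
    intro u hu
    rcases clamp_cases s t u with ⟨h1, h2, h3⟩ | ⟨h1, h3⟩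
    · rw [h3]
      rcases hu with hu | hu
      · rw [le_antisymm hu h1]
      · rw [show u = t + 1 by omega, h.V_eq]
    · rw [h3]
  rw [key u hu, key v hv]

lemma Edge.inside {b : Bool} (h : Reducible X s t) {u v : ℤ} (he : Edge b X u v)
    (hu : s ≤ u ∧ u ≤ t) : s ≤ v ∧ v ≤ t + 1 := by
  rcases he with ⟨j, h1, rfl⟩ | ⟨-, h1⟩
  · omega
  · have := h.matched_iff h1.1
    omega

lemma Edge.outside {b : Bool} (h : Reducible X s t) {u v : ℤ} (he : Edge b X u v)
    (hu : u < s ∨ t < u) : v ≤ s ∨ t < v := by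
  rcases he with ⟨j, h1, rfl⟩ | ⟨-, h1⟩
  · omega
  · have := h.matched_iff h1.1
    omega

lemma Edge.clamp {b : Bool} (h : Reducible X s t) (hX : ∀ k, s ≤ k → k ≤ t → X k = X' k) {u v : ℤ}
    (he : Edge b X u v) : gdist b X' (clamp s t u) (clamp s t v) ≤ 1 := by
  by_cases hu : s ≤ u ∧ u ≤ t
  · have hv := he.inside h hu
    rw [BurgerWord.clamp, if_pos (by omega), BurgerWord.clamp, if_pos hv]
    refine Edge.gdist_le ?_
    rcases he with ⟨j, h1, rfl⟩ | ⟨hb, h1⟩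
    · have hm := h.matched_iff h1.1
      exact Or.inl ⟨j, ⟨h1.1.congr fun k _ _ => hX k (by omega) (by omega),
        by rw [← hX u hu.1 hu.2]; exact h1.2⟩, rfl⟩
    · have hm := h.matched_iff h1.1
      exact Or.inr ⟨hb, ⟨h1.1.congr fun k _ _ => hX k (by omega) (by omega),
        by rw [← hX u hu.1 hu.2]; exact h1.2⟩⟩
  · rw [gdist_eq_zero (V_clamp_outside (h.congr hX) (by omega) (he.outside h (by omega)))]
    exact zero_le_one

/-- The distances inside a reducible interval depend only on its letters. -/
lemma gdist_le_of_agree (b : Bool) (h : Reducible X s t) (hX : ∀ k, s ≤ k → k ≤ t → X k = X' k)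
    {u v : ℤ} (hu : s ≤ u ∧ u ≤ t + 1) (hv : s ≤ v ∧ v ≤ t + 1) :
    gdist b X' u v ≤ gdist b X u v := by
  have := le_add_gdist (b := b) (X := X) (fun w => gdist b X' u (BurgerWord.clamp s t w))
    (fun w w' hw => gdist_congr rfl (V_clamp h hX hw))
    (fun w w' he => by
      have h1 := he.clamp h hX
      have h2 := gdist_triangle b X' u (BurgerWord.clamp s t w) (BurgerWord.clamp s t w')
      have h3 := gdist_triangle b X' u (BurgerWord.clamp s t w') (BurgerWord.clamp s t w)
      have h4 := gdist_comm b X' (BurgerWord.clamp s t w) (BurgerWord.clamp s t w')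
      omega) u v
  simpa [BurgerWord.clamp, hu, hv] using this

lemma gdist_eq_of_agree (b : Bool) (h : Reducible X s t) (hX : ∀ k, s ≤ k → k ≤ t → X k = X' k)
    {u v : ℤ} (hu : s ≤ u ∧ u ≤ t + 1) (hv : s ≤ v ∧ v ≤ t + 1) :
    gdist b X' u v = gdist b X u v :=
  le_antisymm (gdist_le_of_agree b h hX hu hv)
    (gdist_le_of_agree b (h.congr hX) (fun k h1 h2 => (hX k h1 h2).symm) hu hv)

end Clamp

/-! ### The pinch point of a reducible interval as a cut vertex -/

section Collapse
variable {X : ℤ → Letter} {m n : ℕ}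

lemma V_emb (h : Reducible X (-m) (n - 1)) {u v : ℤ}
    (huv : V (collapse m n X) u = V (collapse m n X) v) :
    V X (emb m n u) = V X (emb m n v) := by
  refine V_map _ (fun i j hij => ?_) huv
  have hm := h.matched_iff hij.1
  have := hij.lt
  by_cases hi : -m ≤ i ∧ i ≤ n - 1
  · refine Or.inr fun u v => ?_
    have := emb_outside m n u
    omega
  · obtain ⟨i', rfl⟩ : ∃ k, i = emb m n k := exists_emb (by omega)
    obtain ⟨j', rfl⟩ : ∃ k, j = emb m n k := exists_emb (by omega)
    refine Or.inl ⟨i', j', (hamburgerArc_collapse h).2 hij, fun u => ?_⟩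
    rw [emb_lt_iff, ← not_lt, emb_lt_iff, not_lt]

lemma Edge.emb {b : Bool} (h : Reducible X (-m) (n - 1)) {u v : ℤ}
    (he : Edge b (collapse m n X) u v) :
    gdist b X (emb m n u) (emb m n v) ≤ 1 := by
  rcases he with ⟨j, h1, rfl⟩ | ⟨hb, h1⟩
  · have e : V X (BurgerWord.emb m n (u + 1)) = V X (BurgerWord.emb m n u + 1) := by
      -- The images of $-1$ and $0$ are not consecutive, but the missing step is bridged by
      -- $V(-m)=V(n)$.
      by_cases hu : u = -1
      · have := h.V_eq
        subst hu
        rw [emb_of_nonneg (by norm_num), emb_of_neg (by norm_num)]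
        rw [show (-1 : ℤ) - m + 1 = -m by ring, this]
        congr 1; ring
      · congr 1
        unfold BurgerWord.emb; split_ifs <;> omega
    rw [gdist_congr rfl e]
    exact Edge.gdist_le (Or.inl ⟨_, (hamburgerArc_collapse h).1 h1, rfl⟩)
  · exact Edge.gdist_le (Or.inr ⟨hb, (cheeseburgerArc_collapse h).1 h1⟩)

lemma gdist_emb_le (b : Bool) (h : Reducible X (-m) (n - 1)) (u v : ℤ) :
    gdist b X (emb m n u) (emb m n v) ≤ gdist b (collapse m n X) u v := by
  have := le_add_gdist (b := b) (X := collapse m n X) (fun w => gdist b X (emb m n u) (emb m n w))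
    (fun w w' hw => gdist_congr rfl (V_emb h hw))
    (fun w w' he => by
      have h1 := he.emb h
      have h2 := gdist_triangle b X (emb m n u) (emb m n w) (emb m n w')
      have h3 := gdist_triangle b X (emb m n u) (emb m n w') (emb m n w)
      have h4 := gdist_comm b X (emb m n w) (emb m n w')
      omega) u v
  simpa using this

lemma unemb_inside {u : ℤ} (hu : -m ≤ u ∧ u ≤ n) : unemb m n u = 0 := by
  unfold unemb; split_ifs <;> omega

lemma V_unemb (h : Reducible X (-m) (n - 1)) {u v : ℤ} (huv : V X u = V X v) :
    V (collapse m n X) (unemb m n u) = V (collapse m n X) (unemb m n v) := by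
  refine V_map _ (fun i j hij => ?_) huv
  refine Or.inl ⟨_, _, (hamburgerArc_collapse h).1 hij, fun u => ?_⟩
  have := hij.lt
  unfold unemb emb
  split_ifs <;> omega

lemma Edge.unemb {b : Bool} (h : Reducible X (-m) (n - 1)) {u v : ℤ} (he : Edge b X u v)
    (hu : u < -m ∨ n - 1 < u) :
    gdist b (collapse m n X) (unemb m n u) (unemb m n v) ≤ 1 := by
  refine Edge.gdist_le ?_
  rcases he with ⟨j, h1, rfl⟩ | ⟨hb, h1⟩
  · have hm := h.matched_iff h1.1
    obtain ⟨u', rfl⟩ : ∃ k, u = BurgerWord.emb m n k := exists_emb (by omega)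
    obtain ⟨j', rfl⟩ : ∃ k, j = BurgerWord.emb m n k := exists_emb (by omega)
    refine Or.inl ⟨j', ?_, ?_⟩
    · rw [unemb_emb]; exact (hamburgerArc_collapse h).2 h1
    · rw [unemb_emb]; unfold BurgerWord.unemb BurgerWord.emb; split_ifs <;> omega
  · have hm := h.matched_iff h1.1
    obtain ⟨u', rfl⟩ : ∃ k, u = BurgerWord.emb m n k := exists_emb (by omega)
    obtain ⟨j', rfl⟩ : ∃ k, v = BurgerWord.emb m n k := exists_emb (by omega)
    refine Or.inr ⟨hb, ?_⟩
    rw [unemb_emb, unemb_emb]; exact (cheeseburgerArc_collapse h).2 h1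

/-- Distances from the root to faces outside a reducible interval are obtained by cutting at the
pinch point of the interval. -/
theorem gdist_emb (b : Bool) (h : Reducible X (-m) (n - 1)) (v : ℤ) :
    gdist b X 0 (emb m n v) = gdist b X 0 (-m) + gdist b (collapse m n X) 0 v := by
  have hlt := h.1
  have hV : V X (-m) = V X n := by rw [h.V_eq]; congr 1; ring
  refine le_antisymm ?_ ?_
  · have h1 := gdist_triangle b X 0 n (emb m n v)
    have h2 := gdist_emb_le b h 0 v
    rw [emb_of_nonneg le_rfl, zero_add] at h2
    rw [gdist_congr (b := b) (u := 0) rfl hV]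
    omega
  -- The test function is the distance to the point clamped to the interval plus the distance in the
  -- collapsed word. It is $1$-Lipschitz because an edge inside the interval changes only the first
  -- term and an edge outside changes only the second.
  · have := le_add_gdist (b := b) (X := X)
      (fun w => gdist b X 0 (clamp (-m) (n - 1) w) + gdist b (collapse m n X) 0 (unemb m n w))
      (fun w w' hw => by
        rw [gdist_congr (u := 0) rfl (V_clamp h (fun _ _ _ => rfl) hw),
          gdist_congr (u := 0) rfl (V_unemb h hw)])
      (fun w w' he => by
        by_cases hw : -m ≤ w ∧ w ≤ n - 1
        · have hw' := he.inside h hw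
          have h1 := he.clamp h (fun _ _ _ => rfl)
          have h2 := gdist_triangle b X 0 (clamp (-m) (n - 1) w) (clamp (-m) (n - 1) w')
          have h3 := gdist_triangle b X 0 (clamp (-m) (n - 1) w') (clamp (-m) (n - 1) w)
          have h4 := gdist_comm b X (clamp (-m) (n - 1) w) (clamp (-m) (n - 1) w')
          rw [unemb_inside (u := w) (by omega), unemb_inside (u := w') (by omega)]
          omega
        · have hw1 : w < -m ∨ n - 1 < w := by omega
          have hw' := he.outside h hw1
          have h1 := he.unemb h hw1
          have h2 := gdist_triangle b (collapse m n X) 0 (unemb m n w) (unemb m n w')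
          have h3 := gdist_triangle b (collapse m n X) 0 (unemb m n w') (unemb m n w)
          have h4 := gdist_comm b (collapse m n X) (unemb m n w) (unemb m n w')
          rw [gdist_congr (u := 0) (v := clamp (-m) (n - 1) w) rfl
            (V_clamp_outside h (v := w') (by omega) hw')]
          omega) 0 (emb m n v)
    simp only [unemb_emb] at this
    have e0 : clamp (-m) (n - 1) 0 = 0 := if_pos (by omega)
    have e1 : unemb m n 0 = 0 := unemb_inside (by omega)
    have e2 : V X (clamp (-m) (n - 1) (emb m n v)) = V X (-m) := by
      have := V_clamp_outside h (u := emb m n v) (v := -m)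
        (by have := emb_outside m n v; omega) (by omega)
      rw [this]; congr 1; unfold clamp; split_ifs <;> rfl
    rw [e0, e1, gdist_self, gdist_self, gdist_congr (u := 0) rfl e2] at this
    omega

end Collapse

end BurgerWord

namespace BurgerWord

/-! ### Reducible intervals around the origin -/

/-- The word `X_{-m} ⋯ X_{-1}`. -/
def pw (X : ℤ → Letter) (m : ℕ) : List Letter := wd X (-m) m

/-- The word `X_0 ⋯ X_{n-1}`. -/
def fw (X : ℤ → Letter) (n : ℕ) : List Letter := wd X 0 n

lemma pw_add_collapse (X : ℤ → Letter) (m n k : ℕ) :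
    pw X (k + m) = pw (collapse m n X) k ++ pw X m := by
  rw [pw, pw, pw, wd_add]
  congr 1
  · refine wd_congr fun l hl => ?_
    rw [collapse, emb_of_neg (by omega)]; congr 1; push_cast; ring
  · congr 1; push_cast; ring

lemma fw_add_collapse (X : ℤ → Letter) (m n k : ℕ) :
    fw X (n + k) = fw X n ++ fw (collapse m n X) k := by
  rw [fw, fw, fw, wd_add]
  congr 1
  refine wd_congr fun l hl => ?_
  rw [collapse, emb_of_nonneg (by omega)]; congr 1; ring

lemma pw_succ (X : ℤ → Letter) (m : ℕ) : pw X (m + 1) = X (-(m + 1 : ℕ)) :: pw X m := by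
  rw [pw, add_comm m 1, wd_add, pw]
  simp [wd]

lemma fw_succ (X : ℤ → Letter) (n : ℕ) : fw X (n + 1) = fw X n ++ [X n] := by
  rw [fw, wd_succ, zero_add]; rfl

lemma pw_congr {X X' : ℤ → Letter} {m : ℕ} (h : ∀ k : ℤ, -m ≤ k → k < 0 → X k = X' k) :
    pw X m = pw X' m := wd_congr fun k hk => h _ (by omega) (by omega)

lemma fw_congr {X X' : ℤ → Letter} {n : ℕ} (h : ∀ k : ℤ, 0 ≤ k → k < n → X k = X' k) :
    fw X n = fw X' n := wd_congr fun k hk => h _ (by omega) (by omega)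

lemma wd_neg_eq (X : ℤ → Letter) (m n : ℕ) : wd X (-m) (m + n) = pw X m ++ fw X n := by
  rw [wd_add, pw, fw]; simp

/-- The word `X_{-m} ⋯ X_{n-1}` reduces to the empty word. -/
def Closed (X : ℤ → Letter) (m n : ℕ) : Prop := red (pw X m ++ fw X n) = ([], [])

lemma closed_iff_cls {X : ℤ → Letter} {m n : ℕ} : Closed X m n ↔ cls (pw X m) * cls (fw X n) = 1 := by
  rw [Closed, ← cls_append, cls_eq_one_iff]

lemma Closed.congr {X X' : ℤ → Letter} {m n : ℕ} (h : Closed X m n)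
    (hX : ∀ k : ℤ, -m ≤ k → k < n → X k = X' k) : Closed X' m n := by
  rwa [Closed, ← pw_congr (X := X) fun k h1 h2 => hX k h1 (by omega),
    ← fw_congr (X := X) fun k h1 h2 => hX k (by omega) h2]

lemma reducible_iff_closed {X : ℤ → Letter} {m n : ℕ} (hn : 1 ≤ n) :
    Reducible X (-m) (n - 1) ↔ Closed X m n := by
  rw [reducible_iff, show ((n : ℤ) - 1 + 1 - -m).toNat = m + n by omega, wd_neg_eq, Closed]
  refine and_iff_right_of_imp fun h => ?_
  -- Apart from length at least two, the only possibility is a single letter, and no letter reduces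
  -- to the empty word.
  by_contra hlt
  obtain rfl : m = 0 := by omega
  obtain rfl : n = 1 := by omega
  rw [fw_succ] at h
  generalize X (0 : ℕ) = c at h
  cases c <;> simp [pw, fw, red_cons, consStep, Letter.isBurger] at h

lemma mem_reducibleAround {X : ℤ → Letter} {I : ℤ × ℤ} :
    I ∈ reducibleAround X 0 ↔ ∃ m n : ℕ, 1 ≤ n ∧ I = (-(m : ℤ), (n : ℤ) - 1) ∧ Closed X m n := by
  constructor
  · rintro ⟨h1, h2, h3⟩
    have e : I = (-((-I.1).toNat : ℤ), ((I.2 + 1).toNat : ℤ) - 1) := Prod.ext (by simp; omega) (by simp; omega)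
    refine ⟨(-I.1).toNat, (I.2 + 1).toNat, by omega, e, (reducible_iff_closed (by omega)).1 ?_⟩
    convert h3 using 1 <;> omega
  · rintro ⟨m, n, hn, rfl, h⟩
    exact ⟨by simp, by simp; omega, (reducible_iff_closed hn).2 h⟩

lemma Closed.inter_of_lt {X : ℤ → Letter} {m n m' n' : ℕ} (h : Closed X m n) (h' : Closed X m' n')
    (hm : m ≤ m') (hn : n' ≤ n) : Closed X m n' := by
  obtain ⟨k, rfl⟩ := Nat.exists_eq_add_of_le' hm
  obtain ⟨l, rfl⟩ := Nat.exists_eq_add_of_le hn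
  unfold Closed at h h' ⊢
  rw [pw_add_collapse X m n', List.append_assoc] at h'
  rw [fw_add_collapse X m n', ← List.append_assoc] at h
  exact (red_overlap h' h).1

/-- Reducible intervals around $0$ are stable under intersection, by `red_overlap` when neither
contains the other. This is why there is a smallest one. -/
lemma Closed.inter {X : ℤ → Letter} {m n m' n' : ℕ} (h : Closed X m n) (h' : Closed X m' n') :
    Closed X (min m m') (min n n') := by
  rcases le_total m m' with hm | hm <;> rcases le_total n n' with hn | hn
  · rwa [min_eq_left hm, min_eq_left hn]
  · rw [min_eq_left hm, min_eq_right hn]; exact h.inter_of_lt h' hm hn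
  · rw [min_eq_right hm, min_eq_left hn]; exact h'.inter_of_lt h hm hn
  · rwa [min_eq_right hm, min_eq_right hn]

/-- The deleted block is the unit of the monoid. Note that $l\ge1$ on the left means a strictly
larger right end on the right: intervals sharing the right end of the deleted one are lost. -/
lemma closed_collapse {X : ℤ → Letter} {m n : ℕ} (h : Closed X m n) {k l : ℕ} :
    Closed (collapse m n X) k l ↔ Closed X (k + m) (n + l) := by
  rw [closed_iff_cls, closed_iff_cls, pw_add_collapse X m n, fw_add_collapse X m n, cls_append,
    cls_append, mul_assoc, ← mul_assoc (cls (pw X m)), closed_iff_cls.1 h, one_mul]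

/-- `[-m, n-1]` is the smallest reducible interval containing `0`. -/
def IsFirst (X : ℤ → Letter) (p : ℕ × ℕ) : Prop :=
  1 ≤ p.2 ∧ Closed X p.1 p.2 ∧ ∀ k ≤ p.1, ∀ l ≤ p.2, 1 ≤ l → Closed X k l → k = p.1 ∧ l = p.2

lemma IsFirst.le {X : ℤ → Letter} {p : ℕ × ℕ} (h : IsFirst X p) {k l : ℕ} (hl : 1 ≤ l)
    (hc : Closed X k l) : p.1 ≤ k ∧ p.2 ≤ l := by
  have h1 := h.2.2 _ (min_le_left p.1 k) _ (min_le_left p.2 l) (le_min h.1 hl) (h.2.1.inter hc)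
  omega

lemma IsFirst.unique {X : ℤ → Letter} {p q : ℕ × ℕ} (h : IsFirst X p) (h' : IsFirst X q) :
    p = q := by
  have h1 := h.le h'.1 h'.2.1
  have h2 := h'.le h.1 h.2.1
  exact Prod.ext (by omega) (by omega)

lemma IsFirst.congr {X X' : ℤ → Letter} {p : ℕ × ℕ} (h : IsFirst X p)
    (hX : ∀ k : ℤ, -p.1 ≤ k → k < p.2 → X k = X' k) : IsFirst X' p :=
  ⟨h.1, h.2.1.congr hX, fun k hk l hl h1 hc =>
    h.2.2 k hk l hl h1 (hc.congr fun i h2 h3 => (hX i (by omega) (by omega)).symm)⟩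

/-- The least left extent and the least right extent are attained by possibly different intervals;
their intersection attains both. -/
lemma exists_isFirst {X : ℤ → Letter} (h : ∃ m n, 1 ≤ n ∧ Closed X m n) : ∃ p, IsFirst X p := by
  classical
  have h1 : ∃ m, ∃ n, 1 ≤ n ∧ Closed X m n := h
  have h2 : ∃ n, ∃ m, 1 ≤ n ∧ Closed X m n := by obtain ⟨m, n, h⟩ := h; exact ⟨n, m, h⟩
  obtain ⟨n₁, hn₁, hc₁⟩ := Nat.find_spec h1
  obtain ⟨m₂, hn₂, hc₂⟩ := Nat.find_spec h2
  have e1 : Nat.find h1 ≤ m₂ := Nat.find_min' h1 ⟨_, hn₂, hc₂⟩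
  have e2 : Nat.find h2 ≤ n₁ := Nat.find_min' h2 ⟨_, hn₁, hc₁⟩
  refine ⟨(Nat.find h1, Nat.find h2), hn₂, ?_, fun k hk l hl h3 hc => ?_⟩
  · exact hc₁.inter_of_lt hc₂ e1 e2
  · exact ⟨le_antisymm hk (Nat.find_min' h1 ⟨_, h3, hc⟩),
      le_antisymm hl (Nat.find_min' h2 ⟨_, h3, hc⟩)⟩

open Classical in
/-- The smallest reducible interval containing `0`, together with the two distances between the
root and its pinch point. -/
noncomputable def firstInterval (X : ℤ → Letter) : Option (ℕ × ℕ × (Bool → ℕ)) :=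
  if h : ∃ p, IsFirst X p then
    some (h.choose.1, h.choose.2, fun b => gdist b X 0 (-h.choose.1)) else none

lemma firstInterval_eq_some {X : ℤ → Letter} {m n : ℕ} {d : Bool → ℕ} :
    firstInterval X = some (m, n, d) ↔ IsFirst X (m, n) ∧ d = fun b => gdist b X 0 (-m) := by
  unfold firstInterval
  split_ifs with h
  · simp only [Option.some.injEq, Prod.mk.injEq]
    constructor
    · rintro ⟨h1, h2, rfl⟩
      have h3 := h.choose_spec
      rw [show h.choose = (m, n) from Prod.ext h1 h2] at h3 ⊢
      exact ⟨h3, rfl⟩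
    · rintro ⟨h1, rfl⟩
      have := h.choose_spec.unique h1
      rw [this]
      exact ⟨rfl, rfl, rfl⟩
  · simp only [reduceCtorEq, false_iff]
    exact fun h1 => h ⟨_, h1.1⟩

lemma IsFirst.reducible {X : ℤ → Letter} {m n : ℕ} (h : IsFirst X (m, n)) :
    Reducible X (-m) (n - 1) := (reducible_iff_closed h.1).2 h.2.1

/-- The smallest interval and the distances inside it are functions of its own letters; this is what
makes `firstInterval` an exploration and `shrink` a renewal. -/
lemma firstInterval_congr {X X' : ℤ → Letter} {m n : ℕ} {d : Bool → ℕ}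
    (h : firstInterval X = some (m, n, d)) (hX : ∀ k : ℤ, -m ≤ k → k < n → X k = X' k) :
    firstInterval X' = some (m, n, d) := by
  rw [firstInterval_eq_some] at h ⊢
  obtain ⟨h1, rfl⟩ := h
  refine ⟨h1.congr hX, funext fun b => ?_⟩
  have := h1.1
  refine (gdist_eq_of_agree b h1.reducible (fun k h2 h3 => hX k h2 (by omega)) ?_ ?_).symm <;>
    simp at * <;> omega

/-- The word with its smallest reducible interval around `0` deleted. -/
noncomputable def shrink (X : ℤ → Letter) : ℤ → Letter :=
  (firstInterval X).elim X fun q => collapse q.1 q.2.1 X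

/-- The distances between the root and its first pinch point. -/
noncomputable def rootDist (b : Bool) (X : ℤ → Letter) : ℕ :=
  (firstInterval X).elim 0 fun q => q.2.2 b

/-- All successive shrinkings have a first reducible interval. -/
def Good (X : ℤ → Letter) : Prop := ∀ i : ℕ, (firstInterval (shrink^[i] X)).isSome

lemma Good.of_shrink {X : ℤ → Letter} (h : Good X) : Good (shrink X) := fun i => h (i + 1)

lemma Good.exists {X : ℤ → Letter} (h : Good X) : ∃ m n, IsFirst X (m, n) ∧
    shrink X = collapse m n X ∧ ∀ b, rootDist b X = gdist b X 0 (-m) := by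
  obtain ⟨⟨m, n, d⟩, hq⟩ := Option.isSome_iff_exists.1 (h 0)
  have hq : firstInterval X = some (m, n, d) := hq
  obtain ⟨h1, rfl⟩ := firstInterval_eq_some.1 hq
  exact ⟨m, n, h1, by rw [shrink, hq]; rfl, fun b => by rw [rootDist, hq]; rfl⟩

lemma Good.exists_closed {X : ℤ → Letter} (h : Good X) (N : ℕ) :
    ∃ m n, 1 ≤ n ∧ N ≤ n ∧ Closed X m n := by
  induction N generalizing X with
  | zero =>
    obtain ⟨m, n, h1, -⟩ := h.exists
    exact ⟨m, n, h1.1, Nat.zero_le _, h1.2.1⟩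
  | succ N ih =>
    obtain ⟨m, n, h1, h2, -⟩ := h.exists
    obtain ⟨k, l, h3, h4, h5⟩ := ih h.of_shrink
    rw [h2, closed_collapse h1.2.1] at h5
    have := h1.1
    exact ⟨_, _, by omega, by simp only at this; omega, h5⟩

open Classical in
/-- The reducible intervals containing `0` and contained in `[-m, n-1]`. -/
noncomputable def closedBelow (X : ℤ → Letter) (m n : ℕ) : Finset (ℕ × ℕ) :=
  (Finset.range (m + 1) ×ˢ Finset.range (n + 1)).filter fun p => 1 ≤ p.2 ∧ Closed X p.1 p.2

lemma mem_closedBelow {X : ℤ → Letter} {m n : ℕ} {p : ℕ × ℕ} :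
    p ∈ closedBelow X m n ↔ p.1 ≤ m ∧ p.2 ≤ n ∧ 1 ≤ p.2 ∧ Closed X p.1 p.2 := by
  simp [closedBelow, and_assoc]

/-- The distance from the root to the pinch point of a reducible interval is a sum of distances
between successive pinch points. -/
theorem Good.gdist_eq_sum {X : ℤ → Letter} (h : Good X) {m n : ℕ} (hn : 1 ≤ n)
    (hc : Closed X m n) : ∃ j, 1 ≤ j ∧ j ≤ (closedBelow X m n).card ∧
      ∀ b, gdist b X 0 (-m) = ∑ i ∈ Finset.range j, rootDist b (shrink^[i] X) := by
  induction n using Nat.strong_induction_on generalizing X m with | _ n ih => ?_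
  obtain ⟨m₁, n₁, h1, h2, h3⟩ := h.exists
  have hle := h1.le hn hc
  have hn1 := h1.1
  simp only at hle hn1
  have hV : V X (-m) = V X n := by
    rw [((reducible_iff_closed hn).2 hc).V_eq]; congr 1; ring
  have hV1 : V X (-m₁) = V X n₁ := by rw [h1.reducible.V_eq]; congr 1; ring
  -- With equal right ends the two intervals have the same pinch point $V(n)$, so a single increment
  -- suffices. Otherwise the first interval is deleted and the sum for the rest is obtained by
  -- induction.
  rcases eq_or_lt_of_le hle.2 with he | hlt
  · subst he
    refine ⟨1, le_rfl, Finset.card_pos.2 ⟨(m₁, n₁), mem_closedBelow.2 ⟨hle.1, le_rfl, h1.1, h1.2.1⟩⟩,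
      fun b => ?_⟩
    rw [Finset.sum_range_one, Function.iterate_zero, id, h3]
    exact gdist_congr rfl (by rw [hV, hV1])
  · obtain ⟨k, rfl⟩ := Nat.exists_eq_add_of_le' hle.1
    obtain ⟨l, rfl⟩ := Nat.exists_eq_add_of_le hle.2
    have hc' := (closed_collapse h1.2.1).2 hc
    rw [← h2] at hc'
    obtain ⟨j, hj1, hj2, hj3⟩ := ih l (by omega) h.of_shrink (by omega) hc'
    refine ⟨j + 1, by omega, ?_, fun b => ?_⟩
    · refine (Nat.succ_le_succ hj2).trans ?_
      have hnot : (m₁, n₁) ∉ (closedBelow (shrink X) k l).image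
          fun p => (p.1 + m₁, n₁ + p.2) := by
        intro hmem
        obtain ⟨p, hp, e⟩ := Finset.mem_image.1 hmem
        have := (mem_closedBelow.1 hp).2.2.1
        simp only [Prod.mk.injEq] at e
        omega
      rw [← Finset.card_image_of_injective (closedBelow (shrink X) k l)
        (f := fun p => (p.1 + m₁, n₁ + p.2)) (fun p q e => by
          simp only [Prod.mk.injEq] at e
          exact Prod.ext (by omega) (by omega)), Nat.succ_eq_add_one, ← Finset.card_insert_of_notMem hnot]
      refine Finset.card_le_card fun p hp => ?_
      rcases Finset.mem_insert.1 hp with rfl | hp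
      · exact mem_closedBelow.2 ⟨hle.1, hle.2, h1.1, h1.2.1⟩
      · obtain ⟨q, hq, rfl⟩ := Finset.mem_image.1 hp
        have hq := mem_closedBelow.1 hq
        rw [h2, closed_collapse h1.2.1] at hq
        exact mem_closedBelow.2 ⟨by simp only; omega, by simp only; omega, by simp only; omega,
          hq.2.2.2⟩
    · rw [Finset.sum_range_succ']
      simp only [Function.iterate_succ, Function.comp]
      rw [← hj3 b, Function.iterate_zero, id, h3, h2]
      have := gdist_emb b h1.reducible (-k)
      rw [add_comm (gdist b _ _ _), ← this]
      refine gdist_congr rfl ?_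
      rcases Nat.eq_zero_or_pos k with rfl | hk
      · rw [emb_of_nonneg (by simp)]
        simpa using hV1
      · rw [emb_of_neg (by omega)]; congr 1; push_cast; ring

/-! ### The enumeration of the reducible intervals -/

/-- The position of an interval in the order by length. -/
def intervalKey (I : ℤ × ℤ) : ℕ ×ₗ ℕ := toLex ((I.2 - I.1).toNat, I.2.toNat)

/-- For intervals of equal length, being further left is the same as having a smaller right end, and
right ends are nonnegative. The key thus turns `Smaller` into a well-founded lexicographic order. -/
lemma smaller_iff {X : ℤ → Letter} {I J : ℤ × ℤ} (hI : I ∈ reducibleAround X 0)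
    (hJ : J ∈ reducibleAround X 0) : Smaller I J ↔ intervalKey I < intervalKey J := by
  have h1 := hI.1; have h2 := hI.2.1; have h3 := hJ.1; have h4 := hJ.2.1
  rw [Smaller, intervalKey, intervalKey, Prod.Lex.toLex_lt_toLex]
  simp only
  omega

lemma intervalKey_inj {X : ℤ → Letter} {I J : ℤ × ℤ} (hI : I ∈ reducibleAround X 0)
    (hJ : J ∈ reducibleAround X 0) (h : intervalKey I = intervalKey J) : I = J := by
  have h1 := hI.1; have h2 := hI.2.1; have h3 := hJ.1; have h4 := hJ.2.1
  have h5 := congrArg (fun z => (ofLex z).1) h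
  have h6 := congrArg (fun z => (ofLex z).2) h
  simp only [intervalKey, ofLex_toLex] at h5 h6
  exact Prod.ext (by omega) (by omega)

lemma finite_smaller (X : ℤ → Letter) (I : ℤ × ℤ) :
    {J ∈ reducibleAround X 0 | Smaller J I}.Finite := by
  refine Set.Finite.subset ((Set.finite_Icc (-(I.2 - I.1)) (I.2 - I.1)).prod
    (Set.finite_Icc (-(I.2 - I.1)) (I.2 - I.1))) ?_
  rintro J ⟨hJ, hs⟩
  have h3 := hJ.1; have h4 := hJ.2.1
  unfold Smaller at hs
  refine ⟨⟨?_, ?_⟩, ?_, ?_⟩ <;> omega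

lemma IsKthReducible.unique {X : ℤ → Letter} {k : ℕ} {I J : ℤ × ℤ} (hI : IsKthReducible X 0 k I)
    (hJ : IsKthReducible X 0 k J) : I = J := by
  have key : ∀ {I J : ℤ × ℤ}, IsKthReducible X 0 k I → IsKthReducible X 0 k J →
      ¬ intervalKey I < intervalKey J := by
    intro I J hI hJ hlt
    have : {K ∈ reducibleAround X 0 | Smaller K I}.ncard <
        {K ∈ reducibleAround X 0 | Smaller K J}.ncard := by
      refine Set.ncard_lt_ncard ⟨?_, ?_⟩ (finite_smaller X J)
      · rintro K ⟨hK, hs⟩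
        exact ⟨hK, (smaller_iff hK hJ.1).2 (((smaller_iff hK hI.1).1 hs).trans hlt)⟩
      · intro hsub
        have := hsub ⟨hI.1, (smaller_iff hI.1 hJ.1).2 hlt⟩
        exact lt_irrefl _ ((smaller_iff hI.1 hI.1).1 this.2)
    have h1 := hI.2
    have h2 := hJ.2
    omega
  exact intervalKey_inj hI.1 hJ.1 (le_antisymm (not_lt.1 (key hJ hI)) (not_lt.1 (key hI hJ)))

lemma Good.infinite {X : ℤ → Letter} (h : Good X) : (reducibleAround X 0).Infinite := by
  intro hfin
  obtain ⟨N, hN⟩ := (hfin.image fun I => I.2).bddAbove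
  obtain ⟨m, n, h1, h2, h3⟩ := h.exists_closed (N + 2).toNat
  have := hN ⟨_, mem_reducibleAround.2 ⟨m, n, h1, rfl, h3⟩, rfl⟩
  simp only at this
  omega

lemma Good.exists_isKthReducible {X : ℤ → Letter} (h : Good X) {k : ℕ} (hk : 1 ≤ k) :
    ∃ I, IsKthReducible X 0 k I := by
  have hmin : ∀ B : Set (ℤ × ℤ), B.Nonempty → ∃ I ∈ B, ∀ J ∈ B, ¬ intervalKey J < intervalKey I :=
    fun B hB => WellFounded.has_min (InvImage.wf intervalKey wellFounded_lt) B hB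
  induction k, hk using Nat.le_induction with
  | base =>
    obtain ⟨I, hI, hmin⟩ := hmin _ h.infinite.nonempty
    refine ⟨I, hI, ?_⟩
    have : {J ∈ reducibleAround X 0 | Smaller J I} = ∅ := by
      refine Set.eq_empty_iff_forall_notMem.2 ?_
      rintro J ⟨hJ, hs⟩
      exact hmin J hJ ((smaller_iff hJ hI).1 hs)
    rw [this, Set.ncard_empty]
  | succ k hk ih =>
    obtain ⟨I, hI, hc⟩ := ih
    obtain ⟨J, ⟨hJ, hIJ⟩, hJmin⟩ := hmin {J ∈ reducibleAround X 0 | intervalKey I < intervalKey J} (by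
      by_contra hne
      rw [Set.not_nonempty_iff_eq_empty] at hne
      refine h.infinite (((finite_smaller X I).insert I).subset fun J hJ => ?_)
      have hle : ¬ intervalKey I < intervalKey J := fun hlt =>
        Set.eq_empty_iff_forall_notMem.1 hne J ⟨hJ, hlt⟩
      rcases eq_or_lt_of_le (not_lt.1 hle) with he | hlt
      · exact Or.inl (intervalKey_inj hJ hI he)
      · exact Or.inr ⟨hJ, (smaller_iff hJ hI).2 hlt⟩)
    refine ⟨J, hJ, ?_⟩
    have : {K ∈ reducibleAround X 0 | Smaller K J} =
        insert I {K ∈ reducibleAround X 0 | Smaller K I} := by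
      ext K
      constructor
      · rintro ⟨hK, hs⟩
        rw [smaller_iff hK hJ] at hs
        have hle : ¬ intervalKey I < intervalKey K := fun hlt => hJmin K ⟨hK, hlt⟩ hs
        rcases eq_or_lt_of_le (not_lt.1 hle) with he | hlt
        · exact Or.inl (intervalKey_inj hK hI he)
        · exact Or.inr ⟨hK, (smaller_iff hK hI).2 hlt⟩
      · rintro (rfl | ⟨hK, hs⟩)
        · exact ⟨hI, (smaller_iff hI hJ).2 hIJ⟩
        · exact ⟨hK, (smaller_iff hK hJ).2 (((smaller_iff hK hI).1 hs).trans hIJ)⟩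
    rw [this, Set.ncard_insert_of_notMem (fun hmem =>
      lt_irrefl _ ((smaller_iff hI hI).1 hmem.2)) (finite_smaller X I), hc]

/-- A reducible interval around $0$ that lies inside the $k$-th one is either that one or strictly
shorter, so it comes earlier in the enumeration. This gives $j\le k$ for the number of increments.
-/
lemma card_closedBelow_le {X : ℤ → Letter} {m n k : ℕ} (hn : 1 ≤ n)
    (h : IsKthReducible X 0 k (-(m : ℤ), (n : ℤ) - 1)) : (closedBelow X m n).card ≤ k := by
  have hfin := finite_smaller X (-(m : ℤ), (n : ℤ) - 1)
  have hnot : (-(m : ℤ), (n : ℤ) - 1) ∉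
      {J ∈ reducibleAround X 0 | Smaller J (-(m : ℤ), (n : ℤ) - 1)} :=
    fun hmem => lt_irrefl _ ((smaller_iff h.1 h.1).1 hmem.2)
  rw [← h.2, ← Set.ncard_insert_of_notMem hnot hfin, ← Set.ncard_coe_finset]
  refine Set.ncard_le_ncard_of_injOn (fun p => (-(p.1 : ℤ), (p.2 : ℤ) - 1)) ?_ ?_ (hfin.insert _)
  · intro p hp
    obtain ⟨h1, h2, h3, h4⟩ := mem_closedBelow.1 (Finset.mem_coe.1 hp)
    by_cases he : p = (m, n)
    · subst he; exact Or.inl rfl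
    · refine Or.inr ⟨mem_reducibleAround.2 ⟨_, _, h3, rfl, h4⟩, Or.inl ?_⟩
      simp only
      by_contra hlt
      exact he (Prod.ext (by simp only; omega) (by simp only; omega))
  · intro p _ q _ e
    simp only [Prod.mk.injEq, neg_inj, Nat.cast_inj, sub_left_inj] at e
    exact Prod.ext e.1 e.2

/-- The distance from the root to its `k`-th pinch point. -/
noncomputable def pinchDist (b : Bool) (k : ℕ) (X : ℤ → Letter) : ℕ :=
  (graph b X).dist (root X) (pinchPoint X 0 k)

lemma dT_pinchPoint (X : ℤ → Letter) (k : ℕ) :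
    dT X (root X) (pinchPoint X 0 k) = pinchDist false k X := by
  rw [dT, pinchDist, graph_false]

lemma dM_pinchPoint (X : ℤ → Letter) (k : ℕ) :
    dM X (root X) (pinchPoint X 0 k) = pinchDist true k X := by
  rw [dM, pinchDist, graph_true]

lemma IsKthReducible.pinchDist_eq {X : ℤ → Letter} {k : ℕ} {I : ℤ × ℤ}
    (h : IsKthReducible X 0 k I) (b : Bool) : pinchDist b k X = gdist b X 0 I.1 := by
  have hex : ∃ I, IsKthReducible X 0 k I := ⟨I, h⟩
  rw [pinchDist, pinchPoint, dif_pos hex, hex.choose_spec.unique h]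
  rfl

lemma pinchDist_eq_zero {X : ℤ → Letter} {k : ℕ} (h : ¬ ∃ I, IsKthReducible X 0 k I) (b : Bool) :
    pinchDist b k X = 0 := by
  rw [pinchDist, pinchPoint, dif_neg h]
  exact SimpleGraph.dist_self

/-- The distances from the root to its pinch points are partial sums of the successive first
distances. -/
theorem Good.pinchDist_eq_sum {X : ℤ → Letter} (h : Good X) (k : ℕ) :
    ∃ j ≤ k, (1 ≤ k → 1 ≤ j) ∧
      ∀ b, pinchDist b k X = ∑ i ∈ Finset.range j, rootDist b (shrink^[i] X) := by
  rcases Nat.eq_zero_or_pos k with rfl | hk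
  · refine ⟨0, le_rfl, by simp, fun b => ?_⟩
    rw [pinchDist_eq_zero (fun ⟨I, hI⟩ => by have := hI.2; omega), Finset.sum_range_zero]
  · obtain ⟨I, hI⟩ := h.exists_isKthReducible hk
    obtain ⟨m, n, hn, rfl, hc⟩ := mem_reducibleAround.1 hI.1
    obtain ⟨j, h1, h2, h3⟩ := h.gdist_eq_sum hn hc
    exact ⟨j, h2.trans (card_closedBelow_le hn hI), fun _ => h1,
      fun b => by rw [hI.pinchDist_eq, h3]⟩

lemma Good.pinchDist_one {X : ℤ → Letter} (h : Good X) (b : Bool) :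
    pinchDist b 1 X = rootDist b X := by
  obtain ⟨j, h1, h2, h3⟩ := h.pinchDist_eq_sum 1
  obtain rfl : j = 1 := le_antisymm h1 (h2 le_rfl)
  rw [h3, Finset.sum_range_one]; rfl

/-- Being the `k`-th reducible interval around `0` depends on finitely many letters. -/
lemma IsKthReducible.congr {X X' : ℤ → Letter} {k : ℕ} {I : ℤ × ℤ} (h : IsKthReducible X 0 k I)
    (hX : ∀ i, -(I.2 - I.1) ≤ i → i ≤ I.2 - I.1 → X i = X' i) : IsKthReducible X' 0 k I := by
  have h1 := h.1.1; have h2 := h.1.2.1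
  refine ⟨⟨h1, h2, h.1.2.2.congr fun i h3 h4 => hX i (by omega) (by omega)⟩, ?_⟩
  rw [← h.2]
  congr 2
  ext J
  refine and_congr_left fun hs => ?_
  refine and_congr_right fun h3 => and_congr_right fun h4 => ?_
  unfold Smaller at hs
  constructor
  · exact fun hr => hr.congr fun i h5 h6 => (hX i (by omega) (by omega)).symm
  · exact fun hr => hr.congr fun i h5 h6 => hX i (by omega) (by omega)

end BurgerWord

namespace BurgerWord

/-! ### The law of the random word -/

instance : Fintype Letter :=
  ⟨{Letter.a, Letter.b, Letter.A, Letter.B, Letter.F}, fun c => by cases c <;> simp⟩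

lemma sum_letter {M : Type*} [AddCommMonoid M] (f : Letter → M) :
    ∑ c, f c = f .a + (f .b + (f .A + (f .B + f .F))) := by
  change Finset.sum {Letter.a, Letter.b, Letter.A, Letter.B, Letter.F} f = _
  simp

instance : MeasurableSingletonClass Letter := ⟨fun _ => trivial⟩

/-- The letter distribution. -/
noncomputable def letterLaw (p : ℝ) : Measure Letter :=
  Measure.sum fun c => ENNReal.ofReal (Letter.prob p c) • Measure.dirac c

lemma letterLaw_singleton (p : ℝ) (c : Letter) :
    letterLaw p {c} = ENNReal.ofReal (Letter.prob p c) := by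
  rw [letterLaw, Measure.sum_apply _ (measurableSet_singleton c), tsum_fintype]
  simp [Set.indicator_apply]

section Law
variable {p : ℝ} [hp : Fact (p ∈ Set.Ioo (1 / 2 : ℝ) 1)]

lemma prob_nonneg (c : Letter) : 0 ≤ Letter.prob p c := by
  have h := hp.out
  cases c <;> simp only [Letter.prob] <;> linarith [h.1, h.2]

lemma sum_prob (p : ℝ) : ∑ c, Letter.prob p c = 1 := by
  rw [sum_letter]; simp only [Letter.prob]; ring

instance : IsProbabilityMeasure (letterLaw p) := by
  constructor
  rw [← Finset.coe_univ, ← sum_measure_singleton]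
  simp_rw [letterLaw_singleton]
  rw [← ENNReal.ofReal_sum_of_nonneg fun c _ => prob_nonneg c, sum_prob, ENNReal.ofReal_one]

variable (p) in
/-- The law of the bi-infinite random word. -/
noncomputable def wordLaw : Measure (ℤ → Letter) := Measure.infinitePi fun _ => letterLaw p

instance : IsProbabilityMeasure (wordLaw p) := by unfold wordLaw; infer_instance

/-- A function of the word that depends only on the letters in `[-m, n-1]`. -/
def LocalOn {β : Type*} (m n : ℕ) (f : (ℤ → Letter) → β) : Prop :=
  ∀ x x' : ℤ → Letter, (∀ k : ℤ, -m ≤ k → k < n → x k = x' k) → f x = f x'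

/-- A local function factors through the finitely many letters of its window, which form a countable
discrete space; no regularity of `f` is needed. -/
lemma LocalOn.measurable_iSup {β : Type*} [MeasurableSpace β] {m n : ℕ} {f : (ℤ → Letter) → β}
    (hf : LocalOn m n f) :
    Measurable[⨆ i ∈ Set.Ico (-m : ℤ) n, MeasurableSpace.comap (fun x : ℤ → Letter => x i) ⊤] f := by
  classical
  let g : (Set.Ico (-m : ℤ) n → Letter) → β := fun w =>
    f fun k => if h : k ∈ Set.Ico (-m : ℤ) n then w ⟨k, h⟩ else Letter.a
  have e : f = g ∘ fun x i => x i := by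
    funext x
    refine hf _ _ fun k h1 h2 => ?_
    have : k ∈ Set.Ico (-m : ℤ) n := ⟨h1, h2⟩
    simp [this]
  rw [e]
  refine Measurable.comp (measurable_of_countable g) ?_
  refine @measurable_pi_lambda _ _ _ (_) _ _ fun i => ?_
  rw [measurable_iff_comap_le]
  exact le_iSup₂_of_le i.1 i.2 le_rfl

lemma iSup_comap_le (S : Set ℤ) :
    (⨆ i ∈ S, MeasurableSpace.comap (fun x : ℤ → Letter => x i) ⊤) ≤ MeasurableSpace.pi :=
  iSup₂_le fun i _ => (measurable_pi_apply i).comap_le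

lemma LocalOn.measurable {β : Type*} [MeasurableSpace β] {m n : ℕ} {f : (ℤ → Letter) → β}
    (hf : LocalOn m n f) : Measurable f :=
  hf.measurable_iSup.mono (iSup_comap_le _) le_rfl

lemma measurable_collapse_iSup (m n : ℕ) :
    Measurable[⨆ i ∈ (Set.Ico (-m : ℤ) n)ᶜ,
      MeasurableSpace.comap (fun x : ℤ → Letter => x i) ⊤] (collapse m n) := by
  refine @measurable_pi_lambda _ _ _ (_) _ _ fun k => ?_
  rw [measurable_iff_comap_le]
  refine le_iSup₂_of_le (emb m n k) ?_ le_rfl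
  have := emb_outside m n k
  simp only [Set.mem_compl_iff, Set.mem_Ico]
  omega

lemma measurable_collapse (m n : ℕ) : Measurable (collapse m n) :=
  (measurable_collapse_iSup m n).mono (iSup_comap_le _) le_rfl

lemma map_collapse (m n : ℕ) : (wordLaw p).map (collapse m n) = wordLaw p :=
  Measure.map_infinitePi_infinitePi_of_inj (emb_injective m n)

/-- The letters of a window and the word in which it is deleted are independent. -/
lemma lintegral_local_mul {m n : ℕ} {f : (ℤ → Letter) → ℝ≥0∞} (hf : LocalOn m n f)
    {g : (ℤ → Letter) → ℝ≥0∞} (hg : Measurable g) :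
    ∫⁻ x, f x * g (collapse m n x) ∂(wordLaw p) =
      (∫⁻ x, f x ∂(wordLaw p)) * ∫⁻ x, g x ∂(wordLaw p) := by
  have hind : iIndep (fun i : ℤ => MeasurableSpace.comap (fun x : ℤ → Letter => x i) ⊤)
      (wordLaw p) := (iIndepFun_infinitePi (P := fun _ : ℤ => letterLaw p)
        (X := fun _ c => c) fun _ => measurable_id).iIndep
  have hI := indep_iSup_of_disjoint (fun i => (measurable_pi_apply i).comap_le) hind
    (S := Set.Ico (-m : ℤ) n) (T := (Set.Ico (-m : ℤ) n)ᶜ) disjoint_compl_right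
  have := lintegral_mul_eq_lintegral_mul_lintegral_of_independent_measurableSpace
    (iSup_comap_le _) (iSup_comap_le _) hI hf.measurable_iSup
    (g := fun x => g (collapse m n x)) (hg.comp (measurable_collapse_iSup m n))
  rw [this]
  congr 1
  conv_rhs => rw [← map_collapse m n]
  rw [lintegral_map hg (measurable_collapse m n)]

/-- An exploration of the word: it reveals a window around the gap before time `0`, and returns
some data depending only on the letters revealed. -/
def IsExploration {γ : Type*} (e : (ℤ → Letter) → Option (ℕ × ℕ × γ)) : Prop :=
  ∀ x x' m n c, e x = some (m, n, c) → (∀ k : ℤ, -m ≤ k → k < n → x k = x' k) →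
    e x' = some (m, n, c)

lemma IsExploration.localOn {γ : Type*} {e : (ℤ → Letter) → Option (ℕ × ℕ × γ)}
    (he : IsExploration e) (m n : ℕ) (c : γ) : LocalOn m n fun x => e x = some (m, n, c) :=
  fun _ _ h => propext ⟨fun h1 => he _ _ _ _ _ h1 h,
    fun h1 => he _ _ _ _ _ h1 fun k h2 h3 => (h k h2 h3).symm⟩

/-- After an exploration, the unexplored word is fresh. -/
theorem IsExploration.lintegral_eq {γ : Type*} [Countable γ]
    {e : (ℤ → Letter) → Option (ℕ × ℕ × γ)} (he : IsExploration e)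
    {F : γ → (ℤ → Letter) → ℝ≥0∞} (hF : ∀ c, Measurable (F c)) :
    ∫⁻ x, (e x).elim 0 (fun q => F q.2.2 (collapse q.1 q.2.1 x)) ∂(wordLaw p) =
      ∫⁻ x, (e x).elim 0 (fun q => ∫⁻ y, F q.2.2 y ∂(wordLaw p)) ∂(wordLaw p) := by
  classical
  -- The integral is split over the countably many outcomes $q$. On each of them the window is
  -- deterministic, and `lintegral_local_mul` applies.
  have key : ∀ G : (ℤ → Letter) → ℕ × ℕ × γ → ℝ≥0∞, ∀ x, (e x).elim 0 (G x) =
      ∑' q, (if e x = some q then 1 else 0) * G x q := by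
    intro G x
    rcases h : e x with _ | q
    · simp
    · simp only [Option.elim_some, Option.some.injEq]
      rw [tsum_eq_single q fun q' hq' => by rw [if_neg (Ne.symm hq'), zero_mul], if_pos rfl, one_mul]
  have hloc : ∀ q : ℕ × ℕ × γ, LocalOn q.1 q.2.1
      fun x => if e x = some q then (1 : ℝ≥0∞) else 0 := fun q x x' h => by
    have : (e x = some q) = (e x' = some q) := he.localOn q.1 q.2.1 q.2.2 x x' h
    exact if_congr (iff_of_eq this) rfl rfl
  rw [lintegral_congr (key fun x q => F q.2.2 (collapse q.1 q.2.1 x)),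
    lintegral_congr (key fun x q => ∫⁻ y, F q.2.2 y ∂(wordLaw p))]
  have m1 : ∀ q : ℕ × ℕ × γ, AEMeasurable (fun x =>
      (if e x = some q then (1 : ℝ≥0∞) else 0) * F q.2.2 (collapse q.1 q.2.1 x)) (wordLaw p) :=
    fun q => ((hloc q).measurable.mul ((hF q.2.2).comp (measurable_collapse q.1 q.2.1))).aemeasurable
  have m2 : ∀ q : ℕ × ℕ × γ, AEMeasurable (fun x =>
      (if e x = some q then (1 : ℝ≥0∞) else 0) * ∫⁻ y, F q.2.2 y ∂(wordLaw p)) (wordLaw p) :=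
    fun q => ((hloc q).measurable.mul measurable_const).aemeasurable
  rw [lintegral_tsum m1, lintegral_tsum m2]
  congr 1
  funext q
  rw [lintegral_local_mul (hloc q) (hF q.2.2), lintegral_mul_const _ (hloc q).measurable]

lemma IsExploration.measurableSet {γ : Type*} {e : (ℤ → Letter) → Option (ℕ × ℕ × γ)}
    (he : IsExploration e) (q : ℕ × ℕ × γ) : MeasurableSet {x | e x = some q} :=
  measurableSet_setOfPred.2 (he.localOn q.1 q.2.1 q.2.2).measurable

lemma IsExploration.measurable {γ β : Type*} [Countable γ] [MeasurableSpace β]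
    {e : (ℤ → Letter) → Option (ℕ × ℕ × γ)} (he : IsExploration e)
    (f : Option (ℕ × ℕ × γ) → β) : Measurable fun x => f (e x) := by
  let _ : MeasurableSpace (Option (ℕ × ℕ × γ)) := ⊤
  have : Measurable e := by
    refine measurable_to_countable' fun q => ?_
    rcases q with _ | q
    · have : e ⁻¹' {none} = (⋃ q, {x | e x = some q})ᶜ := by
        ext x
        rcases h : e x with _ | q <;> simp [h]
      rw [this]
      exact (MeasurableSet.iUnion fun q => he.measurableSet q).compl
    · exact he.measurableSet q
  exact (measurable_from_top (f := f)).comp this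

lemma wordLaw_letter (i : ℤ) (c : Letter) :
    wordLaw p {x | x i = c} = ENNReal.ofReal (Letter.prob p c) := by
  rw [← letterLaw_singleton, ← Measure.infinitePi_map_eval (fun _ : ℤ => letterLaw p) i,
    Measure.map_apply (measurable_pi_apply i) (measurableSet_singleton c)]
  rfl

lemma lintegral_letter (i : ℤ) (f : Letter → ℝ≥0∞) :
    ∫⁻ x, f (x i) ∂(wordLaw p) = ∑ c, ENNReal.ofReal (Letter.prob p c) * f c := by
  have := lintegral_map (μ := wordLaw p) (f := f) (g := fun x => x i) (measurable_of_countable f)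
    (measurable_pi_apply i)
  rw [← this, wordLaw, Measure.infinitePi_map_eval (fun _ : ℤ => letterLaw p) i, lintegral_fintype]
  exact Finset.sum_congr rfl fun c _ => by rw [letterLaw_singleton, mul_comm]

/-- Conditioning on the last letter of the past. -/
lemma lintegral_past_letter {F : Letter → (ℤ → Letter) → ℝ≥0∞} (hF : ∀ c, Measurable (F c)) :
    ∫⁻ x, F (x (-1)) (collapse 1 0 x) ∂(wordLaw p) =
      ∑ c, ENNReal.ofReal (Letter.prob p c) * ∫⁻ y, F c y ∂(wordLaw p) := by
  have he : IsExploration fun x : ℤ → Letter => some (1, 0, x (-1)) := by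
    intro x x' m n c h hx
    simp only [Option.some.injEq, Prod.mk.injEq] at h ⊢
    obtain ⟨rfl, rfl, h⟩ := h
    exact ⟨rfl, rfl, by rw [← hx (-1) (by simp) (by simp), h]⟩
  have := he.lintegral_eq (p := p) hF
  simp only [Option.elim_some] at this
  rw [this, lintegral_letter (p := p) (-1) fun c => ∫⁻ y, F c y ∂(wordLaw p)]

/-- Conditioning on the first letter of the future. -/
lemma lintegral_future_letter {F : Letter → (ℤ → Letter) → ℝ≥0∞} (hF : ∀ c, Measurable (F c)) :
    ∫⁻ x, F (x 0) (collapse 0 1 x) ∂(wordLaw p) =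
      ∑ c, ENNReal.ofReal (Letter.prob p c) * ∫⁻ y, F c y ∂(wordLaw p) := by
  have he : IsExploration fun x : ℤ → Letter => some (0, 1, x 0) := by
    intro x x' m n c h hx
    simp only [Option.some.injEq, Prod.mk.injEq] at h ⊢
    obtain ⟨rfl, rfl, h⟩ := h
    exact ⟨rfl, rfl, by rw [← hx 0 (by simp) (by simp), h]⟩
  have := he.lintegral_eq (p := p) hF
  simp only [Option.elim_some] at this
  rw [this, lintegral_letter (p := p) 0 fun c => ∫⁻ y, F c y ∂(wordLaw p)]

end Law

/-! ### Expectations of functions of a random word of fixed length -/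

/-- The expectation of `f u` for a random word `u` of length `n`. -/
noncomputable def Ew (p : ℝ) : ℕ → (List Letter → ℝ) → ℝ
  | 0, f => f []
  | n + 1, f => ∑ c, Letter.prob p c * Ew p n fun u => f (c :: u)

lemma Ew_succ_cons (p : ℝ) (n : ℕ) (f : List Letter → ℝ) :
    Ew p (n + 1) f = ∑ c, Letter.prob p c * Ew p n fun u => f (c :: u) := rfl

/-- The law of a finite word is exchangeable under growth at either end. The past and the future can
therefore be described by the same expectation `Ew`, which later allows time reversal. -/
lemma Ew_succ_snoc (p : ℝ) (n : ℕ) (f : List Letter → ℝ) :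
    Ew p (n + 1) f = ∑ c, Letter.prob p c * Ew p n fun u => f (u ++ [c]) := by
  induction n generalizing f with
  | zero => rfl
  | succ n ih =>
    have h1 : ∀ c, Ew p (n + 1) (fun u => f (c :: u)) =
        ∑ d, Letter.prob p d * Ew p n fun u => f (c :: (u ++ [d])) := fun c => ih _
    have h2 : ∀ d, Ew p (n + 1) (fun u => f (u ++ [d])) =
        ∑ c, Letter.prob p c * Ew p n fun u => f (c :: (u ++ [d])) := fun d => rfl
    rw [Ew_succ_cons]
    simp_rw [h1, h2, Finset.mul_sum]
    rw [Finset.sum_comm]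
    exact Finset.sum_congr rfl fun c _ => Finset.sum_congr rfl fun d _ => by ring

lemma Ew_add (p : ℝ) (n : ℕ) (f g : List Letter → ℝ) :
    Ew p n (fun u => f u + g u) = Ew p n f + Ew p n g := by
  induction n generalizing f g with
  | zero => rfl
  | succ n ih => simp_rw [Ew_succ_cons, ih, mul_add, Finset.sum_add_distrib]

lemma Ew_mul (p : ℝ) (n : ℕ) (a : ℝ) (f : List Letter → ℝ) :
    Ew p n (fun u => a * f u) = a * Ew p n f := by
  induction n generalizing f with
  | zero => rfl
  | succ n ih =>
    simp_rw [Ew_succ_cons, ih, Finset.mul_sum]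
    exact Finset.sum_congr rfl fun c _ => by ring

lemma Ew_const (p : ℝ) (n : ℕ) (a : ℝ) : Ew p n (fun _ => a) = a := by
  induction n with
  | zero => rfl
  | succ n ih => simp_rw [Ew_succ_cons, ih, ← Finset.sum_mul, sum_prob, one_mul]

section
variable {p : ℝ} [hp : Fact (p ∈ Set.Ioo (1 / 2 : ℝ) 1)]

lemma Ew_mono {n : ℕ} {f g : List Letter → ℝ} (h : ∀ u, u.length = n → f u ≤ g u) :
    Ew p n f ≤ Ew p n g := by
  induction n generalizing f g with
  | zero => exact h [] rfl
  | succ n ih =>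
    rw [Ew_succ_cons, Ew_succ_cons]
    exact Finset.sum_le_sum fun c _ => mul_le_mul_of_nonneg_left
      (ih fun u hu => h _ (by simp [hu])) (prob_nonneg c)

lemma Ew_nonneg {n : ℕ} {f : List Letter → ℝ} (h : ∀ u, 0 ≤ f u) : 0 ≤ Ew p n f := by
  rw [← Ew_const p n 0]; exact Ew_mono fun u _ => h u

lemma Ew_congr {n : ℕ} {f g : List Letter → ℝ} (h : ∀ u, u.length = n → f u = g u) :
    Ew p n f = Ew p n g :=
  le_antisymm (Ew_mono fun u hu => (h u hu).le) (Ew_mono fun u hu => (h u hu).ge)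

lemma localOn_pw {β : Type*} (n : ℕ) (f : List Letter → β) : LocalOn n 0 fun x => f (pw x n) :=
  fun x x' h => by simp only; rw [pw_congr (X := x) (X' := x') fun k h1 h2 => h k h1 (by simpa)]

lemma localOn_fw {β : Type*} (n : ℕ) (f : List Letter → β) : LocalOn 0 n fun x => f (fw x n) :=
  fun x x' h => by
    simp only; rw [fw_congr (X := x) (X' := x') fun k h1 h2 => h k (by simpa) (by simpa)]

lemma measurable_pw {β : Type*} [MeasurableSpace β] (n : ℕ) (f : List Letter → β) :
    Measurable fun x => f (pw x n) := (localOn_pw n f).measurable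

lemma measurable_fw {β : Type*} [MeasurableSpace β] (n : ℕ) (f : List Letter → β) :
    Measurable fun x => f (fw x n) := (localOn_fw n f).measurable

lemma lintegral_pw {n : ℕ} {f : List Letter → ℝ} (hf : ∀ u, 0 ≤ f u) :
    ∫⁻ x, ENNReal.ofReal (f (pw x n)) ∂(wordLaw p) = ENNReal.ofReal (Ew p n f) := by
  induction n generalizing f with
  | zero => simp [pw, Ew]
  | succ n ih =>
    have h1 : ∀ x : ℤ → Letter, pw x (n + 1) = pw (collapse 1 0 x) n ++ [x (-1)] := fun x => by
      rw [pw_add_collapse x 1 0 n]; congr 1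
    simp_rw [h1]
    rw [lintegral_past_letter (F := fun c y => ENNReal.ofReal (f (pw y n ++ [c])))
      (fun c => measurable_pw n fun u => ENNReal.ofReal (f (u ++ [c]))), Ew_succ_snoc,
      ENNReal.ofReal_sum_of_nonneg
        fun c _ => mul_nonneg (prob_nonneg c) (Ew_nonneg fun u => hf _)]
    refine Finset.sum_congr rfl fun c _ => ?_
    rw [ENNReal.ofReal_mul (prob_nonneg c), ← ih fun u => hf _]

lemma lintegral_fw {n : ℕ} {f : List Letter → ℝ} (hf : ∀ u, 0 ≤ f u) :
    ∫⁻ x, ENNReal.ofReal (f (fw x n)) ∂(wordLaw p) = ENNReal.ofReal (Ew p n f) := by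
  induction n generalizing f with
  | zero => simp [fw, Ew]
  | succ n ih =>
    have h1 : ∀ x : ℤ → Letter, fw x (n + 1) = x 0 :: fw (collapse 0 1 x) n := fun x => by
      rw [add_comm, fw_add_collapse x 0 1 n]; rfl
    simp_rw [h1]
    rw [lintegral_future_letter (F := fun c y => ENNReal.ofReal (f (c :: fw y n)))
      (fun c => measurable_fw n fun u => ENNReal.ofReal (f (c :: u))), Ew_succ_cons,
      ENNReal.ofReal_sum_of_nonneg
        fun c _ => mul_nonneg (prob_nonneg c) (Ew_nonneg fun u => hf _)]
    refine Finset.sum_congr rfl fun c _ => ?_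
    rw [ENNReal.ofReal_mul (prob_nonneg c), ← ih fun u => hf _]

end

end BurgerWord

namespace BurgerWord

/-! ### Simple random walk -/

/-- The probability that a simple random walk stays above `-x` for `n` steps. -/
noncomputable def stayProb : ℕ → ℕ → ℝ
  | 0, _ => 1
  | n + 1, 0 => 1 / 2 * stayProb n 1
  | n + 1, x + 1 => 1 / 2 * stayProb n x + 1 / 2 * stayProb n (x + 2)

lemma stayProb_nonneg (n x : ℕ) : 0 ≤ stayProb n x := by
  induction n generalizing x with
  | zero => simp [stayProb]
  | succ n ih =>
    rcases x with _ | x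
    · rw [stayProb]; linarith [ih 1]
    · rw [stayProb]; linarith [ih x, ih (x + 2)]

lemma stayProb_le_one (n x : ℕ) : stayProb n x ≤ 1 := by
  induction n generalizing x with
  | zero => simp [stayProb]
  | succ n ih =>
    rcases x with _ | x
    · rw [stayProb]; linarith [ih 1, stayProb_nonneg n 1]
    · rw [stayProb]; linarith [ih x, ih (x + 2)]

lemma stayProb_succ_le (n x : ℕ) : stayProb (n + 1) x ≤ stayProb n x := by
  induction n generalizing x with
  | zero => exact stayProb_le_one 1 x
  | succ n ih =>
    rcases x with _ | x
    · rw [stayProb, stayProb]; linarith [ih 1]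
    · change 1 / 2 * stayProb (n + 1) x + 1 / 2 * stayProb (n + 1) (x + 2) ≤
        1 / 2 * stayProb n x + 1 / 2 * stayProb n (x + 2)
      linarith [ih x, ih (x + 2)]

/-- The decreasing limits are harmonic on $\mathbb N$ with value $0$ at $-1$, hence equal to
$(x+1)\,l_0$; being bounded by $1$, they vanish. -/
lemma tendsto_stayProb (x : ℕ) : Tendsto (fun n => stayProb n x) atTop (𝓝 0) := by
  have hlim : ∀ x, ∃ l, Tendsto (fun n => stayProb n x) atTop (𝓝 l) := fun x =>
    ⟨_, tendsto_atTop_ciInf (antitone_nat_of_succ_le fun n => stayProb_succ_le n x)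
      ⟨0, by rintro _ ⟨n, rfl⟩; exact stayProb_nonneg n x⟩⟩
  choose l hl using hlim
  have h0 : l 0 = 1 / 2 * l 1 :=
    tendsto_nhds_unique ((tendsto_add_atTop_iff_nat 1).2 (hl 0)) ((hl 1).const_mul _)
  have h1 : ∀ x, l (x + 1) = 1 / 2 * l x + 1 / 2 * l (x + 2) := fun x =>
    tendsto_nhds_unique ((tendsto_add_atTop_iff_nat 1).2 (hl (x + 1)))
      (((hl x).const_mul _).add ((hl (x + 2)).const_mul _))
  have h2 : ∀ x : ℕ, l x = (x + 1) * l 0 ∧ l (x + 1) = (x + 2) * l 0 := by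
    intro x
    induction x with
    | zero => constructor <;> push_cast <;> linarith
    | succ x ih =>
      have := h1 x
      push_cast
      constructor <;> linarith [ih.1, ih.2]
  have hle : ∀ x, l x ≤ 1 := fun x => le_of_tendsto' (hl x) fun n => stayProb_le_one n x
  have hge : ∀ x, 0 ≤ l x := fun x => ge_of_tendsto' (hl x) fun n => stayProb_nonneg n x
  have h3 : l 0 = 0 := by
    by_contra hne
    have hpos : 0 < l 0 := lt_of_le_of_ne (hge 0) (Ne.symm hne)
    obtain ⟨n, hn⟩ := exists_nat_gt (1 / l 0)
    rw [div_lt_iff₀ hpos] at hn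
    have := (h2 n).1
    have := hle n
    nlinarith
  have := (h2 x).1
  rw [h3, mul_zero] at this
  rw [← this]; exact hl x

section
variable {p : ℝ} [hp : Fact (p ∈ Set.Ioo (1 / 2 : ℝ) 1)]

-- Burgers and orders each have total weight $1/2$, so the net count of the successive prefixes is a
-- simple random walk; the recursion of `stayProb` is conditioning on its first step.
open Classical in
lemma Ew_prefix_ge (n x : ℕ) :
    Ew p n (fun u => if ∀ v, v <+: u → -(x : ℤ) ≤ netCount v then 1 else 0) = stayProb n x := by
  induction n generalizing x with
  | zero => simp [Ew, stayProb]
  | succ n ih =>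
    have key : ∀ (c : Letter) (u : List Letter), (∀ v, v <+: c :: u → -(x : ℤ) ≤ netCount v) ↔
        ∀ v, v <+: u → -(x : ℤ) - (if c.isBurger then 1 else -1) ≤ netCount v := by
      intro c u
      constructor
      · intro h v hv
        have := h (c :: v) (List.cons_prefix_cons.2 ⟨rfl, hv⟩)
        rw [netCount_cons] at this
        linarith
      · intro h v hv
        rcases v with _ | ⟨d, v⟩
        · simp
        · obtain ⟨rfl, hv'⟩ := List.cons_prefix_cons.1 hv
          rw [netCount_cons]
          linarith [h v hv']
    rw [Ew_succ_cons, sum_letter]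
    simp only [key, Letter.isBurger, if_true, Bool.false_eq_true, if_false]
    have hup := ih (x + 1)
    rw [show -((x + 1 : ℕ) : ℤ) = -(x : ℤ) - 1 by push_cast; ring] at hup
    rcases x with _ | x
    · have h0 : Ew p n (fun u => if ∀ v, v <+: u → -((0 : ℕ) : ℤ) - -1 ≤ netCount v
          then (1 : ℝ) else 0) = 0 := by
        refine (Ew_congr fun u _ => if_neg fun h => ?_).trans (Ew_const p n 0)
        have := h [] List.nil_prefix
        simp at this
      rw [h0, hup, stayProb]
      simp only [Letter.prob]; ring
    · have hdn := ih x
      rw [show -(x : ℤ) = -((x + 1 : ℕ) : ℤ) - -1 by push_cast; ring] at hdn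
      rw [hup, hdn, stayProb]
      simp only [Letter.prob]; ring

open Classical in
lemma Ew_suffix_le (n x : ℕ) :
    Ew p n (fun u => if ∀ v, v <:+ u → netCount v ≤ x then 1 else 0) = stayProb n x := by
  induction n generalizing x with
  | zero => simp [Ew, stayProb]
  | succ n ih =>
    have key : ∀ (c : Letter) (u : List Letter), (∀ v, v <:+ u ++ [c] → netCount v ≤ x) ↔
        ∀ v, v <:+ u → netCount v ≤ x - (if c.isBurger then 1 else -1) := by
      intro c u
      have hc : ∀ v, netCount (v ++ [c]) = netCount v + if c.isBurger then 1 else -1 := by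
        intro v; rw [netCount_append, netCount_cons]; simp
      constructor
      · intro h v hv
        have := h (v ++ [c]) (by obtain ⟨t, rfl⟩ := hv; exact ⟨t, by simp⟩)
        rw [hc] at this
        linarith
      · intro h v hv
        rcases List.suffix_concat_iff.1 (by simpa using hv) with rfl | ⟨w, rfl, hw⟩
        · simp
        · have := h w hw
          rw [hc]
          linarith
    rw [Ew_succ_snoc, sum_letter]
    simp only [key, Letter.isBurger, if_true, Bool.false_eq_true, if_false]
    have hup := ih (x + 1)
    rw [show ((x + 1 : ℕ) : ℤ) = (x : ℤ) - -1 by push_cast; ring] at hup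
    rcases x with _ | x
    · have h0 : Ew p n (fun u => if ∀ v, v <:+ u → netCount v ≤ ((0 : ℕ) : ℤ) - 1
          then (1 : ℝ) else 0) = 0 := by
        refine (Ew_congr fun u _ => if_neg fun h => ?_).trans (Ew_const p n 0)
        have := h [] List.nil_suffix
        simp at this
      rw [h0, hup, stayProb]
      simp only [Letter.prob]; ring
    · have hdn := ih x
      rw [show (x : ℤ) = ((x + 1 : ℕ) : ℤ) - 1 by push_cast; ring] at hdn
      rw [hup, hdn, stayProb]
      simp only [Letter.prob]; ring

/-- The intersection of the events is contained in each of them, so its probability is below every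
term of a sequence tending to $0$. -/
lemma ae_not_forall_of_tendsto {s : ℕ → Set (ℤ → Letter)}
    {f : ℕ → ℝ} (h : ∀ n, wordLaw p (s n) ≤ ENNReal.ofReal (f n)) (hf : Tendsto f atTop (𝓝 0)) :
    ∀ᵐ x ∂(wordLaw p), ¬ ∀ n, x ∈ s n := by
  rw [ae_iff]
  have hle : ∀ n, wordLaw p {x | ¬ ¬ ∀ n, x ∈ s n} ≤ ENNReal.ofReal (f n) := fun n =>
    (measure_mono fun x hx => by simp only [not_not, Set.mem_setOf_eq] at hx; exact hx n).trans (h n)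
  have ht := ENNReal.tendsto_ofReal hf
  rw [ENNReal.ofReal_zero] at ht
  exact le_antisymm (ge_of_tendsto' ht hle) (zero_le)

lemma pw_suffix {x : ℤ → Letter} {n : ℕ} {v : List Letter} (h : v <:+ pw x n) :
    ∃ k ≤ n, v = pw x k := by
  induction n with
  | zero => exact ⟨0, le_rfl, by simpa [pw] using h⟩
  | succ n ih =>
    rw [pw_succ, List.suffix_cons_iff] at h
    rcases h with h | h
    · exact ⟨n + 1, le_rfl, by rw [pw_succ]; exact h⟩
    · obtain ⟨k, hk, e⟩ := ih h; exact ⟨k, by omega, e⟩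

lemma fw_prefix {x : ℤ → Letter} {n : ℕ} {v : List Letter} (h : v <+: fw x n) :
    ∃ k ≤ n, v = fw x k := by
  induction n with
  | zero => exact ⟨0, le_rfl, by simpa [fw] using h⟩
  | succ n ih =>
    rw [fw_succ, List.prefix_concat_iff] at h
    rcases h with h | h
    · exact ⟨n + 1, le_rfl, by rw [fw_succ]; exact h⟩
    · obtain ⟨k, hk, e⟩ := ih h; exact ⟨k, by omega, e⟩

/-- The net burger count of the past is not bounded above. -/
lemma ae_exists_netCount_pw_gt (K : ℕ) :
    ∀ᵐ x ∂(wordLaw p), ∃ n, (K : ℤ) < netCount (pw x n) := by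
  classical
  have := ae_not_forall_of_tendsto (p := p)
    (s := fun n => {x | ∀ v, v <:+ pw x n → netCount v ≤ K}) (f := fun n => stayProb n K)
    (fun n => by
      rw [← Ew_suffix_le (p := p) n K, ← lintegral_pw fun u => by split_ifs <;> norm_num]
      rw [← lintegral_indicator_one]
      · refine lintegral_mono fun x => ?_
        by_cases h : ∀ v, v <:+ pw x n → netCount v ≤ K
        · rw [Set.indicator_of_mem (by exact h), if_pos h]; simp
        · rw [Set.indicator_of_notMem (by exact h)]; exact zero_le
      · exact measurableSet_setOfPred.2
          (measurable_pw n fun u => ∀ v, v <:+ u → netCount v ≤ (K : ℤ)))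
    (tendsto_stayProb K)
  filter_upwards [this] with x hx
  by_contra hcon
  push Not at hcon
  refine hx fun n v hv => ?_
  obtain ⟨k, -, rfl⟩ := pw_suffix hv
  exact hcon k

/-- The net burger count of the future is not bounded below. -/
lemma ae_exists_netCount_fw_lt (K : ℕ) :
    ∀ᵐ x ∂(wordLaw p), ∃ n, netCount (fw x n) < -(K : ℤ) := by
  classical
  have := ae_not_forall_of_tendsto (p := p)
    (s := fun n => {x | ∀ v, v <+: fw x n → -(K : ℤ) ≤ netCount v}) (f := fun n => stayProb n K)
    (fun n => by
      rw [← Ew_prefix_ge (p := p) n K, ← lintegral_fw fun u => by split_ifs <;> norm_num]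
      rw [← lintegral_indicator_one]
      · refine lintegral_mono fun x => ?_
        by_cases h : ∀ v, v <+: fw x n → -(K : ℤ) ≤ netCount v
        · rw [Set.indicator_of_mem (by exact h), if_pos h]; simp
        · rw [Set.indicator_of_notMem (by exact h)]; exact zero_le
      · exact measurableSet_setOfPred.2
          (measurable_fw n fun u => ∀ v, v <+: u → -(K : ℤ) ≤ netCount v))
    (tendsto_stayProb K)
  filter_upwards [this] with x hx
  by_contra hcon
  push Not at hcon
  refine hx fun n v hv => ?_
  obtain ⟨k, -, rfl⟩ := fw_prefix hv
  exact hcon k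

end

/-! ### The exchange of the two kinds of burgers -/

/-- The exchange of hamburgers and cheeseburgers. -/
def flip : Letter → Letter
  | .a => .b
  | .b => .a
  | .A => .B
  | .B => .A
  | .F => .F

@[simp] lemma flip_flip (c : Letter) : flip (flip c) = c := by cases c <;> rfl
@[simp] lemma isBurger_flip (c : Letter) : (flip c).isBurger = c.isBurger := by cases c <;> rfl
@[simp] lemma serves_flip (c d : Letter) : (flip c).serves (flip d) = c.serves d := by
  cases c <;> cases d <;> rfl
lemma prob_flip (p : ℝ) (c : Letter) : Letter.prob p (flip c) = Letter.prob p c := by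
  cases c <;> rfl

lemma consStep_flip (c : Letter) (r : RWord) :
    consStep (flip c) (r.1.map flip, r.2.map flip) =
      ((consStep c r).1.map flip, (consStep c r).2.map flip) := by
  have h1 : (flip c).serves ∘ flip = c.serves := funext fun d => serves_flip c d
  unfold consStep
  simp only [isBurger_flip, List.any_map, h1]
  split_ifs
  · simp only; rw [List.eraseP_map, h1]
  · simp
  · simp

lemma red_flip (w : List Letter) : red (w.map flip) = ((red w).1.map flip, (red w).2.map flip) := by
  induction w with
  | nil => rfl
  | cons c w ih => rw [List.map_cons, red_cons, ih, consStep_flip, red_cons]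

lemma Ew_flip (p : ℝ) (n : ℕ) (f : List Letter → ℝ) :
    Ew p n (fun u => f (u.map flip)) = Ew p n f := by
  induction n generalizing f with
  | zero => rfl
  | succ n ih =>
    rw [Ew_succ_cons, Ew_succ_cons, sum_letter, sum_letter]
    simp only [List.map_cons, flip]
    rw [ih fun u => f (.a :: u), ih fun u => f (.b :: u), ih fun u => f (.A :: u),
      ih fun u => f (.B :: u), ih fun u => f (.F :: u)]
    simp only [Letter.prob]; ring

lemma map_flip_wordLaw {p : ℝ} [hp : Fact (p ∈ Set.Ioo (1 / 2 : ℝ) 1)] :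
    (wordLaw p).map (fun x k => flip (x k)) = wordLaw p := by
  have h1 : (letterLaw p).map flip = letterLaw p := by
    refine Measure.ext_of_singleton fun c => ?_
    rw [Measure.map_apply (measurable_of_countable _) (measurableSet_singleton c)]
    have : flip ⁻¹' {c} = {flip c} := by
      ext d
      simp only [Set.mem_preimage, Set.mem_singleton_iff]
      constructor
      · rintro rfl; simp
      · rintro rfl; simp
    rw [this, letterLaw_singleton, letterLaw_singleton, prob_flip]
  have := Measure.infinitePi_map_pi (fun _ : ℤ => letterLaw p)
    (f := fun _ c => flip c) fun _ => measurable_of_countable _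
  unfold wordLaw
  rw [this]
  simp_rw [h1]

lemma pw_flip (x : ℤ → Letter) (n : ℕ) : pw (fun k => flip (x k)) n = (pw x n).map flip := by
  simp [pw, wd]

lemma fw_flip (x : ℤ → Letter) (n : ℕ) : fw (fun k => flip (x k)) n = (fw x n).map flip := by
  simp [fw, wd]

end BurgerWord

namespace BurgerWord

/-! ### The shortest past with a surviving burger -/

/-- The two kinds of burgers. -/
def burger (t : Bool) : Letter := if t then .a else .b

/-- The order that a burger of kind `t` does not serve. -/
def opp (t : Bool) : Letter := if t then .B else .A

@[simp] lemma flip_burger (t : Bool) : flip (burger t) = burger (!t) := by cases t <;> rfl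
@[simp] lemma flip_opp (t : Bool) : flip (opp t) = opp (!t) := by cases t <;> rfl
@[simp] lemma isBurger_burger (t : Bool) : (burger t).isBurger = true := by cases t <;> rfl
@[simp] lemma isBurger_opp (t : Bool) : (opp t).isBurger = false := by cases t <;> rfl
lemma burger_injective : Function.Injective burger := by
  intro s t h; cases s <;> cases t <;> simp_all [burger]
lemma exists_burger {c : Letter} (h : c.isBurger = true) : ∃ t, c = burger t := by
  cases c
  · exact ⟨true, rfl⟩
  · exact ⟨false, rfl⟩
  all_goals simp [Letter.isBurger] at h
lemma eq_opp {t : Bool} {o : Letter} (ho : o.isBurger = false) (h : (burger t).serves o = false) :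
    o = opp t := by
  cases t <;> cases o <;> simp_all [Letter.isBurger, Letter.serves, burger, opp]

/-- The new letter must be a burger that serves none of the unserved orders of `v`. So these contain
no $\mathtt F$ and are all of the other kind. -/
lemma red_cons_of_snd_ne_nil {c : Letter} {v : List Letter} (h : (red v).2 = [])
    (h' : (red (c :: v)).2 ≠ []) : ∃ t N, red (c :: v) = (List.replicate N (opp t), [burger t]) := by
  have hw := wf_red v
  rw [red_cons] at h' ⊢
  unfold consStep at h' ⊢
  split_ifs at h' ⊢ with h1 h2
  · exact absurd h h'
  · obtain ⟨t, rfl⟩ := exists_burger h1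
    refine ⟨t, (red v).1.length, ?_⟩
    rw [h, List.nil_append]
    congr 1
    refine List.eq_replicate_iff.2 ⟨rfl, fun o ho => eq_opp (hw.1 o ho) ?_⟩
    by_contra hs
    exact h2 (List.any_eq_true.2 ⟨o, ho, by simpa using hs⟩)
  · exact absurd h h'

/-- The last `n` letters of the past are the shortest past with a surviving burger. This burger is
of kind `q.1` and there are `q.2` unserved orders. -/
def IsBackBlock (x : ℤ → Letter) (n : ℕ) (q : Bool × ℕ) : Prop :=
  red (pw x n) = (List.replicate q.2 (opp q.1), [burger q.1]) ∧ ∀ k < n, (red (pw x k)).2 = []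

lemma IsBackBlock.congr {x x' : ℤ → Letter} {n : ℕ} {q : Bool × ℕ} (h : IsBackBlock x n q)
    (hx : ∀ k : ℤ, -n ≤ k → k < 0 → x k = x' k) : IsBackBlock x' n q := by
  refine ⟨?_, fun k hk => ?_⟩
  · rw [← pw_congr hx]; exact h.1
  · rw [← pw_congr (m := k) fun j h1 h2 => hx j (by omega) h2]; exact h.2 k hk

lemma IsBackBlock.unique {x : ℤ → Letter} {n n' : ℕ} {q q' : Bool × ℕ} (h : IsBackBlock x n q)
    (h' : IsBackBlock x n' q') : n = n' ∧ q = q' := by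
  have e : n = n' := by
    rcases lt_trichotomy n n' with hl | hl | hl
    · have := h'.2 n hl; rw [h.1] at this; simp at this
    · exact hl
    · have := h.2 n' hl; rw [h'.1] at this; simp at this
  subst e
  have := h.1.symm.trans h'.1
  simp only [Prod.mk.injEq, List.cons.injEq, and_true] at this
  refine ⟨rfl, Prod.ext (burger_injective this.2) ?_⟩
  simpa using congrArg List.length this.1

lemma exists_isBackBlock {x : ℤ → Letter} (h : ∃ n, (red (pw x n)).2 ≠ []) :
    ∃ n q, IsBackBlock x n q := by
  classical
  have h1 := Nat.find_spec h
  have h2 : ∀ k < Nat.find h, (red (pw x k)).2 = [] := fun k hk => by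
    simpa using Nat.find_min h hk
  rcases e : Nat.find h with _ | m
  · rw [e] at h1; simp [pw] at h1
  · rw [e] at h1 h2
    have h3 := h2 m (by omega)
    rw [pw_succ] at h1
    obtain ⟨t, N, h4⟩ := red_cons_of_snd_ne_nil h3 h1
    exact ⟨m + 1, (t, N), by rw [pw_succ]; exact h4, h2⟩

lemma IsBackBlock.flip {x : ℤ → Letter} {n : ℕ} {q : Bool × ℕ} (h : IsBackBlock x n q) :
    IsBackBlock (fun k => flip (x k)) n (!q.1, q.2) := by
  refine ⟨?_, fun k hk => ?_⟩
  · rw [pw_flip, red_flip, h.1]; simp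
  · rw [pw_flip, red_flip, h.2 k hk]; simp

open Classical in
/-- The exploration of the past up to the first surviving burger. -/
noncomputable def backBlock (x : ℤ → Letter) : Option (ℕ × ℕ × (Bool × ℕ)) :=
  if h : ∃ r : ℕ × (Bool × ℕ), IsBackBlock x r.1 r.2 then some (h.choose.1, 0, h.choose.2) else none

lemma backBlock_eq_some {x : ℤ → Letter} {r : ℕ × ℕ × (Bool × ℕ)} :
    backBlock x = some r ↔ IsBackBlock x r.1 r.2.2 ∧ r.2.1 = 0 := by
  obtain ⟨n, n', q⟩ := r
  unfold backBlock
  split_ifs with h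
  · simp only [Option.some.injEq, Prod.mk.injEq]
    have hs := h.choose_spec
    constructor
    · rintro ⟨rfl, rfl, rfl⟩; exact ⟨hs, rfl⟩
    · rintro ⟨h1, rfl⟩
      have := hs.unique h1
      exact ⟨this.1, rfl, this.2⟩
  · simp only [reduceCtorEq, false_iff, not_and]
    intro h1; exact absurd ⟨(n, q), h1⟩ h

lemma isExploration_backBlock : IsExploration backBlock := by
  intro x x' m n q h hx
  obtain ⟨h1, rfl⟩ := backBlock_eq_some.1 h
  exact backBlock_eq_some.2 ⟨h1.congr hx, rfl⟩

lemma backBlock_flip (x : ℤ → Letter) :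
    backBlock (fun k => flip (x k)) = (backBlock x).map fun r => (r.1, r.2.1, (!r.2.2.1, r.2.2.2)) := by
  rcases h : backBlock x with _ | ⟨n, n', q⟩
  · rw [Option.map_none]
    rcases h' : backBlock (fun k => flip (x k)) with _ | ⟨n, n', q⟩
    · rfl
    · have := (backBlock_eq_some.1 h').1.flip
      simp only [flip_flip] at this
      rw [backBlock_eq_some (r := (n, 0, (!q.1, q.2))) |>.2 ⟨this, rfl⟩] at h
      cases h
  · obtain ⟨h1, h2⟩ := backBlock_eq_some.1 h
    exact backBlock_eq_some.2 ⟨h1.flip, h2⟩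

section
variable {p : ℝ} [hp : Fact (p ∈ Set.Ioo (1 / 2 : ℝ) 1)]

lemma ae_exists_backBlock : ∀ᵐ x ∂(wordLaw p), ∃ n q, backBlock x = some (n, 0, q) := by
  filter_upwards [ae_exists_netCount_pw_gt (p := p) 0] with x ⟨n, hn⟩
  obtain ⟨m, q, h⟩ := exists_isBackBlock (x := x) ⟨n, fun h0 => by
    rw [netCount_eq, h0] at hn
    simp at hn
    omega⟩
  exact ⟨m, q, backBlock_eq_some.2 ⟨h, rfl⟩⟩

variable (p) in
/-- The law of the number of orders in the shortest past with a surviving burger. -/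
noncomputable def backLaw : Measure ℕ :=
  (wordLaw p).map fun x => (backBlock x).elim 0 fun r => r.2.2.2

lemma measurable_backLen : Measurable fun x => (backBlock x).elim 0 fun r => r.2.2.2 :=
  isExploration_backBlock.measurable fun o => o.elim 0 fun r => r.2.2.2

instance : IsProbabilityMeasure (backLaw p) :=
  Measure.isProbabilityMeasure_map measurable_backLen.aemeasurable

/-- Exchanging the two kinds preserves the law and the number of orders but flips the kind of the
burger, so given the number both kinds have probability $1/2$. -/
lemma lintegral_backBlock (G : Bool → ℕ → ℝ≥0∞) :
    ∫⁻ x, (backBlock x).elim 0 (fun r => G r.2.2.1 r.2.2.2) ∂(wordLaw p) =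
      ∫⁻ N, 2⁻¹ * (G true N + G false N) ∂(backLaw p) := by
  have hm : ∀ G : Bool → ℕ → ℝ≥0∞, Measurable fun x : ℤ → Letter =>
      (backBlock x).elim 0 (fun r => G r.2.2.1 r.2.2.2) := fun G =>
    isExploration_backBlock.measurable fun o => o.elim 0 fun r => G r.2.2.1 r.2.2.2
  have h1 : ∫⁻ x, (backBlock x).elim 0 (fun r => G r.2.2.1 r.2.2.2) ∂(wordLaw p) =
      ∫⁻ x, (backBlock x).elim 0 (fun r => G (!r.2.2.1) r.2.2.2) ∂(wordLaw p) := by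
    conv_lhs => rw [← map_flip_wordLaw]
    have hflip : Measurable fun (x : ℤ → Letter) k => flip (x k) := measurable_pi_lambda _ fun i =>
      (measurable_of_countable flip).comp (measurable_pi_apply i)
    rw [lintegral_map (hm G) hflip]
    refine lintegral_congr fun x => ?_
    rw [backBlock_flip]
    rcases backBlock x with _ | r <;> rfl
  have h2 : ∫⁻ N, 2⁻¹ * (G true N + G false N) ∂(backLaw p) =
      ∫⁻ x, 2⁻¹ * ((backBlock x).elim 0 (fun r => G r.2.2.1 r.2.2.2) +
        (backBlock x).elim 0 (fun r => G (!r.2.2.1) r.2.2.2)) ∂(wordLaw p) := by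
    rw [backLaw, lintegral_map (measurable_of_countable _) measurable_backLen]
    refine lintegral_congr_ae ?_
    filter_upwards [ae_exists_backBlock (p := p)] with x ⟨n, q, hx⟩
    rw [hx]
    rcases q with ⟨_ | _, N⟩
    · simp [add_comm]
    · simp
  have hadd : Measurable fun x : ℤ → Letter => (backBlock x).elim 0 (fun r => G r.2.2.1 r.2.2.2) +
      (backBlock x).elim 0 (fun r => G (!r.2.2.1) r.2.2.2) := (hm G).add (hm fun t N => G (!t) N)
  rw [h2, lintegral_const_mul _ hadd, lintegral_add_left (hm G),
    ← h1, ← two_mul, ← mul_assoc, ENNReal.inv_mul_cancel (by norm_num) (by norm_num), one_mul]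

end

/-! ### The variance of the discrepancy -/

/-- The contribution of a letter to the discrepancy. -/
def val : Letter → ℝ
  | .a => 1
  | .b => -1
  | .A => -1
  | .B => 1
  | .F => 0

/-- The discrepancy between the two kinds. -/
noncomputable def disc (r : RWord) : ℝ := (r.1.map val).sum + (r.2.map val).sum

/-- The kind of the freshest burger. -/
noncomputable def topVal (r : RWord) : ℝ := (r.2.map val).headD 0

lemma val_of_serves {x c : Letter} (h : x.serves c = true) (hc : c ≠ .F) : val x = - val c := by
  cases x <;> cases c <;> simp_all [Letter.serves, val]

lemma sum_val_eraseP {q : Letter → Bool} {l : List Letter} {s : ℝ} (h : l.any q = true)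
    (hs : ∀ x ∈ l, q x = true → val x = s) :
    ((l.eraseP q).map val).sum = (l.map val).sum - s := by
  obtain ⟨x, hx, hqx⟩ := List.any_eq_true.1 h
  obtain ⟨y, l₁, l₂, -, hy, rfl, e⟩ := List.exists_of_eraseP hx hqx
  rw [e]
  have := hs y (by simp) hy
  simp only [List.map_append, List.sum_append, List.map_cons, List.sum_cons]
  linarith

lemma disc_snocStep {r : RWord} {c : Letter} (hc : c ≠ .F) :
    disc (snocStep r c) = disc r + val c := by
  unfold snocStep
  split_ifs with h1 h2
  · simp [disc]; ring
  · simp only [disc]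
    rw [sum_val_eraseP h2 fun x _ hx => val_of_serves hx hc]
    ring
  · simp [disc]; ring

lemma serves_F {c : Letter} (h : c.isBurger = true) : c.serves .F = true := by
  cases c <;> simp_all [Letter.isBurger, Letter.serves]

lemma disc_snocStep_F {r : RWord} (hr : WF r) : disc (snocStep r .F) = disc r - topVal r := by
  obtain ⟨O, S⟩ := r
  rcases S with _ | ⟨c, S⟩
  · simp [snocStep, disc, topVal, Letter.isBurger, val]
  · have hc : c.serves .F = true := serves_F (hr.2 c (by simp))
    simp [snocStep, disc, topVal, Letter.isBurger, hc]
    ring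

lemma val_sq_le (c : Letter) : val c ^ 2 ≤ 1 := by cases c <;> simp [val]

lemma topVal_sq_le (r : RWord) : topVal r ^ 2 ≤ 1 := by
  obtain ⟨O, S⟩ := r
  rcases S with _ | ⟨c, S⟩
  · simp [topVal]
  · simpa [topVal] using val_sq_le c

lemma val_flip (c : Letter) : val (flip c) = - val c := by cases c <;> simp [val, flip]

lemma disc_flip (r : RWord) : disc (r.1.map flip, r.2.map flip) = - disc r := by
  have : ∀ l : List Letter, ((l.map flip).map val).sum = - (l.map val).sum := by
    intro l
    induction l with
    | nil => simp
    | cons c l ih =>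
      simp only [List.map_cons, List.sum_cons] at ih ⊢
      rw [ih, val_flip]; ring
  simp only [disc, this]; ring

/-- The discrepancy is additive when there is no flexible order in the second word. -/
lemma disc_act (u : List Letter) {r : RWord} (hr : Letter.F ∉ r.1) :
    disc (act u r) = disc (red u) + disc r := by
  -- In `act u r` the orders of `red u` stand first, so a new burger makes the same choice in both
  -- words until it reaches the orders `O` coming from `r`. Those are of a definite kind, so
  -- consuming one there cancels the burger's contribution exactly; an $\mathtt F$ would not.
  have key : ∃ O, (act u r).1 = (red u).1 ++ O ∧ Letter.F ∉ O ∧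
      disc (act u r) = disc (red u) + disc r := by
    induction u with
    | nil => exact ⟨r.1, by simp, hr, by simp [disc]⟩
    | cons c u ih =>
      obtain ⟨O, h1, h2, h3⟩ := ih
      rw [act_cons, red_cons]
      by_cases hb : c.isBurger
      · by_cases ha : (red u).1.any c.serves
        · have ha' : (act u r).1.any c.serves := by rw [h1, List.any_append, ha]; rfl
          refine ⟨O, ?_, h2, ?_⟩
          · simp only [consStep, hb, ha, ha', if_true]
            rw [h1, eraseP_append_any, if_pos ha]
          · simp only [consStep, hb, ha, ha', if_true]
            simp only [disc] at h3 ⊢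
            obtain ⟨y, hy, hcy⟩ := List.any_eq_true.1 ha
            obtain ⟨z, l₁, l₂, hn, hz, e, e'⟩ := List.exists_of_eraseP hy hcy
            rw [h1, eraseP_append_any, if_pos ha]
            rw [h1] at h3
            rw [e'] 
            rw [e] at h3
            simp only [List.map_append, List.sum_append, List.map_cons, List.sum_cons] at h3 ⊢
            linarith
        · by_cases ho : O.any c.serves
          · have ha' : (act u r).1.any c.serves := by rw [h1, List.any_append, ho]; simp
            refine ⟨O.eraseP c.serves, ?_, fun h => h2 (List.mem_of_mem_eraseP h), ?_⟩
            · simp only [consStep, hb, ha, ha', if_true]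
              rw [h1, eraseP_append_any, if_neg ha]; rfl
            · simp only [consStep, hb, ha, ha', if_true]
              simp only [disc] at h3 ⊢
              rw [h1, eraseP_append_any, if_neg ha, List.map_append, List.sum_append,
                sum_val_eraseP (s := - val c) ho fun x hx hs => by
                  rw [val_of_serves hs fun e => h2 (e ▸ hx), neg_neg]]
              rw [h1] at h3
              simp only [List.map_append, List.sum_append] at h3 
              simp
              linarith
          · have ha' : ¬ (act u r).1.any c.serves := by
              rw [h1, List.any_append]; simp only [Bool.or_eq_true]; tauto
            refine ⟨O, ?_, h2, ?_⟩
            · simp only [consStep, hb, ha, ha', if_true]; exact h1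
            · simp only [consStep, hb, ha, ha', if_true]
              simp only [disc] at h3 ⊢
              simp
              linarith
      · refine ⟨O, ?_, h2, ?_⟩
        · simp [consStep, hb, h1]
        · simp only [consStep, hb]
          simp only [disc] at h3 ⊢
          simp
          linarith
  exact key.choose_spec.2.2

/-- One plus the number of orders of the shortest suffix with a surviving burger (zero if there is
no such suffix). -/
def blkLen : List Letter → ℕ
  | [] => 0
  | c :: v => if blkLen v ≠ 0 then blkLen v else
      if (red (c :: v)).2 ≠ [] then (red (c :: v)).1.length + 1 else 0

lemma blkLen_append {u v : List Letter} (h : blkLen v ≠ 0) : blkLen (u ++ v) = blkLen v := by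
  induction u with
  | nil => rfl
  | cons c u ih => rw [List.cons_append, blkLen, ih, if_pos h]

lemma blkLen_le_cons (c : Letter) (v : List Letter) : blkLen v ≤ blkLen (c :: v) := by
  rw [blkLen]; split_ifs <;> omega

lemma val_burger_sq (t : Bool) : val (burger t) * val (burger t) = 1 := by
  cases t <;> simp [val, burger]

lemma val_opp (t : Bool) : val (opp t) = val (burger t) := by
  cases t <;> simp [val, burger, opp]

section
variable {p : ℝ} [hp : Fact (p ∈ Set.Ioo (1 / 2 : ℝ) 1)]

/-- The discrepancy is odd under the exchange of the two kinds. -/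
lemma Ew_disc (n : ℕ) : Ew p n (fun u => disc (red u)) = 0 := by
  have := Ew_flip p n fun u => disc (red u)
  simp_rw [red_flip, disc_flip] at this
  have h2 := Ew_mul p n (-1) fun u => disc (red u)
  simp only [neg_mul, one_mul] at h2
  linarith

/-- Reveal letters to the left until a burger survives. This burger is then the freshest one,
whatever lies further left. The discrepancy is that of the rest, which has mean zero and is
independent, plus $N+1$ contributions of the same sign as the burger: $\mathtt b$ orders count like
$\mathtt a$ burgers and conversely. -/
lemma Ew_disc_mul_topVal (n : ℕ) {v : List Letter} (hv : (red v).2 = []) (hv' : blkLen v = 0) :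
    Ew p n (fun u => disc (red (u ++ v)) * topVal (red (u ++ v))) =
      Ew p n fun u => (blkLen (u ++ v) : ℝ) := by
  induction n generalizing v with
  | zero => simp [Ew, topVal, hv, hv']
  | succ n ih =>
    rw [Ew_succ_snoc, Ew_succ_snoc]
    refine Finset.sum_congr rfl fun c _ => ?_
    congr 1
    simp only [List.append_assoc, List.singleton_append]
    by_cases h : (red (c :: v)).2 = []
    · exact ih h (by rw [blkLen, if_neg (by simpa using hv'), if_neg (by simpa using h)])
    · obtain ⟨t, N, e⟩ := red_cons_of_snd_ne_nil hv h
      have hb : blkLen (c :: v) = N + 1 := by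
        rw [blkLen, if_neg (by simpa using hv'), if_pos h, e]; simp
      have h1 : ∀ u, disc (red (u ++ c :: v)) * topVal (red (u ++ c :: v)) =
          val (burger t) * disc (red u) + (N + 1) := by
        intro u
        have ht : topVal (red (u ++ c :: v)) = val (burger t) := by
          obtain ⟨T, hT⟩ := red_append_snd u (c :: v)
          rw [topVal, hT, e]; simp
        rw [ht, red_append, disc_act u (by
          rw [e]; intro hF
          have := List.eq_of_mem_replicate hF
          cases t <;> simp [opp] at this), e]
        simp only [disc, List.map_replicate, List.sum_replicate, List.map_cons, List.map_nil,
          List.sum_cons, List.sum_nil, val_opp, nsmul_eq_mul]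
        have := val_burger_sq t
        linear_combination ((N : ℝ) + 1) * this
      simp_rw [h1]
      rw [Ew_add, Ew_mul, Ew_disc, Ew_const, mul_zero, zero_add]
      have h2 : ∀ u, ((blkLen (u ++ c :: v) : ℕ) : ℝ) = N + 1 := fun u => by
        rw [blkLen_append (by rw [hb]; omega), hb]; push_cast; rfl
      simp_rw [h2]
      rw [Ew_const]

/-- A letter of definite kind adds an independent centred term of variance $1$. A letter $\mathtt F$
removes the freshest burger, with cross term $-2\,\mathbb E[\mathrm{disc}\cdot\mathrm{top}]$; its
probability $p/2$ turns this into $-p\,\mathbb E[\mathrm{blkLen}]$. -/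
lemma Ew_disc_sq_succ_le (n : ℕ) : Ew p (n + 1) (fun u => disc (red u) ^ 2) ≤
    Ew p n (fun u => disc (red u) ^ 2) + 1 - p * Ew p n fun u => (blkLen u : ℝ) := by
  have h0 := Ew_disc_mul_topVal (p := p) n (v := []) rfl rfl
  simp only [List.append_nil] at h0
  rw [Ew_succ_snoc, sum_letter, ← h0]
  simp_rw [red_concat]
  have hF : Ew p n (fun u => disc (snocStep (red u) .F) ^ 2) ≤
      Ew p n (fun u => disc (red u) ^ 2) + 1 - 2 * Ew p n fun u => disc (red u) * topVal (red u) := by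
    rw [sub_eq_add_neg, ← neg_mul, ← Ew_mul, ← Ew_const p n 1, ← Ew_add, ← Ew_add]
    refine Ew_mono fun u _ => ?_
    rw [disc_snocStep_F (wf_red u)]
    linarith [topVal_sq_le (red u)]
  have hc : ∀ c, c ≠ Letter.F → Ew p n (fun u => disc (snocStep (red u) c) ^ 2) =
      Ew p n (fun u => disc (red u) ^ 2) + val c ^ 2 := by
    intro c hc
    have : ∀ u, disc (snocStep (red u) c) ^ 2 =
        (disc (red u) ^ 2 + 2 * val c * disc (red u)) + val c ^ 2 := fun u => by
      rw [disc_snocStep hc]; ring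
    simp_rw [this]
    rw [Ew_add, Ew_add, Ew_mul, Ew_disc, Ew_const]; ring
  rw [hc .a (by simp), hc .b (by simp), hc .A (by simp), hc .B (by simp)]
  simp only [Letter.prob, val]
  have := hp.out.1
  nlinarith

lemma Ew_blkLen_mono : Monotone fun n => Ew p n fun u => (blkLen u : ℝ) := by
  refine monotone_nat_of_le_succ fun n => ?_
  rw [Ew_succ_cons]
  calc Ew p n (fun u => (blkLen u : ℝ))
      = ∑ c, Letter.prob p c * Ew p n (fun u => (blkLen u : ℝ)) := by
        rw [← Finset.sum_mul, sum_prob, one_mul]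
    _ ≤ _ := Finset.sum_le_sum fun c _ => mul_le_mul_of_nonneg_left
        (Ew_mono fun u _ => by exact_mod_cast blkLen_le_cons c u) (prob_nonneg c)

/-- If the mean exceeded $1/p$ at some length it would do so at all larger lengths, and the second
moment of the discrepancy would decrease linearly and become negative. -/
lemma Ew_blkLen_le (m : ℕ) : Ew p m (fun u => (blkLen u : ℝ)) ≤ 1 / p := by
  have hp0 : 0 < p := by linarith [hp.out.1]
  set χ := Ew p m fun u => (blkLen u : ℝ)
  have h : ∀ K : ℕ, Ew p (m + K) (fun u => disc (red u) ^ 2) ≤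
      Ew p m (fun u => disc (red u) ^ 2) + K * (1 - p * χ) := by
    intro K
    induction K with
    | zero => simp
    | succ K ih =>
      have h1 := Ew_disc_sq_succ_le (p := p) (m + K)
      have h2 := Ew_blkLen_mono (p := p) (show m ≤ m + K by omega)
      simp only at h2
      have h3 := mul_le_mul_of_nonneg_left h2 hp0.le
      rw [← add_assoc]; push_cast
      linarith
  rw [le_div_iff₀ hp0]
  by_contra hcon
  push Not at hcon
  obtain ⟨K, hK⟩ := exists_nat_gt (Ew p m (fun u => disc (red u) ^ 2) / (χ * p - 1))
  rw [div_lt_iff₀ (by linarith)] at hK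
  have := h K
  have h0 : 0 ≤ Ew p (m + K) (fun u => disc (red u) ^ 2) := Ew_nonneg fun u => sq_nonneg _
  linarith

lemma IsBackBlock.blkLen_eq {x : ℤ → Letter} {n : ℕ} {q : Bool × ℕ} (h : IsBackBlock x n q) :
    blkLen (pw x n) = q.2 + 1 := by
  have h0 : ∀ k < n, blkLen (pw x k) = 0 := by
    intro k hk
    induction k with
    | zero => simp [pw, blkLen]
    | succ k ih =>
      have := h.2 (k + 1) hk
      rw [pw_succ] at this ⊢
      rw [blkLen, if_neg (by simpa using ih (by omega)), if_neg (by simpa using this)]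
  rcases n with _ | n
  · have := h.1; simp [pw] at this
  · have := h.1
    rw [pw_succ] at this ⊢
    rw [blkLen, if_neg (by simpa using h0 n (by omega)), this]
    simp

/-- Once the past is long enough to contain the block, `blkLen` is constant equal to $N+1$; monotone
convergence passes the bound to the limit. -/
lemma lintegral_backLaw_le : ∫⁻ N, ((N : ℝ≥0∞) + 1) ∂(backLaw p) ≤ ENNReal.ofReal (1 / p) := by
  rw [backLaw, lintegral_map (measurable_of_countable _) measurable_backLen]
  calc _ ≤ ∫⁻ x, ⨆ m, ENNReal.ofReal (blkLen (pw x m) : ℝ) ∂(wordLaw p) := by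
        refine lintegral_mono_ae ?_
        filter_upwards [ae_exists_backBlock (p := p)] with x ⟨n, q, hx⟩
        refine le_iSup_of_le n ?_
        rw [(backBlock_eq_some.1 hx).1.blkLen_eq, hx]
        simp only [Option.elim_some]
        rw [← ENNReal.ofReal_natCast]; push_cast
        rw [ENNReal.ofReal_add (by positivity) (by norm_num), ENNReal.ofReal_natCast]
        simp
    _ = ⨆ m, ENNReal.ofReal (Ew p m fun u => (blkLen u : ℝ)) := by
        rw [lintegral_iSup (fun m => measurable_pw m fun u => ENNReal.ofReal (blkLen u : ℝ))]
        · exact iSup_congr fun m => lintegral_pw (f := fun u => (blkLen u : ℝ)) fun u => by positivity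
        · refine monotone_nat_of_le_succ fun m x => ?_
          rw [pw_succ]
          exact ENNReal.ofReal_le_ofReal (by exact_mod_cast blkLen_le_cons _ _)
    _ ≤ _ := iSup_le fun m => ENNReal.ofReal_le_ofReal (Ew_blkLen_le m)

/-- The letter at time $-1$ is a burger with probability $1/2$, and then it is the whole block. -/
lemma half_le_backLaw_zero : 2⁻¹ ≤ backLaw p {0} := by
  rw [backLaw, Measure.map_apply measurable_backLen (measurableSet_singleton 0)]
  have h : ∀ x : ℤ → Letter, (x (-1)).isBurger = true → (backBlock x).elim 0 (fun r => r.2.2.2) = 0 := by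
    intro x hx
    obtain ⟨t, ht⟩ := exists_burger hx
    have : backBlock x = some (1, 0, (t, 0)) := by
      refine backBlock_eq_some.2 ⟨⟨?_, fun k hk => ?_⟩, rfl⟩
      · have : pw x 1 = [burger t] := by rw [← ht]; rfl
        rw [this]; cases t <;> rfl
      · obtain rfl : k = 0 := by omega
        rfl
    rw [this]; rfl
  have hsub : {x : ℤ → Letter | x (-1) = .a} ∪ {x | x (-1) = .b} ⊆
      (fun x => (backBlock x).elim 0 fun r => r.2.2.2) ⁻¹' {0} := by
    rintro x (hx | hx)
    · exact h x (by rw [show x (-1) = .a from hx]; rfl)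
    · exact h x (by rw [show x (-1) = .b from hx]; rfl)
  refine le_trans ?_ (measure_mono hsub)
  rw [measure_union, wordLaw_letter, wordLaw_letter]
  · simp only [Letter.prob]
    rw [← ENNReal.ofReal_add (by norm_num) (by norm_num)]
    rw [show (1 / 4 + 1 / 4 : ℝ) = 2⁻¹ by norm_num, ENNReal.ofReal_inv_of_pos (by norm_num)]
    simp
  · rw [Set.disjoint_left]
    intro x h1 h2
    have h1 : x (-1) = .a := h1
    have h2 : x (-1) = .b := h2
    rw [h1] at h2; cases h2
  · exact (measurable_pi_apply (-1 : ℤ) : Measurable fun x : ℤ → Letter => x (-1))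
      (measurableSet_singleton Letter.b)

end

end BurgerWord

namespace BurgerWord

/-! ### The shortest future with an unserved flexible order -/

/-- The word `fw x n` is the shortest future with an unserved flexible order, and the other
unserved orders are `O`. -/
def IsForeBlock (x : ℤ → Letter) (n : ℕ) (O : List Letter) : Prop :=
  red (fw x n) = (O ++ [.F], []) ∧ Letter.F ∉ O ∧ ∀ k < n, Letter.F ∉ (red (fw x k)).1

lemma IsForeBlock.congr {x x' : ℤ → Letter} {n : ℕ} {O : List Letter} (h : IsForeBlock x n O)
    (hx : ∀ k : ℤ, 0 ≤ k → k < n → x k = x' k) : IsForeBlock x' n O := by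
  refine ⟨?_, h.2.1, fun k hk => ?_⟩
  · rw [← fw_congr hx]; exact h.1
  · rw [← fw_congr (n := k) fun j h1 h2 => hx j h1 (by omega)]; exact h.2.2 k hk

lemma IsForeBlock.unique {x : ℤ → Letter} {n n' : ℕ} {O O' : List Letter} (h : IsForeBlock x n O)
    (h' : IsForeBlock x n' O') : n = n' ∧ O = O' := by
  have e : n = n' := by
    rcases lt_trichotomy n n' with hl | hl | hl
    · have := h'.2.2 n hl; rw [h.1] at this; simp at this
    · exact hl
    · have := h.2.2 n' hl; rw [h'.1] at this; simp at this
  subst e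
  have := h.1.symm.trans h'.1
  simp only [Prod.mk.injEq, and_true] at this
  exact ⟨rfl, List.append_cancel_right this⟩

/-- Every burger serves $\mathtt F$, so an $\mathtt F$ stays unserved only when the stack is empty.
Hence nothing but orders remains at the end of the forward search. -/
lemma snocStep_F_mem {r : RWord} (hr : WF r) {c : Letter} (h : Letter.F ∉ r.1)
    (h' : Letter.F ∈ (snocStep r c).1) : snocStep r c = (r.1 ++ [.F], []) := by
  obtain ⟨O, S⟩ := r
  unfold snocStep at h' ⊢
  split_ifs at h' ⊢ with h1 h2
  · exact absurd h' h
  · exact absurd h' h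
  · have hc : c = .F := by
      rcases List.mem_append.1 h' with h3 | h3
      · exact absurd h3 h
      · exact (List.mem_singleton.1 h3).symm
    subst hc
    rcases S with _ | ⟨d, S⟩
    · rfl
    · exact absurd (List.any_eq_true.2 ⟨d, by simp, serves_F (hr.2 d (by simp))⟩) h2

lemma exists_isForeBlock {x : ℤ → Letter} (h : ∃ n, Letter.F ∈ (red (fw x n)).1) :
    ∃ n O, IsForeBlock x n O := by
  classical
  have h1 := Nat.find_spec h
  have h2 : ∀ k < Nat.find h, Letter.F ∉ (red (fw x k)).1 := fun k hk => Nat.find_min h hk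
  rcases e : Nat.find h with _ | m
  · rw [e] at h1; simp [fw] at h1
  · rw [e] at h1 h2
    have h3 := h2 m (by omega)
    have h4 : red (fw x (m + 1)) = snocStep (red (fw x m)) (x m) := by rw [fw_succ, red_concat]
    rw [h4] at h1
    exact ⟨m + 1, _, by rw [h4, snocStep_F_mem (wf_red _) h3 h1], h3, h2⟩

lemma IsForeBlock.flip {x : ℤ → Letter} {n : ℕ} {O : List Letter} (h : IsForeBlock x n O) :
    IsForeBlock (fun k => flip (x k)) n (O.map flip) := by
  have hF : ∀ l : List Letter, Letter.F ∉ l → Letter.F ∉ l.map BurgerWord.flip := by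
    intro l hl hF
    obtain ⟨c, hc, e⟩ := List.mem_map.1 hF
    cases c <;> simp [BurgerWord.flip] at e
    exact hl hc
  refine ⟨?_, hF _ h.2.1, fun k hk => ?_⟩
  · rw [fw_flip, red_flip, h.1]; simp [BurgerWord.flip]
  · rw [fw_flip, red_flip]; exact hF _ (h.2.2 k hk)

open Classical in
/-- The exploration of the future up to the first unserved flexible order. -/
noncomputable def foreBlock (x : ℤ → Letter) : Option (ℕ × ℕ × List Letter) :=
  if h : ∃ r : ℕ × List Letter, IsForeBlock x r.1 r.2 then some (0, h.choose) else none

lemma foreBlock_eq_some {x : ℤ → Letter} {r : ℕ × ℕ × List Letter} :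
    foreBlock x = some r ↔ r.1 = 0 ∧ IsForeBlock x r.2.1 r.2.2 := by
  obtain ⟨n', n, O⟩ := r
  unfold foreBlock
  split_ifs with h
  · simp only [Option.some.injEq, Prod.mk.injEq]
    have hs := h.choose_spec
    constructor
    · rintro ⟨rfl, h2⟩; rw [h2] at hs; exact ⟨rfl, hs⟩
    · rintro ⟨rfl, h1⟩
      have := hs.unique h1
      exact ⟨rfl, Prod.ext this.1 this.2⟩
  · simp only [reduceCtorEq, false_iff, not_and]
    intro _ h1; exact absurd ⟨(n, O), h1⟩ h

lemma isExploration_foreBlock : IsExploration foreBlock := by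
  intro x x' m n q h hx
  obtain ⟨rfl, h1⟩ := foreBlock_eq_some.1 h
  exact foreBlock_eq_some.2 ⟨rfl, h1.congr (by simpa using hx)⟩

lemma foreBlock_flip (x : ℤ → Letter) :
    foreBlock (fun k => flip (x k)) = (foreBlock x).map fun r => (r.1, r.2.1, r.2.2.map flip) := by
  rcases h : foreBlock x with _ | ⟨n', n, O⟩
  · rw [Option.map_none]
    rcases h' : foreBlock (fun k => flip (x k)) with _ | ⟨n', n, O⟩
    · rfl
    · have := (foreBlock_eq_some.1 h').2.flip
      simp only [flip_flip] at this
      rw [foreBlock_eq_some (r := (0, n, O.map flip)) |>.2 ⟨rfl, this⟩] at h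
      cases h
  · obtain ⟨h1, h2⟩ := foreBlock_eq_some.1 h
    exact foreBlock_eq_some.2 ⟨h1, h2.flip⟩

/-- The unserved orders before the first unserved flexible order. -/
def foreLen (u : List Letter) : ℕ := ((red u).1.takeWhile (· ≠ .F)).length

lemma takeWhile_length_append {α : Type*} (q : α → Bool) (l l' : List α) :
    (l.takeWhile q).length ≤ ((l ++ l').takeWhile q).length := by
  induction l with
  | nil => simp
  | cons c l ih =>
    rw [List.cons_append, List.takeWhile_cons, List.takeWhile_cons]
    split_ifs
    · simpa using ih
    · simp

lemma foreLen_le_concat (u : List Letter) (c : Letter) : foreLen u ≤ foreLen (u ++ [c]) := by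
  obtain ⟨T, hT⟩ := red_append_fst u [c]
  rw [foreLen, foreLen, hT]
  exact takeWhile_length_append _ _ _

open Classical in
/-- The indicator of the reduced words on whose right an order `o` (other than `F`) could be
appended before the first unserved flexible order. -/
noncomputable def openFor (t : Bool) (r : RWord) : ℝ :=
  if Letter.F ∉ r.1 ∧ burger t ∉ r.2 then 1 else 0

lemma openFor_nonneg (t : Bool) (r : RWord) : 0 ≤ openFor t r := by
  unfold openFor; split_ifs <;> norm_num

lemma takeWhile_eq_self {l : List Letter} (h : Letter.F ∉ l) :
    l.takeWhile (· ≠ .F) = l :=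
  List.takeWhile_eq_self_iff.2 fun c hc => by
    have : c ≠ .F := fun e => h (e ▸ hc)
    simpa using this

lemma takeWhile_append_of_mem {l l' : List Letter} (h : Letter.F ∈ l) :
    (l ++ l').takeWhile (· ≠ .F) = l.takeWhile (· ≠ .F) := by
  rw [List.takeWhile_append, if_neg]
  intro h2
  have h3 := List.takeWhile_eq_self_iff.1 ((List.takeWhile_prefix _).eq_of_length h2) .F h
  simp at h3

lemma foreLen_concat_opp (u : List Letter) (t : Bool) :
    (foreLen (u ++ [opp !t]) : ℝ) = foreLen u + openFor t (red u) := by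
  classical
  have hs : ∀ c, c.isBurger = true → (c.serves (opp !t) = true ↔ c = burger t) := by
    intro c hc; cases t <;> cases c <;> simp_all [Letter.isBurger, opp, burger, Letter.serves]
  have hw := wf_red u
  simp only [foreLen]
  rw [red_concat, snocStep, if_neg (by simp)]
  have hany : ((red u).2.any fun x => x.serves (opp !t)) = true ↔ burger t ∈ (red u).2 := by
    rw [List.any_eq_true]
    constructor
    · rintro ⟨c, hc, h⟩; rwa [← (hs c (hw.2 c hc)).1 h]
    · intro h; exact ⟨_, h, (hs _ (by simp)).2 rfl⟩
  by_cases h : burger t ∈ (red u).2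
  · rw [if_pos (hany.2 h), openFor, if_neg (fun h' => h'.2 h), add_zero]
  · rw [if_neg (fun h' => h (hany.1 h'))]
    by_cases hF : Letter.F ∈ (red u).1
    · rw [takeWhile_append_of_mem hF, openFor, if_neg (fun h' => h'.1 hF), add_zero]
    · have hF' : Letter.F ∉ (red u).1 ++ [opp !t] := by
        cases t <;> simpa [opp] using hF
      rw [takeWhile_eq_self hF, takeWhile_eq_self hF', openFor, if_pos ⟨hF, h⟩]
      simp

lemma foreLen_concat_burger (u : List Letter) {c : Letter} (hc : c.isBurger = true) :
    foreLen (u ++ [c]) = foreLen u := by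
  simp only [foreLen]; rw [red_concat, snocStep, if_pos hc]

lemma foreLen_concat_F (u : List Letter) : foreLen (u ++ [.F]) = foreLen u := by
  simp only [foreLen]
  rw [red_concat, snocStep, if_neg (by simp [Letter.isBurger])]
  split_ifs with h
  · rfl
  · by_cases hF : Letter.F ∈ (red u).1
    · rw [takeWhile_append_of_mem hF]
    · rw [List.takeWhile_append, takeWhile_eq_self hF]; simp

lemma openFor_flip (t : Bool) (r : RWord) :
    openFor t (r.1.map flip, r.2.map flip) = openFor (!t) r := by
  have h : ∀ (l : List Letter) c, c ∈ l.map flip ↔ flip c ∈ l := by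
    intro l c
    rw [List.mem_map]
    constructor
    · rintro ⟨d, hd, rfl⟩; simpa using hd
    · intro h; exact ⟨_, h, by simp⟩
  unfold openFor
  simp only [h, flip_burger, show flip .F = .F from rfl]

/-! ### Mean number of orders collected by the forward search -/

section
variable {p : ℝ} [hp : Fact (p ∈ Set.Ioo (1 / 2 : ℝ) 1)]

/-- Only a letter $\mathtt A$ or $\mathtt B$ that finds no burger of its kind, before any $\mathtt
F$ is unserved, adds an order. Summing over $n$, the mean is $(1-p)/2$ times the mean number of
times at which the word is open. -/
lemma Ew_foreLen_succ (n : ℕ) : Ew p (n + 1) (fun u => (foreLen u : ℝ)) =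
    Ew p n (fun u => (foreLen u : ℝ)) + (1 - p) / 2 * Ew p n fun u => openFor true (red u) := by
  have hsym : Ew p n (fun u => openFor false (red u)) = Ew p n fun u => openFor true (red u) := by
    rw [← Ew_flip p n fun u => openFor true (red u)]
    simp_rw [red_flip, openFor_flip]; rfl
  have hA : ∀ u, (foreLen (u ++ [.A]) : ℝ) = foreLen u + openFor true (red u) := fun u =>
    foreLen_concat_opp u true
  have hB : ∀ u, (foreLen (u ++ [.B]) : ℝ) = foreLen u + openFor false (red u) := fun u =>
    foreLen_concat_opp u false
  rw [Ew_succ_snoc, sum_letter]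
  simp_rw [hA, hB, foreLen_concat_F, foreLen_concat_burger _ (show Letter.a.isBurger = true from rfl),
    foreLen_concat_burger _ (show Letter.b.isBurger = true from rfl)]
  rw [Ew_add, Ew_add, hsym]
  simp only [Letter.prob]; ring

/-- The expected number of times at which the past, followed by the reduced word `r`, is open for
`A`. -/
noncomputable def openTime (p : ℝ) (k : ℕ) (r : RWord) : ℝ≥0∞ :=
  ∫⁻ x, ∑ j ∈ Finset.range k, ENNReal.ofReal (openFor true (act (pw x j) r)) ∂(wordLaw p)

lemma measurable_openSum (k : ℕ) (r : RWord) : Measurable fun x =>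
    ∑ j ∈ Finset.range k, ENNReal.ofReal (openFor true (act (pw x j) r)) :=
  Finset.measurable_sum _ fun j _ => measurable_pw j fun u => ENNReal.ofReal (openFor true (act u r))

lemma openTime_succ (k : ℕ) (r : RWord) : openTime p (k + 1) r =
    ENNReal.ofReal (openFor true r) +
      ∑ c, ENNReal.ofReal (Letter.prob p c) * openTime p k (consStep c r) := by
  have h : ∀ (x : ℤ → Letter) j, act (pw x (j + 1)) r =
      act (pw (collapse 1 0 x) j) (consStep (x (-1)) r) := fun x j => by
    rw [pw_add_collapse x 1 0 j, act_append]; rfl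
  simp only [openTime]
  simp_rw [Finset.sum_range_succ' _ k, h]
  rw [lintegral_add_right _ (by exact measurable_pw 0 fun u => ENNReal.ofReal (openFor true (act u r))),
    add_comm]
  congr 1
  · simp [pw]
  · exact lintegral_past_letter (F := fun c y => ∑ j ∈ Finset.range k,
      ENNReal.ofReal (openFor true (act (pw y j) (consStep c r)))) fun c => measurable_openSum k _

/-- Letters added on the left cannot consume a burger of `r`, so a surviving hamburger closes the
word to $\mathtt A$ for ever. -/
lemma openTime_of_mem {r : RWord} (h : Letter.a ∈ r.2) (k : ℕ) : openTime p k r = 0 := by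
  unfold openTime
  refine (lintegral_congr fun x => ?_).trans lintegral_zero
  refine Finset.sum_eq_zero fun j _ => ?_
  obtain ⟨T, hT⟩ := act_snd (pw x j) r
  rw [openFor, if_neg, ENNReal.ofReal_zero]
  rintro ⟨-, h2⟩
  exact h2 (by rw [hT]; exact List.mem_append_left _ h)

lemma act_orders {O : List Letter} (hO : ∀ o ∈ O, o.isBurger = false) (r : RWord) :
    act O r = (O ++ r.1, r.2) := by
  induction O with
  | nil => rfl
  | cons o O ih =>
    rw [act_cons, ih fun o' ho => hO o' (by simp [ho]), consStep, if_neg (by simp [hO o])]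
    rfl

lemma act_red (u : List Letter) (r : RWord) :
    act u r = act (red u).1 (act (red u).2.reverse r) := by
  rw [← act_append]
  exact act_eq_of_cls_eq (by rw [cls_append, ← cls_eq_red]) r

lemma IsBackBlock.act_eq {x : ℤ → Letter} {n : ℕ} {q : Bool × ℕ} (h : IsBackBlock x n q)
    (r : RWord) :
    act (pw x n) r = act (List.replicate q.2 (opp q.1)) (consStep (burger q.1) r) := by
  rw [act_red, h.1]; rfl

lemma IsBackBlock.act_F {x : ℤ → Letter} {n : ℕ} {q : Bool × ℕ} (h : IsBackBlock x n q)
    (r : RWord) :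
    act (pw x n) (.F :: r.1, r.2) = (List.replicate q.2 (opp q.1) ++ r.1, r.2) := by
  have : consStep (burger q.1) (.F :: r.1, r.2) = r := by
    obtain ⟨t, N⟩ := q
    cases t <;> rfl
  rw [h.act_eq, this, act_orders fun o ho => by rw [List.eq_of_mem_replicate ho]; simp]

/-- Until a burger survives in the past the $\mathtt F$ remains unserved and the word is not open.
At that moment the block $\mathtt F$-and-burger cancels, leaving the $N$ orders in place of the
$\mathtt F$, and the unexplored past is fresh. -/
lemma openTime_F_le (k : ℕ) (r : RWord) : openTime p k (.F :: r.1, r.2) ≤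
    ∫⁻ x, (backBlock x).elim 0 (fun q =>
      openTime p k (List.replicate q.2.2.2 (opp q.2.2.1) ++ r.1, r.2)) ∂(wordLaw p) := by
  have := isExploration_backBlock.lintegral_eq (p := p) (F := fun q y => ∑ j ∈ Finset.range k,
    ENNReal.ofReal (openFor true (act (pw y j) (List.replicate q.2 (opp q.1) ++ r.1, r.2))))
    fun q => measurable_openSum k _
  simp only [openTime]
  rw [← this]
  refine lintegral_mono_ae ?_
  filter_upwards [ae_exists_backBlock (p := p)] with x ⟨n, q, hx⟩
  have hb := (backBlock_eq_some.1 hx).1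
  simp only at hb
  rw [hx, Option.elim_some]
  simp only
  have h0 : ∀ j < n, ENNReal.ofReal (openFor true (act (pw x j) (.F :: r.1, r.2))) = 0 := by
    intro j hj
    rw [openFor, if_neg, ENNReal.ofReal_zero]
    rintro ⟨h1, -⟩
    rw [act_red, hb.2 j hj, List.reverse_nil, act_nil, act_orders (wf_red _).1] at h1
    simp at h1
  have h1 : ∀ j, act (pw x (n + j)) (.F :: r.1, r.2) =
      act (pw (collapse n 0 x) j) (List.replicate q.2 (opp q.1) ++ r.1, r.2) := fun j => by
    rw [add_comm, pw_add_collapse x n 0 j, act_append, hb.act_F]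
  -- The range is lengthened by $n$ so that, after dropping the $n$ vanishing terms, exactly $k$
  -- terms of the fresh word remain.
  calc ∑ j ∈ Finset.range k, ENNReal.ofReal (openFor true (act (pw x j) (.F :: r.1, r.2)))
      ≤ ∑ j ∈ Finset.range (n + k), ENNReal.ofReal (openFor true (act (pw x j) (.F :: r.1, r.2))) :=
        Finset.sum_le_sum_of_subset (Finset.range_subset_range.2 (by omega))
    _ = _ := by
        rw [Finset.sum_range_add, Finset.sum_eq_zero fun j hj => h0 j (Finset.mem_range.1 hj),
          zero_add]
        simp_rw [h1]

variable (p) in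
/-- The constant `(2p - 1) / 4`, which is positive for `p > 1 / 2`. -/
noncomputable def gap : ℝ := (2 * p - 1) / 4

lemma lintegral_backLaw_len_le :
    ∫⁻ N, (N : ℝ≥0∞) ∂(backLaw p) ≤ ENNReal.ofReal (1 / p - 1) := by
  have h := lintegral_backLaw_le (p := p)
  rw [lintegral_add_right _ measurable_const, lintegral_const, measure_univ, mul_one] at h
  rw [ENNReal.ofReal_sub _ (by norm_num), ENNReal.ofReal_one]
  exact ENNReal.le_sub_of_add_le_right (by norm_num) h

/-- The number of unserved $\mathtt A$ is a supermartingale along the backward reading. Its drift is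
at most $-\frac14+\frac{1-p}4+\frac p2\cdot\frac12(\frac1p-1)=-\frac{2p-1}4$: an $\mathtt a$ removes
one, an $\mathtt A$ adds one, and an $\mathtt F$ is replaced by $N$ orders which are $\mathtt A$
half of the time. Each unit of time spent open is paid by this gap; when an $\mathtt a$ finds no
$\mathtt A$ the count stops, whence the $+1$. -/
lemma openTime_le (k : ℕ) {r : RWord} (hr : WF r) (hF : Letter.F ∉ r.1) (ha : Letter.a ∉ r.2) :
    openTime p k r ≤ ENNReal.ofReal (1 / gap p) * (r.1.count .A + 1 : ℕ) := by
  have hp1 := hp.out.1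
  have hp2 := hp.out.2
  have hg : 0 < gap p := by unfold gap; linarith
  set D := ENNReal.ofReal (1 / gap p) with hD
  induction k generalizing r with
  | zero => simp [openTime]
  | succ k ih =>
    obtain ⟨O, S⟩ := r
    simp only at hF ha
    set m := O.count Letter.A with hm
    have e1 : openTime p k (consStep .a (O, S)) ≤ D * (m : ℕ) := by
      by_cases h : O.any Letter.a.serves
      · have hw := hr.consStep .a
        simp only [consStep, Letter.isBurger, h, if_true] at hw ⊢
        refine (ih hw (fun h' => hF (List.mem_of_mem_eraseP h')) ha).trans ?_
        gcongr
        obtain ⟨y, hy, hcy⟩ := List.any_eq_true.1 h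
        obtain ⟨z, l₁, l₂, -, hz, e, e'⟩ := List.exists_of_eraseP hy hcy
        have hzF : z ≠ .F := fun h' => hF (by rw [e, h']; simp)
        have hzA : z = .A := by cases z <;> simp_all [Letter.serves]
        simp only
        rw [e', hm, e, hzA]
        simp
      · rw [openTime_of_mem]
        · exact zero_le
        · simp [consStep, Letter.isBurger, h]
    have e2 : openTime p k (consStep .b (O, S)) ≤ D * (m + 1 : ℕ) := by
      have hw := hr.consStep .b
      by_cases h : O.any Letter.b.serves
      · simp only [consStep, Letter.isBurger, h, if_true] at hw ⊢
        refine (ih hw (fun h' => hF (List.mem_of_mem_eraseP h')) ha).trans ?_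
        gcongr
        exact (List.eraseP_sublist).count_le _
      · simp only [consStep, Letter.isBurger, h, if_true] at hw ⊢
        exact ih hw hF (by simpa using ha)
    have e3 : openTime p k (consStep .A (O, S)) ≤ D * (m + 2 : ℕ) := by
      refine (ih (hr.consStep .A) (by simpa [consStep, Letter.isBurger] using hF) ha).trans ?_
      refine le_of_eq ?_
      congr 2
      simp [consStep, Letter.isBurger, hm]
    have e4 : openTime p k (consStep .B (O, S)) ≤ D * (m + 1 : ℕ) := by
      refine (ih (hr.consStep .B) (by simpa [consStep, Letter.isBurger] using hF) ha).trans ?_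
      simp [consStep, Letter.isBurger, hm]
    -- The $\mathtt F$ is exchanged for its block; only a surviving cheeseburger brings orders
    -- $\mathtt A$.
    have e5 : openTime p k (consStep .F (O, S)) ≤
        D * (m + 1 : ℕ) + D * ENNReal.ofReal ((1 / p - 1) / 2) := by
      calc openTime p k (consStep .F (O, S)) ≤ _ := openTime_F_le k (O, S)
        _ ≤ ∫⁻ x, (backBlock x).elim 0 (fun q => D * (m + 1 : ℕ) +
              D * (if q.2.2.1 then 0 else (q.2.2.2 : ℝ≥0∞))) ∂(wordLaw p) := by
            refine lintegral_mono fun x => ?_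
            simp only
            rcases backBlock x with _ | ⟨n, n', t, N⟩
            · simp
            · simp only [Option.elim_some]
              refine (ih ?_ ?_ ha).trans ?_
              · refine ⟨fun o ho => ?_, hr.2⟩
                rcases List.mem_append.1 ho with h | h
                · rw [List.eq_of_mem_replicate h]; simp
                · exact hr.1 o h
              · intro h
                rcases List.mem_append.1 h with h | h
                · have := List.eq_of_mem_replicate h
                  cases t <;> simp [opp] at this
                · exact hF h
              · rw [← mul_add]
                gcongr
                cases t
                · simp [opp, List.count_replicate, hm]
                  exact le_of_eq (by ring)
                · simp [opp, List.count_replicate, hm]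
        _ = ∫⁻ N, (D * (m + 1 : ℕ) + D * 2⁻¹ * (N : ℝ≥0∞)) ∂(backLaw p) := by
            rw [lintegral_backBlock fun t N => D * (m + 1 : ℕ) + D * (if t then 0 else (N : ℝ≥0∞))]
            refine lintegral_congr fun N => ?_
            simp only [if_true, Bool.false_eq_true, if_false, mul_zero, add_zero]
            rw [← add_assoc, ← two_mul, mul_add, ← mul_assoc,
              ENNReal.inv_mul_cancel (by norm_num) (by norm_num), one_mul]
            ring
        _ ≤ _ := by
            rw [lintegral_add_left measurable_const, lintegral_const, measure_univ, mul_one,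
              lintegral_const_mul _ (measurable_of_countable _), mul_assoc]
            gcongr
            rw [div_eq_inv_mul, ENNReal.ofReal_mul (by norm_num)]
            gcongr
            · rw [ENNReal.ofReal_inv_of_pos (by norm_num)]; simp
            · exact lintegral_backLaw_len_le
    rw [openTime_succ, sum_letter]
    have e0 : ENNReal.ofReal (openFor true (O, S)) ≤ 1 := by
      rw [← ENNReal.ofReal_one]
      refine ENNReal.ofReal_le_ofReal ?_
      unfold openFor; split_ifs <;> norm_num
    have hmu : 0 ≤ (1 / p - 1) / 2 := by
      have : 1 ≤ 1 / p := by rw [le_div_iff₀ (by linarith)]; linarith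
      linarith
    calc _ ≤ 1 + (ENNReal.ofReal (Letter.prob p .a) * (D * (m : ℕ)) +
          (ENNReal.ofReal (Letter.prob p .b) * (D * (m + 1 : ℕ)) +
          (ENNReal.ofReal (Letter.prob p .A) * (D * (m + 2 : ℕ)) +
          (ENNReal.ofReal (Letter.prob p .B) * (D * (m + 1 : ℕ)) +
          ENNReal.ofReal (Letter.prob p .F) *
            (D * (m + 1 : ℕ) + D * ENNReal.ofReal ((1 / p - 1) / 2)))))) := by
          gcongr
      _ = ENNReal.ofReal (1 + (Letter.prob p .a * (1 / gap p * m) +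
          (Letter.prob p .b * (1 / gap p * (m + 1)) +
          (Letter.prob p .A * (1 / gap p * (m + 2)) +
          (Letter.prob p .B * (1 / gap p * (m + 1)) +
          Letter.prob p .F * (1 / gap p * (m + 1) + 1 / gap p * ((1 / p - 1) / 2))))))) := by
          have hd : 0 ≤ 1 / gap p := by positivity
          have hpa := prob_nonneg (p := p) .a
          have hpb := prob_nonneg (p := p) .b
          have hpA := prob_nonneg (p := p) .A
          have hpB := prob_nonneg (p := p) .B
          have hpF := prob_nonneg (p := p) .F
          have hc : ∀ n : ℕ, (n : ℝ≥0∞) = ENNReal.ofReal (n : ℝ) := fun n => by simp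
          rw [hc, hc, hc, hD]
          push_cast
          rw [← ENNReal.ofReal_mul hd, ← ENNReal.ofReal_mul hd, ← ENNReal.ofReal_mul hd,
            ← ENNReal.ofReal_mul hd, ← ENNReal.ofReal_add (by positivity) (by positivity),
            ← ENNReal.ofReal_mul hpa, ← ENNReal.ofReal_mul hpb, ← ENNReal.ofReal_mul hpA,
            ← ENNReal.ofReal_mul hpB, ← ENNReal.ofReal_mul hpF,
            ← ENNReal.ofReal_add (by positivity) (by positivity),
            ← ENNReal.ofReal_add (by positivity) (by positivity),
            ← ENNReal.ofReal_add (by positivity) (by positivity),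
            ← ENNReal.ofReal_add (by positivity) (by positivity), ← ENNReal.ofReal_one,
            ← ENNReal.ofReal_add (by norm_num) (by positivity)]
      _ = D * (m + 1 : ℕ) := by
          rw [← ENNReal.ofReal_natCast (m + 1), hD,
            ← ENNReal.ofReal_mul (by positivity)]
          congr 1
          simp only [Letter.prob, gap]
          push_cast
          have h1 : p ≠ 0 := by linarith
          have h2 : 2 * p - 1 ≠ 0 := by linarith
          field_simp
          ring

/-- Time reversal: the prefixes of the future and the suffixes of the past of each length have the
same law, so the mean open time of the forward reading is computed by `openTime` from the empty
word. -/
lemma Ew_foreLen_le (n : ℕ) : Ew p n (fun u => (foreLen u : ℝ)) ≤ (1 - p) / 2 * (1 / gap p) := by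
  have hp1 := hp.out.1
  have hp2 := hp.out.2
  have hg : 0 < gap p := by unfold gap; linarith
  have h1 : ∀ n, Ew p n (fun u => (foreLen u : ℝ)) =
      (1 - p) / 2 * ∑ k ∈ Finset.range n, Ew p k fun u => openFor true (red u) := by
    intro n
    induction n with
    | zero => simp [Ew, foreLen]
    | succ n ih => rw [Ew_foreLen_succ, ih, Finset.sum_range_succ, mul_add]
  rw [h1]
  refine mul_le_mul_of_nonneg_left ?_ (by linarith)
  have h2 := openTime_le (p := p) n (r := ([], [])) ⟨by simp, by simp⟩ (by simp) (by simp)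
  simp only [List.count_nil, zero_add, Nat.cast_one, mul_one] at h2
  rw [openTime, lintegral_finsetSum _ fun j _ =>
    (measurable_pw j fun u => ENNReal.ofReal (openFor true (act u ([], []))))] at h2
  have h3 : ∀ j, ∫⁻ x, ENNReal.ofReal (openFor true (act (pw x j) ([], []))) ∂(wordLaw p) =
      ENNReal.ofReal (Ew p j fun u => openFor true (red u)) := fun j =>
    lintegral_pw (f := fun u => openFor true (red u)) fun u => openFor_nonneg _ _
  simp_rw [h3] at h2
  rw [← ENNReal.ofReal_sum_of_nonneg fun j _ => Ew_nonneg fun u => openFor_nonneg _ _] at h2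
  exact (ENNReal.ofReal_le_ofReal_iff (by positivity)).1 h2

lemma lintegral_iSup_foreLen_le : ∫⁻ x, ⨆ n, (foreLen (fw x n) : ℝ≥0∞) ∂(wordLaw p) ≤
    ENNReal.ofReal ((1 - p) / 2 * (1 / gap p)) := by
  rw [lintegral_iSup (fun n => measurable_fw n fun u => (foreLen u : ℝ≥0∞))]
  · refine iSup_le fun n => ?_
    have := lintegral_fw (p := p) (n := n) (f := fun u => (foreLen u : ℝ)) fun u => by positivity
    simp only [ENNReal.ofReal_natCast] at this
    rw [this]
    exact ENNReal.ofReal_le_ofReal (Ew_foreLen_le n)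
  · refine monotone_nat_of_le_succ fun n x => ?_
    simp only
    rw [fw_succ]
    exact_mod_cast foreLen_le_concat _ _

/-- If no $\mathtt F$ were ever unserved, all unserved orders would be counted by `foreLen`, which
is bounded along almost every word, whereas the net count of the future is unbounded below. -/
lemma ae_exists_foreBlock : ∀ᵐ x ∂(wordLaw p), ∃ n O, foreBlock x = some (0, n, O) := by
  have hfin := ae_lt_top (Measurable.iSup fun n => measurable_fw n fun u => (foreLen u : ℝ≥0∞))
    ((lintegral_iSup_foreLen_le (p := p)).trans_lt ENNReal.ofReal_lt_top).ne
  have hcount := ae_all_iff.2 fun K => ae_exists_netCount_fw_lt (p := p) K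
  filter_upwards [hfin, hcount] with x h1 h2
  suffices h : ∃ n, Letter.F ∈ (red (fw x n)).1 by
    obtain ⟨n, O, hO⟩ := exists_isForeBlock h
    exact ⟨n, O, foreBlock_eq_some.2 ⟨rfl, hO⟩⟩
  by_contra hcon
  push Not at hcon
  obtain ⟨K, hK⟩ := ENNReal.exists_nat_gt h1.ne
  obtain ⟨n, hn⟩ := h2 K
  have h3 : (foreLen (fw x n) : ℝ≥0∞) < K :=
    (le_iSup (fun n => (foreLen (fw x n) : ℝ≥0∞)) n).trans_lt hK
  rw [netCount_eq] at hn
  have h4 : foreLen (fw x n) < K := by exact_mod_cast h3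
  rw [foreLen, takeWhile_eq_self (hcon n)] at h4
  omega

variable (p) in
/-- The law of the numbers of orders of the two kinds before the first unserved flexible order. -/
noncomputable def foreLaw : Measure (ℕ × ℕ) :=
  (wordLaw p).map fun x => (foreBlock x).elim (0, 0) fun r => (r.2.2.count .A, r.2.2.count .B)

lemma measurable_foreCount : Measurable fun x =>
    (foreBlock x).elim (0, 0) fun r => (r.2.2.count Letter.A, r.2.2.count Letter.B) :=
  isExploration_foreBlock.measurable fun o =>
    o.elim (0, 0) fun r => (r.2.2.count Letter.A, r.2.2.count Letter.B)

instance : IsProbabilityMeasure (foreLaw p) :=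
  Measure.isProbabilityMeasure_map measurable_foreCount.aemeasurable

lemma count_map_flip (l : List Letter) : (l.map flip).count .A = l.count .B ∧
    (l.map flip).count .B = l.count .A := by
  induction l with
  | nil => simp
  | cons c l ih => cases c <;> simp [flip, ih.1, ih.2]

lemma lintegral_foreBlock (G : ℕ → ℕ → ℝ≥0∞) :
    ∫⁻ x, (foreBlock x).elim 0 (fun r => G (r.2.2.count .A) (r.2.2.count .B)) ∂(wordLaw p) =
      ∫⁻ q, 2⁻¹ * (G q.1 q.2 + G q.2 q.1) ∂(foreLaw p) := by
  have hm : ∀ G : ℕ → ℕ → ℝ≥0∞, Measurable fun x : ℤ → Letter =>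
      (foreBlock x).elim 0 (fun r => G (r.2.2.count .A) (r.2.2.count .B)) := fun G =>
    isExploration_foreBlock.measurable fun o => o.elim 0 fun r => G (r.2.2.count .A) (r.2.2.count .B)
  have h1 : ∫⁻ x, (foreBlock x).elim 0 (fun r => G (r.2.2.count .A) (r.2.2.count .B)) ∂(wordLaw p) =
      ∫⁻ x, (foreBlock x).elim 0 (fun r => G (r.2.2.count .B) (r.2.2.count .A)) ∂(wordLaw p) := by
    conv_lhs => rw [← map_flip_wordLaw]
    have hflip : Measurable fun (x : ℤ → Letter) k => flip (x k) := measurable_pi_lambda _ fun i =>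
      (measurable_of_countable flip).comp (measurable_pi_apply i)
    rw [lintegral_map (hm G) hflip]
    refine lintegral_congr fun x => ?_
    rw [foreBlock_flip]
    rcases foreBlock x with _ | r
    · rfl
    · simp only [Option.map_some, Option.elim_some, count_map_flip]
  have h2 : ∫⁻ q, 2⁻¹ * (G q.1 q.2 + G q.2 q.1) ∂(foreLaw p) =
      ∫⁻ x, 2⁻¹ * ((foreBlock x).elim 0 (fun r => G (r.2.2.count .A) (r.2.2.count .B)) +
        (foreBlock x).elim 0 (fun r => G (r.2.2.count .B) (r.2.2.count .A))) ∂(wordLaw p) := by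
    rw [foreLaw, lintegral_map (measurable_of_countable _) measurable_foreCount]
    refine lintegral_congr_ae ?_
    filter_upwards [ae_exists_foreBlock (p := p)] with x ⟨n, O, hx⟩
    rw [hx]; rfl
  have hadd : Measurable fun x : ℤ → Letter =>
      (foreBlock x).elim 0 (fun r => G (r.2.2.count .A) (r.2.2.count .B)) +
        (foreBlock x).elim 0 (fun r => G (r.2.2.count .B) (r.2.2.count .A)) :=
    (hm G).add (hm fun i j => G j i)
  rw [h2, lintegral_const_mul _ hadd, lintegral_add_left (hm G),
    ← h1, ← two_mul, ← mul_assoc, ENNReal.inv_mul_cancel (by norm_num) (by norm_num), one_mul]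

lemma count_add_count {O : List Letter} (hO : ∀ o ∈ O, o.isBurger = false) (hF : Letter.F ∉ O) :
    O.count .A + O.count .B = O.length := by
  induction O with
  | nil => rfl
  | cons o O ih =>
    have := ih (fun o' ho => hO o' (by simp [ho])) fun h => hF (by simp [h])
    have ho := hO o (by simp)
    have hoF : o ≠ .F := fun h => hF (by simp [h])
    cases o <;> simp_all [Letter.isBurger] <;> omega

lemma lintegral_foreLaw_lt_top : ∫⁻ q, ((q.1 : ℝ≥0∞) + q.2) ∂(foreLaw p) < ∞ := by
  refine lt_of_le_of_lt ?_ ((lintegral_iSup_foreLen_le (p := p)).trans_lt ENNReal.ofReal_lt_top)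
  rw [foreLaw, lintegral_map (measurable_of_countable _) measurable_foreCount]
  refine lintegral_mono_ae ?_
  filter_upwards [ae_exists_foreBlock (p := p)] with x ⟨n, O, hx⟩
  rw [hx]
  simp only [Option.elim_some]
  have hb := (foreBlock_eq_some.1 hx).2
  simp only at hb
  refine le_iSup_of_le n ?_
  have hO : ∀ o ∈ O, o.isBurger = false := fun o ho =>
    (wf_red (fw x n)).1 o (by rw [hb.1]; simp [ho])
  rw [← Nat.cast_add, count_add_count hO hb.2.1, foreLen, hb.1, List.takeWhile_append,
    takeWhile_eq_self hb.2.1]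
  simp

end

end BurgerWord

namespace BurgerWord

/-! ### A Lyapunov function -/

/-- A smooth version of the absolute value. -/
noncomputable def softAbs (R d : ℝ) : ℝ := √(d ^ 2 + R ^ 2)

lemma softAbs_sq (R d : ℝ) : softAbs R d ^ 2 = d ^ 2 + R ^ 2 := Real.sq_sqrt (by positivity)

lemma softAbs_nonneg (R d : ℝ) : 0 ≤ softAbs R d := Real.sqrt_nonneg _

lemma softAbs_neg (R d : ℝ) : softAbs R (-d) = softAbs R d := by simp [softAbs]

lemma softAbs_zero {R : ℝ} (hR : 0 ≤ R) : softAbs R 0 = R := by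
  simp [softAbs, Real.sqrt_sq hR]

lemma le_softAbs {R : ℝ} (hR : 0 ≤ R) (d : ℝ) : R ≤ softAbs R d :=
  Real.le_sqrt_of_sq_le (by nlinarith [sq_nonneg d])

lemma abs_le_softAbs (R d : ℝ) : |d| ≤ softAbs R d :=
  Real.abs_le_sqrt (by nlinarith [sq_nonneg R])

lemma softAbs_add_le (R d h : ℝ) : softAbs R (d + h) ≤ softAbs R d + |h| := by
  refine Real.sqrt_le_iff.2 ⟨add_nonneg (softAbs_nonneg _ _) (abs_nonneg _), ?_⟩
  have h1 := softAbs_sq R d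
  have h2 : d * h ≤ softAbs R d * |h| := by
    calc d * h ≤ |d * h| := le_abs_self _
      _ = |d| * |h| := abs_mul _ _
      _ ≤ _ := mul_le_mul_of_nonneg_right (abs_le_softAbs R d) (abs_nonneg h)
  nlinarith [sq_abs h]

/-- The maximal convexity defect of `softAbs`. -/
noncomputable def bend (R h : ℝ) : ℝ := softAbs R h - R

lemma bend_nonneg {R : ℝ} (hR : 0 ≤ R) (h : ℝ) : 0 ≤ bend R h := by
  have := le_softAbs hR h; unfold bend; linarith

lemma bend_le_abs {R : ℝ} (hR : 0 ≤ R) (h : ℝ) : bend R h ≤ |h| := by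
  have := softAbs_add_le R 0 h
  rw [zero_add, softAbs_zero hR] at this
  unfold bend; linarith

lemma bend_le_div {R : ℝ} (hR : 0 < R) (h : ℝ) : bend R h ≤ h ^ 2 / R := by
  have h1 := softAbs_sq R h
  have h2 := le_softAbs hR.le h
  rw [le_div_iff₀ hR]
  unfold bend
  nlinarith

lemma bend_mono {R h h' : ℝ} (h0 : 0 ≤ h) (hh : h ≤ h') : bend R h ≤ bend R h' := by
  unfold bend softAbs
  have : √(h ^ 2 + R ^ 2) ≤ √(h' ^ 2 + R ^ 2) := Real.sqrt_le_sqrt (by nlinarith)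
  linarith

lemma bend_abs (R h : ℝ) : bend R |h| = bend R h := by simp [bend, softAbs]

/-- The mean of the squares at $d\pm h$ is $\mathrm{softAbs}(d)^2+h^2$, and
$h^2=\mathrm{bend}^2+2R\,\mathrm{bend}$, while $\mathrm{softAbs}(d)\ge R$. So the convexity defect
is largest at $d=0$. -/
lemma softAbs_mid_le {R : ℝ} (hR : 0 ≤ R) (d h : ℝ) :
    (softAbs R (d + h) + softAbs R (d - h)) / 2 ≤ softAbs R d + bend R h := by
  have h1 := softAbs_sq R (d + h)
  have h2 := softAbs_sq R (d - h)
  have h3 := softAbs_sq R d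
  have h4 := softAbs_sq R h
  have h5 := bend_nonneg hR h
  have h6 := le_softAbs hR d
  have h7 : softAbs R h = bend R h + R := by unfold bend; ring
  refine abs_le_of_sq_le_sq' ?_ (by linarith [softAbs_nonneg R d]) |>.2
  rw [h7] at h4
  nlinarith [sq_nonneg (softAbs R (d + h) - softAbs R (d - h)),
    mul_nonneg (sub_nonneg.2 h6) h5]

/-- Far from the smoothing scale the slope is close to $1$; the value $3/8$ is what the drift
estimate at the boundary needs. -/
lemma softAbs_sub_half_le {R y : ℝ} (hR : 0 ≤ R) (hy : 4 * R + 1 ≤ y) :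
    softAbs R (y - 1 / 2) ≤ softAbs R y - 3 / 8 := by
  have h1 := softAbs_sq R y
  have h2 : softAbs R y ≤ y + R := by
    have := softAbs_add_le R 0 y
    rw [zero_add, softAbs_zero hR, abs_of_nonneg (by linarith)] at this
    linarith
  have h3 : y ≤ softAbs R y := (le_abs_self y).trans (abs_le_softAbs R y)
  refine Real.sqrt_le_iff.2 ⟨by linarith, ?_⟩
  nlinarith

/-- Only a first moment is available. The bound `bend` $\le|h|$ provides the domination, and `bend`
$\le h^2/R$ the pointwise limit. -/
lemma tendsto_integral_bend {α : Type*} [MeasurableSpace α] [DiscreteMeasurableSpace α]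
    [Countable α] {ν : Measure α} {f : α → ℝ} (hf : Integrable f ν) :
    Tendsto (fun n : ℕ => ∫ a, bend (n + 1) (f a) ∂ν) atTop (𝓝 0) := by
  have h0 : ∀ n : ℕ, (0 : ℝ) < n + 1 := fun n => by positivity
  have := tendsto_integral_of_dominated_convergence (μ := ν)
    (F := fun (n : ℕ) a => bend (n + 1) (f a)) (f := fun _ => 0) (fun a => |f a|)
    (fun n => (Measurable.of_discrete (f := fun a => bend (n + 1) (f a))).aestronglyMeasurable)
    hf.abs
    (fun n => Eventually.of_forall fun a => by
      rw [Real.norm_of_nonneg (bend_nonneg (h0 n).le _)]; exact bend_le_abs (h0 n).le _)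
    (Eventually.of_forall fun a => by
      have h1 : Tendsto (fun n : ℕ => f a ^ 2 / ((n : ℝ) + 1)) atTop (𝓝 0) :=
        tendsto_const_nhds.div_atTop (tendsto_atTop_add_const_right _ _ tendsto_natCast_atTop_atTop)
      exact squeeze_zero (fun n => bend_nonneg (h0 n).le _) (fun n => bend_le_div (h0 n) _) h1)
  simpa using this

lemma integrable_bend {α : Type*} [MeasurableSpace α] [DiscreteMeasurableSpace α]
    [Countable α] {ν : Measure α} {f : α → ℝ} (hf : Integrable f ν) {R : ℝ} (hR : 0 ≤ R) :
    Integrable (fun a => bend R (f a)) ν :=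
  hf.mono (Measurable.of_discrete (f := fun a => bend R (f a))).aestronglyMeasurable
    (Eventually.of_forall fun a => by
      rw [Real.norm_of_nonneg (bend_nonneg hR _)]; exact bend_le_abs hR _)

lemma integral_affine {α : Type*} [MeasurableSpace α] {ν : Measure α} [IsProbabilityMeasure ν]
    {f g : α → ℝ} (hf : Integrable f ν) (hg : Integrable g ν) (a b : ℝ) :
    Integrable (fun x => a + (f x + b * g x)) ν ∧
      ∫ x, (a + (f x + b * g x)) ∂ν = a + (∫ x, f x ∂ν + b * ∫ x, g x ∂ν) := by
  have h1 : Integrable (fun x => f x + b * g x) ν := hf.add (hg.const_mul b)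
  refine ⟨(integrable_const _).add h1, ?_⟩
  rw [integral_add (integrable_const _) h1, integral_add hf (hg.const_mul b), integral_const_mul]
  simp

/-- The boundary correction at the states that wait for a burger. -/
noncomputable def corrB (x y : ℕ) : ℝ :=
  if x = 0 then 1 - (1 / 8) ^ (y + 1) else if y = 0 then 1 - (1 / 8) ^ (x + 1) else 1

/-- The boundary correction at the states that wait for an order. -/
noncomputable def corrF (x y : ℕ) : ℝ := if x = 0 ∧ y = 0 then 0 else 1

lemma corrB_swap (x y : ℕ) : corrB y x = corrB x y := by
  unfold corrB
  by_cases hx : x = 0 <;> by_cases hy : y = 0 <;> simp [hx, hy]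

lemma corrF_swap (x y : ℕ) : corrF y x = corrF x y := by simp [corrF, and_comm]

lemma pow_eighth_le (k : ℕ) : ((1 : ℝ) / 8) ^ k ≤ 1 := pow_le_one₀ (by norm_num) (by norm_num)

lemma corrB_le_one (x y : ℕ) : corrB x y ≤ 1 := by
  have h : ∀ k : ℕ, (0 : ℝ) ≤ (1 / 8) ^ k := fun k => by positivity
  unfold corrB; split_ifs <;> linarith [h (x + 1), h (y + 1)]

lemma corrB_nonneg (x y : ℕ) : 0 ≤ corrB x y := by
  unfold corrB; split_ifs <;> linarith [pow_eighth_le (x + 1), pow_eighth_le (y + 1)]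

lemma corrF_nonneg (x y : ℕ) : 0 ≤ corrF x y := by unfold corrF; split_ifs <;> norm_num

lemma corrF_le_one (x y : ℕ) : corrF x y ≤ 1 := by unfold corrF; split_ifs <;> norm_num

/-- The Lyapunov function (up to scaling) at the states that wait for a burger. -/
noncomputable def lyapB (R l M : ℝ) (x y : ℕ) : ℝ :=
  softAbs R (y - x) + l * (x + y) + M * corrB x y

/-- The Lyapunov function (up to scaling) at the states that wait for an order. -/
noncomputable def lyapF (R l M : ℝ) (x y : ℕ) : ℝ :=
  softAbs R (y - x) + l * (x + y) + 1 / 2 + M * corrF x y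

lemma lyapB_swap (R l M : ℝ) (x y : ℕ) : lyapB R l M y x = lyapB R l M x y := by
  unfold lyapB
  rw [corrB_swap, show (x : ℝ) - y = -(y - x) by ring, softAbs_neg, add_comm (y : ℝ)]

lemma lyapF_swap (R l M : ℝ) (x y : ℕ) : lyapF R l M y x = lyapF R l M x y := by
  unfold lyapF
  rw [corrF_swap, show (x : ℝ) - y = -(y - x) by ring, softAbs_neg, add_comm (y : ℝ)]

/-- The mean of the Lyapunov function after the first burger is found. -/
noncomputable def backStep (LB LF : ℕ → ℕ → ℝ) (x y N : ℕ) : ℝ :=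
  ((if x = 0 then LF 0 (y + N) else LB (x - 1) (y + N)) +
    (if y = 0 then LF (x + N) 0 else LB (x + N) (y - 1))) / 2

section
variable {R l M : ℝ} 

/-- The total $x+y$ changes by $N-1$, and $y-x$ by $\pm(N+1)$ with equal probability, so the smooth
absolute value costs only a convexity defect. -/
lemma backStep_interior (hR : 0 ≤ R) (hM : 0 ≤ M) {x y : ℕ} (hx : x ≠ 0) (hy : y ≠ 0) (N : ℕ) :
    backStep (lyapB R l M) (lyapF R l M) x y N ≤
      lyapB R l M x y - l + (bend R (N + 1) + l * N) := by
  rw [backStep, if_neg hx, if_neg hy]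
  have h1 := softAbs_mid_le hR ((y : ℝ) - x) (N + 1)
  have c1 := mul_le_mul_of_nonneg_left (corrB_le_one (x - 1) (y + N)) hM
  have c2 := mul_le_mul_of_nonneg_left (corrB_le_one (x + N) (y - 1)) hM
  have c3 : corrB x y = 1 := by simp [corrB, hx, hy]
  obtain ⟨x, rfl⟩ := Nat.exists_eq_succ_of_ne_zero hx
  obtain ⟨y, rfl⟩ := Nat.exists_eq_succ_of_ne_zero hy
  simp only [lyapB, c3]
  simp only [Nat.succ_eq_add_one, Nat.add_sub_cancel] at *
  push_cast at *
  rw [show ((y : ℝ) + 1 + N - x) = (y + 1 - (x + 1)) + (N + 1) by ring,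
    show ((y : ℝ) - (x + 1 + N)) = (y + 1 - (x + 1)) - (N + 1) by ring]
  linarith

/-- At $x=0$ the difference $y$ moves to $y+N$ or $y-1-N$, that is to $(y-\frac12)\pm(N+\frac12)$:
there is an inward drift of $\frac12$. The $1/4$ is half of the extra $\frac12$ in `lyapF`, and the
last term is the gain from the move to $(0,y-1)$ when $N=0$. -/
lemma backStep_boundary (hR : 0 ≤ R) (hM : 0 ≤ M) {y : ℕ} (hl : 0 ≤ l) (hy : y ≠ 0) (N : ℕ) :
    backStep (lyapB R l M) (lyapF R l M) 0 y N ≤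
      lyapB R l M 0 y + (softAbs R (y - 1 / 2) - softAbs R y) + 1 / 4 + M * (1 / 8) ^ (y + 1) +
        (bend R (N + 1) + l * N - M * (1 / 8) ^ y / 2 * if N = 0 then 1 else 0) := by
  rw [backStep, if_pos rfl, if_neg hy]
  have h1 := softAbs_mid_le hR ((y : ℝ) - 1 / 2) (N + 1 / 2)
  have h2 : bend R ((N : ℝ) + 1 / 2) ≤ bend R (N + 1) := bend_mono (by positivity) (by linarith)
  have c1 := mul_le_mul_of_nonneg_left (corrF_le_one 0 (y + N)) hM
  have c2 : corrB (0 + N) (y - 1) ≤ 1 - (1 / 8) ^ y * if N = 0 then 1 else 0 := by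
    by_cases hN : N = 0
    · subst hN
      have : y - 1 + 1 = y := by omega
      simp [corrB, this]
    · simpa [hN] using corrB_le_one N (y - 1)
  have c2 := mul_le_mul_of_nonneg_left c2 hM
  have c3 : corrB 0 y = 1 - (1 / 8) ^ (y + 1) := by simp [corrB]
  obtain ⟨y, rfl⟩ := Nat.exists_eq_succ_of_ne_zero hy
  simp only [lyapB, lyapF, c3]
  simp only [Nat.succ_eq_add_one, Nat.add_sub_cancel] at *
  push_cast at *
  simp only [zero_add, sub_zero] at *
  rw [show ((y : ℝ) + 1 + N) = (y + 1 - 1 / 2) + (N + 1 / 2) by ring,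
    show ((y : ℝ) - N) = (y + 1 - 1 / 2) - (N + 1 / 2) by ring]
  linarith

/-- Either kind of burger consumes the $\mathtt F$. With $N=0$ the word is then empty and the whole
correction $M$ is recovered. -/
lemma backStep_zero (hR : 0 ≤ R) (hM : 0 ≤ M) (N : ℕ) :
    backStep (lyapB R l M) (lyapF R l M) 0 0 N ≤
      lyapB R l M 0 0 + 1 / 2 + M * (1 / 8) + (N + l * N - M * if N = 0 then 1 else 0) := by
  rw [backStep, if_pos rfl, if_pos rfl, zero_add, lyapF_swap]
  have h1 := softAbs_add_le R 0 N
  rw [zero_add, abs_of_nonneg (by positivity)] at h1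
  have c1 : corrF N 0 = 1 - if N = 0 then 1 else 0 := by
    by_cases hN : N = 0 <;> simp [corrF, hN]
  simp only [lyapB, lyapF, c1]
  simp [corrB, softAbs_neg, mul_sub]
  linarith

/-- The two kinds of new orders are exchangeable, so the change of $y-x$ is symmetric; the extra
$\frac12$ of `lyapF` pays for the convexity defect and for the growth of $x+y$. At $(0,0)$ there is
nothing to prove since the exploration has ended. -/
lemma lyapB_mid_le (hR : 0 ≤ R) (hM : 0 ≤ M) {x y : ℕ} (hxy : ¬ (x = 0 ∧ y = 0)) (q : ℕ × ℕ) :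
    (lyapB R l M (x + q.1) (y + q.2) + lyapB R l M (x + q.2) (y + q.1)) / 2 ≤
      lyapF R l M x y - 1 / 2 + (bend R (q.1 + q.2) + l * (q.1 + q.2)) := by
  have h1 := softAbs_mid_le hR ((y : ℝ) - x) (q.2 - q.1)
  have h2 : bend R ((q.2 : ℝ) - q.1) ≤ bend R (q.1 + q.2) := by
    rw [← bend_abs]
    refine bend_mono (abs_nonneg _) (abs_le.2 ⟨?_, ?_⟩) <;>
      linarith [(Nat.cast_nonneg q.1 : (0 : ℝ) ≤ q.1), (Nat.cast_nonneg q.2 : (0 : ℝ) ≤ q.2)]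
  have c1 := mul_le_mul_of_nonneg_left (corrB_le_one (x + q.1) (y + q.2)) hM
  have c2 := mul_le_mul_of_nonneg_left (corrB_le_one (x + q.2) (y + q.1)) hM
  have c3 : corrF x y = 1 := by simp [corrF, hxy]
  simp only [lyapB, lyapF, c3]
  push_cast
  rw [show ((y : ℝ) + q.2 - (x + q.1)) = (y - x) + (q.2 - q.1) by ring,
    show ((y : ℝ) + q.1 - (x + q.2)) = (y - x) - (q.2 - q.1) by ring]
  linarith

lemma backStep_swap (x y N : ℕ) : backStep (lyapB R l M) (lyapF R l M) y x N =
    backStep (lyapB R l M) (lyapF R l M) x y N := by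
  unfold backStep
  rw [add_comm]
  congr 2
  · split_ifs
    · rw [lyapF_swap]
    · rw [lyapB_swap]
  · split_ifs
    · rw [lyapF_swap]
    · rw [lyapB_swap]

lemma lyapB_nonneg (hl : 0 ≤ l) (hM : 0 ≤ M) (x y : ℕ) : 0 ≤ lyapB R l M x y := by
  have := mul_nonneg hM (corrB_nonneg x y)
  have := softAbs_nonneg R ((y : ℝ) - x)
  unfold lyapB; positivity

lemma lyapF_nonneg (hl : 0 ≤ l) (hM : 0 ≤ M) (x y : ℕ) : 0 ≤ lyapF R l M x y := by
  have := mul_nonneg hM (corrF_nonneg x y)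
  have := softAbs_nonneg R ((y : ℝ) - x)
  unfold lyapF; positivity

lemma lyapB_le (hR : 0 ≤ R) (hM : 0 ≤ M) (x y : ℕ) :
    lyapB R l M x y ≤ R + M + (1 + l) * (x + y) := by
  have h1 := softAbs_add_le R 0 ((y : ℝ) - x)
  rw [zero_add, softAbs_zero hR] at h1
  have h2 : |(y : ℝ) - x| ≤ x + y := abs_le.2 ⟨by
    linarith [(Nat.cast_nonneg y : (0 : ℝ) ≤ y)], by linarith [(Nat.cast_nonneg x : (0 : ℝ) ≤ x)]⟩
  have := mul_le_mul_of_nonneg_left (corrB_le_one x y) hM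
  unfold lyapB; linarith

end

/-- There is a Lyapunov function for the exploration which alternates the search of a burger in the
past and of a flexible order in the future. -/
theorem exists_lyapunov {ν : Measure ℕ} [IsProbabilityMeasure ν]
    (hν : Integrable (fun N : ℕ => (N : ℝ)) ν) (hν1 : ∫ N, (N : ℝ) ∂ν < 1)
    (hν0 : 1 / 2 ≤ ν.real {0}) {ρ : Measure (ℕ × ℕ)} [IsProbabilityMeasure ρ]
    (hρ : Integrable (fun q : ℕ × ℕ => (q.1 + q.2 : ℝ)) ρ) :
    ∃ LB LF : ℕ → ℕ → ℝ, ∃ C : ℝ, (∀ x y, 0 ≤ LB x y) ∧ (∀ x y, 0 ≤ LF x y) ∧ 0 ≤ C ∧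
      (∀ x y, LB x y ≤ C * (1 + (x + y))) ∧
      (∀ x y, ∃ g : ℕ → ℝ, Integrable g ν ∧ (∀ N, backStep LB LF x y N ≤ g N) ∧
        1 + ∫ N, g N ∂ν ≤ LB x y) ∧
      (∀ x y, ¬ (x = 0 ∧ y = 0) → ∃ g : ℕ × ℕ → ℝ, Integrable g ρ ∧
        (∀ q, (LB (x + q.1) (y + q.2) + LB (x + q.2) (y + q.1)) / 2 ≤ g q) ∧
        ∫ q, g q ∂ρ ≤ LF x y) := by
  set m := ∫ N, (N : ℝ) ∂ν with hm
  set e := ∫ q, (q.1 + q.2 : ℝ) ∂ρ with he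
  have hm0 : 0 ≤ m := integral_nonneg fun N => by positivity
  have he0 : 0 ≤ e := integral_nonneg fun q => by positivity
  -- The weight of $x+y$ is small enough that the mean growth $e$ of a forward search costs at most
  -- $1/8$.
  obtain ⟨l, hl0, hl1, hl2⟩ : ∃ l : ℝ, 0 < l ∧ l ≤ 1 / 32 ∧ l * e ≤ 1 / 8 := by
    refine ⟨1 / (32 * (e + 1)), by positivity, ?_, ?_⟩
    · rw [div_le_div_iff_of_pos_left (by norm_num) (by positivity) (by norm_num)]; linarith
    · rw [div_mul_eq_mul_div, div_le_iff₀ (by positivity)]; linarith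
  have hν' : Integrable (fun N : ℕ => (N : ℝ) + 1) ν := hν.add (integrable_const 1)
  -- The scale $R$ makes the mean convexity defect at most half of the interior gain $l(1-m)$, and
  -- small beside the boundary gain.
  obtain ⟨R, hR, hR1, hR2⟩ : ∃ R : ℝ, 0 ≤ R ∧
      ∫ N : ℕ, bend R ((N : ℝ) + 1) ∂ν ≤ min (1 / 32) (l * (1 - m) / 2) ∧
      ∫ q : ℕ × ℕ, bend R ((q.1 : ℝ) + q.2) ∂ρ ≤ 1 / 8 := by
    have h1 := (tendsto_integral_bend hν').eventually_le_const
      (show (0 : ℝ) < min (1 / 32) (l * (1 - m) / 2) from lt_min (by norm_num)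
        (by have := mul_pos hl0 (sub_pos.2 hν1); linarith))
    have h2 := (tendsto_integral_bend hρ).eventually_le_const (show (0 : ℝ) < 1 / 8 by norm_num)
    obtain ⟨n, h3, h4⟩ := (h1.and h2).exists
    exact ⟨n + 1, by positivity, h3, h4⟩
  obtain ⟨Y, hY⟩ := exists_nat_gt (4 * R + 1)
  -- This is chosen so that $M\,8^{-y}\ge16$ at the boundary points $y<Y$, where the smooth absolute
  -- value gives no drift.
  set M : ℝ := 16 * 8 ^ Y with hMdef
  have hM16 : 16 ≤ M := by
    have : (1 : ℝ) ≤ 8 ^ Y := one_le_pow₀ (by norm_num)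
    linarith
  have hM : 0 ≤ M := by linarith
  -- The uniform drift: $l(1-m)/2$ in the interior and
  -- $\frac38-\frac14-\frac1{32}-\frac1{32}=\frac1{16}$ at the far boundary. Dividing by it
  -- normalises the cost of a backward search to $1$.
  set k := min (1 / 16) (l * (1 - m) / 2) with hk
  have hk0 : 0 < k := lt_min (by norm_num) (by have := mul_pos hl0 (sub_pos.2 hν1); linarith)
  have hk1 : k ≤ 1 / 16 := min_le_left _ _
  have hk2 : k ≤ l * (1 - m) / 2 := min_le_right _ _
  have hb := integrable_bend hν' hR
  have hlm : l * m ≤ 1 / 32 := by nlinarith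
  have hind : Integrable (fun N : ℕ => if N = 0 then (1 : ℝ) else 0) ν :=
    (integrable_const (1 : ℝ)).mono (Measurable.of_discrete).aestronglyMeasurable
      (Eventually.of_forall fun N => by split_ifs <;> simp)
  have hind' : ∫ N : ℕ, (if N = 0 then (1 : ℝ) else 0) ∂ν = ν.real {0} := by
    rw [← integral_indicator_one (measurableSet_singleton 0)]
    refine integral_congr_ae (Eventually.of_forall fun N => ?_)
    simp [Set.indicator_apply]
  have hR1a := hR1.trans (min_le_left _ _)
  have hR1b := hR1.trans (min_le_right _ _)
  -- the drift before scaling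
  have drift : ∀ x y, ∃ g : ℕ → ℝ, Integrable g ν ∧
      (∀ N, backStep (lyapB R l M) (lyapF R l M) x y N ≤ g N) ∧
      k + ∫ N, g N ∂ν ≤ lyapB R l M x y := by
    have bdry : ∀ y, ∃ g : ℕ → ℝ, Integrable g ν ∧
        (∀ N, backStep (lyapB R l M) (lyapF R l M) 0 y N ≤ g N) ∧
        k + ∫ N, g N ∂ν ≤ lyapB R l M 0 y := by
      intro y
      rcases eq_or_ne y 0 with rfl | hy
      · refine ⟨_, ?_, fun N => backStep_zero hR hM N, ?_⟩
        · simp_rw [← add_sub_assoc]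
          exact (integral_affine hν hν _ l).1.sub (hind.const_mul M)
        · simp_rw [← add_sub_assoc]
          rw [integral_sub (integral_affine hν hν _ l).1 (hind.const_mul M),
            (integral_affine hν hν _ l).2, integral_const_mul, hind']
          have := mul_le_mul_of_nonneg_left hν0 hM
          linarith
      · refine ⟨_, ?_, fun N => backStep_boundary hR hM hl0.le hy N, ?_⟩
        · simp_rw [← add_sub_assoc]
          exact (integral_affine hb hν _ l).1.sub (hind.const_mul _)
        · simp_rw [← add_sub_assoc]
          rw [integral_sub (integral_affine hb hν _ l).1 (hind.const_mul _),
            (integral_affine hb hν _ l).2, integral_const_mul, hind']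
          have h2 : 0 ≤ M * (1 / 8) ^ y / 2 := by positivity
          have h3 := mul_le_mul_of_nonneg_left hν0 h2
          have h4 : M * (1 / 8) ^ (y + 1) = M * (1 / 8) ^ y / 8 := by rw [pow_succ]; ring
          rw [h4]
          -- In both cases the corrections change in mean by at most $M8^{-y}(\frac18-\frac14)$,
          -- since $N=0$ has probability at least $\frac12$. Far away this is only discarded; near
          -- the corner it is at most $-2$ and dominates everything else.
          by_cases hyY : Y ≤ y
          · have h5 := softAbs_sub_half_le hR (show 4 * R + 1 ≤ (y : ℝ) by
              have : (Y : ℝ) ≤ y := by exact_mod_cast hyY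
              linarith)
            linarith
          · have h5 := softAbs_add_le R y (-(1 / 2))
            rw [abs_neg, abs_of_nonneg (by norm_num), ← sub_eq_add_neg] at h5
            have h6 : 16 ≤ M * (1 / 8) ^ y := by
              rw [hMdef, mul_assoc]
              have : (1 : ℝ) ≤ 8 ^ Y * (1 / 8) ^ y := by
                rw [one_div, inv_pow, ← div_eq_mul_inv, one_le_div (by positivity)]
                exact pow_le_pow_right₀ (by norm_num) (by omega)
              linarith
            linarith
    intro x y
    by_cases hx : x = 0
    · subst hx; exact bdry y
    by_cases hy : y = 0
    · subst hy
      obtain ⟨g, h1, h2, h3⟩ := bdry x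
      exact ⟨g, h1, fun N => by rw [backStep_swap]; exact h2 N, by rw [lyapB_swap]; exact h3⟩
    refine ⟨_, ?_, fun N => backStep_interior hR hM hx hy N, ?_⟩
    · exact (integral_affine hb hν _ l).1
    · rw [(integral_affine hb hν _ l).2]
      linarith
  have hk' : 0 ≤ k⁻¹ := by positivity
  refine ⟨fun x y => k⁻¹ * lyapB R l M x y, fun x y => k⁻¹ * lyapF R l M x y,
    k⁻¹ * (R + M + (1 + l)), fun x y => mul_nonneg hk' (lyapB_nonneg hl0.le hM x y),
    fun x y => mul_nonneg hk' (lyapF_nonneg hl0.le hM x y), by positivity, ?_, ?_, ?_⟩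
  · intro x y
    rw [mul_assoc]
    refine mul_le_mul_of_nonneg_left ((lyapB_le hR hM x y).trans ?_) hk'
    have : (0 : ℝ) ≤ x + y := by positivity
    nlinarith
  · intro x y
    obtain ⟨g, h1, h2, h3⟩ := drift x y
    refine ⟨fun N => k⁻¹ * g N, h1.const_mul _, fun N => ?_, ?_⟩
    · refine le_trans (le_of_eq ?_) (mul_le_mul_of_nonneg_left (h2 N) hk')
      simp only [backStep]
      split_ifs <;> ring
    · rw [integral_const_mul]
      have := mul_le_mul_of_nonneg_left h3 hk'
      rw [mul_add, inv_mul_cancel₀ hk0.ne'] at this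
      exact this
  · intro x y hxy
    have hb' := integrable_bend hρ hR
    refine ⟨fun q => k⁻¹ * (lyapF R l M x y - 1 / 2 +
      (bend R (q.1 + q.2) + l * (q.1 + q.2))), ?_, fun q => ?_, ?_⟩
    · exact (integral_affine hb' hρ _ l).1.const_mul _
    · refine le_trans (le_of_eq ?_) (mul_le_mul_of_nonneg_left (lyapB_mid_le hR hM hxy q) hk')
      ring
    · rw [integral_const_mul, (integral_affine hb' hρ _ l).2]
      exact mul_le_mul_of_nonneg_left (by linarith) hk'

end BurgerWord

namespace BurgerWord

/-! ### The size of the first reducible interval -/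

/-- The least number of burgers in the past of a completion of the word `W` to a word which reduces
to the empty word. -/
noncomputable def closeCost (W : List Letter) (x : ℤ → Letter) : ℝ≥0∞ :=
  ⨅ (m : ℕ) (n : ℕ) (_ : cls (pw x m) * cls W * cls (fw x n) = 1), ((netCount (pw x m)).toNat : ℝ≥0∞)

lemma measurable_closeCost (W : List Letter) : Measurable (closeCost W) := by
  refine Measurable.iInf fun m => Measurable.iInf fun n => ?_
  refine LocalOn.measurable (m := m) (n := n) fun x x' h => ?_
  rw [pw_congr (X := x) (X' := x') fun k h1 h2 => h k h1 (by omega),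
    fw_congr (X := x) (X' := x') fun k h1 h2 => h k (by omega) h2]

/-- The cost, capped at `r`. -/
noncomputable def cappedCost (W : List Letter) (r : ℕ) (x : ℤ → Letter) : ℝ≥0∞ :=
  min (closeCost W x) r

lemma measurable_cappedCost (W : List Letter) (r : ℕ) : Measurable (cappedCost W r) :=
  (measurable_closeCost W).min measurable_const

lemma closeCost_nil (x : ℤ → Letter) : closeCost [] x = 0 := by
  refine le_antisymm (iInf_le_of_le 0 (iInf_le_of_le 0 (iInf_le_of_le ?_ ?_))) zero_le
  · simp [pw, fw]
  · simp [pw]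

/-- A completion of `W'` by letters outside the explored window, together with the window, is a
completion of `W`. -/
lemma closeCost_le {W W' : List Letter} {x : ℤ → Letter} {m n c : ℕ}
    (h : cls (pw x m) * cls W * cls (fw x n) = cls W') (hc : netCount (pw x m) ≤ c) :
    closeCost W x ≤ c + closeCost W' (collapse m n x) := by
  unfold closeCost
  simp only [ENNReal.add_iInf]
  refine le_iInf fun m' => le_iInf fun n' => le_iInf fun h' => ?_
  refine iInf_le_of_le (m' + m) (iInf_le_of_le (n + n') (iInf_le_of_le ?_ ?_))
  · rw [pw_add_collapse x m n, fw_add_collapse x m n, cls_append, cls_append, ← h', ← h]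
    simp only [mul_assoc]
  · rw [pw_add_collapse x m n, netCount_append]
    exact_mod_cast (by omega : (netCount (pw (collapse m n x) m') + netCount (pw x m)).toNat ≤
      c + (netCount (pw (collapse m n x) m')).toNat)

/-- The word consists of orders of a definite kind. -/
def Definite (O : List Letter) : Prop := ∀ o ∈ O, o = .A ∨ o = .B

lemma Definite.isBurger {O : List Letter} (h : Definite O) : ∀ o ∈ O, o.isBurger = false := by
  intro o ho; rcases h o ho with rfl | rfl <;> rfl

lemma definite_iff {O : List Letter} :
    Definite O ↔ (∀ o ∈ O, o.isBurger = false) ∧ Letter.F ∉ O := by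
  refine ⟨fun h => ⟨h.isBurger, fun hF => by rcases h _ hF with h | h <;> cases h⟩, fun h o ho => ?_⟩
  have h1 := h.1 o ho
  have h2 : o ≠ .F := fun e => h.2 (e ▸ ho)
  cases o <;> simp_all [Letter.isBurger]

lemma Definite.append {O O' : List Letter} (h : Definite O) (h' : Definite O') :
    Definite (O ++ O') := fun o ho => (List.mem_append.1 ho).elim (h o) (h' o)

lemma definite_replicate (N : ℕ) (t : Bool) : Definite (List.replicate N (opp t)) := by
  intro o ho
  rw [List.eq_of_mem_replicate ho]
  cases t <;> simp [opp]

/-- Does the first burger find an order before the flexible one? -/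
def finds (t : Bool) (O : List Letter) : Bool := O.any (burger t).serves

/-- The orders after the first burger of the past is found. -/
def afterBack (O : List Letter) (t : Bool) (N : ℕ) : List Letter :=
  List.replicate N (opp t) ++ O.eraseP (burger t).serves

/-- The word that remains to be completed after the first burger of the past is found. -/
def nextWord (O : List Letter) (q : Bool × ℕ) : List Letter :=
  afterBack O q.1 q.2 ++ if finds q.1 O then [.F] else []

lemma Definite.afterBack {O : List Letter} (h : Definite O) (t : Bool) (N : ℕ) :
    Definite (afterBack O t N) :=
  (definite_replicate N t).append fun o ho => h o (List.mem_of_mem_eraseP ho)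

lemma IsBackBlock.cls_eq {x : ℤ → Letter} {n : ℕ} {q : Bool × ℕ} (h : IsBackBlock x n q)
    {O : List Letter} (hO : Definite O) :
    cls (pw x n) * cls (O ++ [.F]) = cls (nextWord O q) := by
  have hF : (burger q.1).serves .F = true := serves_F (by simp)
  have h1 : ∀ o ∈ O ++ [Letter.F], o.isBurger = false := by
    intro o ho
    rcases List.mem_append.1 ho with h | h
    · exact hO.isBurger o h
    · rw [List.mem_singleton.1 h]; rfl
  have h2 : cls (pw x n) = cls (List.replicate q.2 (opp q.1)) * cls [burger q.1] := by
    rw [cls_eq_red, h.1]; rfl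
  rw [h2, mul_assoc, cls_burger_mul (by simp) _ h1, if_pos (by simp [hF]), ← cls_append, nextWord, afterBack,
    List.append_assoc, eraseP_append_any, finds]
  by_cases ha : O.any (burger q.1).serves
  · simp [ha]
  · rw [if_neg ha, if_neg ha, eraseP_of_not_any _ _ ha]
    simp [hF]

lemma count_of_finds {O : List Letter} (hO : Definite O) (t : Bool) :
    finds t O = true ↔ O.count (opp !t) ≠ 0 := by
  rw [finds, List.any_eq_true, ← Nat.pos_iff_ne_zero, List.count_pos_iff]
  constructor
  · rintro ⟨o, ho, h⟩
    rcases hO o ho with rfl | rfl <;> cases t <;> simp_all [burger, opp, Letter.serves]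
  · intro h
    exact ⟨_, h, by cases t <;> rfl⟩

lemma count_eraseP {O : List Letter} (hO : Definite O) (t : Bool) :
    (O.eraseP (burger t).serves).count (opp !t) = O.count (opp !t) - 1 ∧
      (O.eraseP (burger t).serves).count (opp t) = O.count (opp t) := by
  have : O.eraseP (burger t).serves = O.erase (opp !t) := by
    rw [List.erase_eq_eraseP]
    refine eraseP_congr_mem fun o ho => ?_
    rcases hO o ho with rfl | rfl <;> cases t <;> rfl
  rw [this]
  refine ⟨List.count_erase_self, List.count_erase_of_ne ?_⟩
  cases t <;> simp [opp]

section
variable {p : ℝ} [hp : Fact (p ∈ Set.Ioo (1 / 2 : ℝ) 1)]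

lemma integrable_backLaw : Integrable (fun N : ℕ => (N : ℝ)) (backLaw p) ∧
    ∫ N, (N : ℝ) ∂(backLaw p) < 1 := by
  have h := lintegral_backLaw_len_le (p := p)
  have hp1 := hp.out.1
  have h2 : ∫⁻ N, ENNReal.ofReal (N : ℝ) ∂(backLaw p) ≤ ENNReal.ofReal (1 / p - 1) := by
    simpa using h
  have hint : Integrable (fun N : ℕ => (N : ℝ)) (backLaw p) := by
    refine ⟨(Measurable.of_discrete).aestronglyMeasurable, ?_⟩
    rw [hasFiniteIntegral_iff_ofReal (Eventually.of_forall fun N => by positivity)]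
    exact h2.trans_lt ENNReal.ofReal_lt_top
  refine ⟨hint, ?_⟩
  rw [integral_eq_lintegral_of_nonneg_ae (Eventually.of_forall fun N => by positivity) hint.1]
  have h3 : 1 / p - 1 < 1 := by
    rw [sub_lt_iff_lt_add, div_lt_iff₀ (by linarith)]; linarith
  have h4 : 0 ≤ 1 / p - 1 := by
    have : 1 ≤ 1 / p := by rw [le_div_iff₀ (by linarith)]; linarith [hp.out.2]
    linarith
  exact (ENNReal.toReal_le_of_le_ofReal h4 h2).trans_lt h3

lemma integrable_foreLaw : Integrable (fun q : ℕ × ℕ => (q.1 + q.2 : ℝ)) (foreLaw p) := by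
  refine ⟨(Measurable.of_discrete).aestronglyMeasurable, ?_⟩
  rw [hasFiniteIntegral_iff_ofReal (Eventually.of_forall fun q => by positivity)]
  refine lt_of_le_of_lt (lintegral_mono fun q => ?_) (lintegral_foreLaw_lt_top (p := p))
  rw [ENNReal.ofReal_add (by positivity) (by positivity), ENNReal.ofReal_natCast,
    ENNReal.ofReal_natCast]

lemma lintegral_le_of_foreBlock {H : (ℤ → Letter) → ℝ≥0∞} {F : List Letter → (ℤ → Letter) → ℝ≥0∞}
    (hF : ∀ O, Measurable (F O))
    (hle : ∀ x n O, IsForeBlock x n O → H x ≤ F O (collapse 0 n x)) {G : ℕ → ℕ → ℝ≥0∞}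
    (hG : ∀ O, Definite O → ∫⁻ x, F O x ∂(wordLaw p) ≤ G (O.count .A) (O.count .B)) :
    ∫⁻ x, H x ∂(wordLaw p) ≤ ∫⁻ q, 2⁻¹ * (G q.1 q.2 + G q.2 q.1) ∂(foreLaw p) := by
  rw [← lintegral_foreBlock G]
  calc ∫⁻ x, H x ∂(wordLaw p)
      ≤ ∫⁻ x, (foreBlock x).elim 0 (fun q => F q.2.2 (collapse q.1 q.2.1 x)) ∂(wordLaw p) := by
        refine lintegral_mono_ae ?_
        filter_upwards [ae_exists_foreBlock (p := p)] with x ⟨n, O, hx⟩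
        rw [hx]
        exact hle x n O (foreBlock_eq_some.1 hx).2
    _ = ∫⁻ x, (foreBlock x).elim 0 (fun q => ∫⁻ y, F q.2.2 y ∂(wordLaw p)) ∂(wordLaw p) :=
        isExploration_foreBlock.lintegral_eq hF
    _ ≤ _ := by
        refine lintegral_mono_ae ?_
        filter_upwards [ae_exists_foreBlock (p := p)] with x ⟨n, O, hx⟩
        have hb : IsForeBlock x n O := (foreBlock_eq_some.1 hx).2
        rw [hx]
        exact hG O (definite_iff.2
          ⟨fun o ho => (wf_red (fw x n)).1 o (by rw [hb.1]; simp [ho]), hb.2.1⟩)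

lemma lintegral_le_of_backBlock {H : (ℤ → Letter) → ℝ≥0∞} {F : Bool × ℕ → (ℤ → Letter) → ℝ≥0∞}
    (hF : ∀ q, Measurable (F q))
    (hle : ∀ x n q, IsBackBlock x n q → H x ≤ F q (collapse n 0 x)) {G : Bool → ℕ → ℝ≥0∞}
    (hG : ∀ t N, ∫⁻ x, F (t, N) x ∂(wordLaw p) ≤ G t N) :
    ∫⁻ x, H x ∂(wordLaw p) ≤ ∫⁻ N, 2⁻¹ * (G true N + G false N) ∂(backLaw p) := by
  rw [← lintegral_backBlock G]
  calc ∫⁻ x, H x ∂(wordLaw p)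
      ≤ ∫⁻ x, (backBlock x).elim 0 (fun q => F q.2.2 (collapse q.1 q.2.1 x)) ∂(wordLaw p) := by
        refine lintegral_mono_ae ?_
        filter_upwards [ae_exists_backBlock (p := p)] with x ⟨n, q, hx⟩
        rw [hx]
        exact hle x n q (backBlock_eq_some.1 hx).1
    _ = ∫⁻ x, (backBlock x).elim 0 (fun q => ∫⁻ y, F q.2.2 y ∂(wordLaw p)) ∂(wordLaw p) :=
        isExploration_backBlock.lintegral_eq hF
    _ ≤ _ := by
        refine lintegral_mono fun x => ?_
        rcases backBlock x with _ | ⟨n, n', t, N⟩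
        · exact le_rfl
        · exact hG t N

lemma lintegral_half_le {α : Type*} [MeasurableSpace α] {ν : Measure α} {f₁ f₂ g : α → ℝ}
    (h₁ : ∀ a, 0 ≤ f₁ a) (h₂ : ∀ a, 0 ≤ f₂ a) (hg : Integrable g ν)
    (h : ∀ a, (f₁ a + f₂ a) / 2 ≤ g a) :
    ∫⁻ a, 2⁻¹ * (ENNReal.ofReal (f₁ a) + ENNReal.ofReal (f₂ a)) ∂ν ≤ ENNReal.ofReal (∫ a, g a ∂ν) := by
  have h0 : ∀ a, 0 ≤ g a := fun a => le_trans (by linarith [h₁ a, h₂ a]) (h a)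
  rw [ofReal_integral_eq_lintegral_ofReal hg (Eventually.of_forall h0)]
  refine lintegral_mono fun a => ?_
  refine le_trans (le_of_eq ?_) (ENNReal.ofReal_le_ofReal (h a))
  rw [← ENNReal.ofReal_add (h₁ a) (h₂ a), div_eq_inv_mul, ENNReal.ofReal_mul (by norm_num),
    ENNReal.ofReal_inv_of_pos (by norm_num)]
  simp

variable (p) in
/-- The mean cost of closing the word, after a search in the past and in the future respectively,
is bounded by a function of linear growth. -/
lemma exists_closeCost_bound : ∃ LB : ℕ → ℕ → ℝ, ∃ C : ℝ, 0 ≤ C ∧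
    (∀ x y, LB x y ≤ C * (1 + (x + y))) ∧ ∀ (r : ℕ) (O : List Letter), Definite O →
      ∫⁻ x, cappedCost (O ++ [.F]) r x ∂(wordLaw p) ≤
        ENNReal.ofReal (LB (O.count .A) (O.count .B)) := by
  have hν0 : 1 / 2 ≤ (backLaw p).real {0} := by
    rw [measureReal_def]
    have := ENNReal.toReal_mono (measure_ne_top _ _) (half_le_backLaw_zero (p := p))
    simpa using this
  obtain ⟨LB, LF, C, hB0, hF0, hC, hlin, hback, hfore⟩ := exists_lyapunov (ν := backLaw p)
    integrable_backLaw.1 integrable_backLaw.2 hν0 (integrable_foreLaw (p := p))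
  refine ⟨LB, C, hC, hlin, fun r => ?_⟩
  -- from a bound before a flexible order to a bound before the past is searched
  have hF : ∀ r : ℕ, (∀ O : List Letter, Definite O →
      ∫⁻ x, cappedCost (O ++ [.F]) r x ∂(wordLaw p) ≤
        ENNReal.ofReal (LB (O.count .A) (O.count .B))) → ∀ O : List Letter, Definite O →
      ∫⁻ x, cappedCost O r x ∂(wordLaw p) ≤
        ENNReal.ofReal (LF (O.count .A) (O.count .B)) := by
    intro r ih O hO
    -- The empty word is already completed and costs nothing.
    by_cases h0 : O.count .A = 0 ∧ O.count .B = 0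
    · obtain rfl : O = [] := by
        refine List.eq_nil_iff_forall_not_mem.2 fun o ho => ?_
        rcases hO o ho with rfl | rfl
        · exact List.count_eq_zero.1 h0.1 ho
        · exact List.count_eq_zero.1 h0.2 ho
      simp [cappedCost, closeCost_nil]
    obtain ⟨g, hg1, hg2, hg3⟩ := hfore _ _ h0
    -- A forward search uses no letter of the past, so it has cost $0$ and keeps the cap $r$.
    refine (lintegral_le_of_foreBlock (p := p)
      (F := fun O' => cappedCost (O ++ O' ++ [.F]) r) (fun O' => measurable_cappedCost _ _) (fun x n O' hb => ?_)
      (G := fun i j => ENNReal.ofReal (LB (O.count .A + i) (O.count .B + j)))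
      (fun O' hO' => ?_)).trans ((lintegral_half_le (fun q => hB0 _ _) (fun q => hB0 _ _) hg1 hg2).trans
        (ENNReal.ofReal_le_ofReal hg3))
    · refine min_le_min_right _ ?_
      have := closeCost_le (x := x) (W := O) (W' := O ++ O' ++ [.F]) (m := 0) (n := n) (c := 0)
        (by
          rw [cls_eq_red (fw x n), hb.1]
          simp only [pw, wd_zero, cls_nil, one_mul, List.reverse_nil, mul_one]
          rw [← cls_append, List.append_assoc]) (by simp [pw])
      simpa using this
    · have := ih _ (hO.append hO')
      simpa only [List.count_append] using this
  -- The cap replaces an optional stopping argument: each backward search costs at most $1$ and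
  -- lowers the cap by $1$, so the Lyapunov inequality can be iterated without assuming that the
  -- exploration terminates.
  induction r with
  | zero => intro O _; simp [cappedCost]
  | succ r ih =>
    intro O hO
    obtain ⟨g, hg1, hg2, hg3⟩ := hback (O.count .A) (O.count .B)
    set f₁ : ℕ → ℝ := fun N => if O.count .A = 0 then LF 0 (O.count .B + N)
      else LB (O.count .A - 1) (O.count .B + N) with hf₁
    set f₂ : ℕ → ℝ := fun N => if O.count .B = 0 then LF (O.count .A + N) 0
      else LB (O.count .A + N) (O.count .B - 1) with hf₂
    have hf₁0 : ∀ N, 0 ≤ f₁ N := fun N => by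
      simp only [hf₁]; split_ifs
      exacts [hF0 _ _, hB0 _ _]
    have hf₂0 : ∀ N, 0 ≤ f₂ N := fun N => by
      simp only [hf₂]; split_ifs
      exacts [hF0 _ _, hB0 _ _]
    calc ∫⁻ x, cappedCost (O ++ [.F]) (r + 1) x ∂(wordLaw p)
        ≤ ∫⁻ N, 2⁻¹ * ((1 + ENNReal.ofReal (f₁ N)) + (1 + ENNReal.ofReal (f₂ N)))
            ∂(backLaw p) := by
          refine lintegral_le_of_backBlock (p := p) (F := fun q x => 1 + cappedCost (nextWord O q) r x)
            (fun q => measurable_const.add (measurable_cappedCost _ _))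
            (G := fun t N => 1 + ENNReal.ofReal (if t then f₁ N else f₂ N))
            (fun x n q hb => ?_) (fun t N => ?_)
          · have h1 := closeCost_le (x := x) (W := O ++ [.F]) (m := n) (n := 0) (c := 1)
              (W' := nextWord O q)
              (by
                rw [hb.cls_eq hO]
                simp [fw]) (by rw [netCount_eq, hb.1]; simp)
            refine (min_le_min_right _ h1).trans ?_
            push_cast
            rw [add_comm (r : ℝ≥0∞) 1, min_add_add_left]; rfl
          rw [lintegral_add_left measurable_const, lintegral_const, measure_univ, mul_one]
          gcongr
          have hd := hO.afterBack t N
          have hc := count_eraseP hO t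
          have hfi := count_of_finds hO t
          have hR : ∀ c, (afterBack O t N).count c =
              (List.replicate N (opp t)).count c + (O.eraseP (burger t).serves).count c :=
            fun c => List.count_append
          cases t
          · simp only [Bool.false_eq_true, if_false]
            simp only [opp, Bool.not_false, if_true, Bool.false_eq_true, if_false] at hc hfi hR
            by_cases h : O.count .B = 0
            · have h2 : ¬ finds false O = true := fun h' => hfi.1 h' h
              have := hF r ih _ hd
              simp only [hR, hc, List.count_replicate, h] at this
              simp only [nextWord, hf₂, if_neg h2, if_pos h, List.append_nil]
              simpa [add_comm] using this
            · have h2 : finds false O = true := hfi.2 h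
              have := ih _ hd
              simp only [hR, hc, List.count_replicate] at this
              simp only [nextWord, hf₂, if_pos h2, if_neg h]
              simpa [add_comm] using this
          · simp only [if_true]
            simp only [opp, Bool.not_true, if_true, Bool.false_eq_true, if_false] at hc hfi hR
            by_cases h : O.count .A = 0
            · have h2 : ¬ finds true O = true := fun h' => hfi.1 h' h
              have := hF r ih _ hd
              simp only [hR, hc, List.count_replicate, h] at this
              simp only [nextWord, hf₁, if_neg h2, if_pos h, List.append_nil]
              simpa [add_comm] using this
            · have h2 : finds true O = true := hfi.2 h
              have := ih _ hd
              simp only [hR, hc, List.count_replicate] at this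
              simp only [nextWord, hf₁, if_pos h2, if_neg h]
              simpa [add_comm] using this
      _ = 1 + ∫⁻ N, 2⁻¹ * (ENNReal.ofReal (f₁ N) + ENNReal.ofReal (f₂ N)) ∂(backLaw p) := by
          have : ∀ N, 2⁻¹ * ((1 + ENNReal.ofReal (f₁ N)) + (1 + ENNReal.ofReal (f₂ N))) =
              1 + 2⁻¹ * (ENNReal.ofReal (f₁ N) + ENNReal.ofReal (f₂ N)) := fun N => by
            rw [add_add_add_comm, mul_add, one_add_one_eq_two,
              ENNReal.inv_mul_cancel (by norm_num) (by norm_num)]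
          simp_rw [this]
          rw [lintegral_add_left measurable_const, lintegral_const, measure_univ, mul_one]
      _ ≤ 1 + ENNReal.ofReal (∫ N, g N ∂(backLaw p)) := by
          gcongr
          exact lintegral_half_le hf₁0 hf₂0 hg1 hg2
      _ ≤ _ := by
          have h0 : 0 ≤ ∫ N, g N ∂(backLaw p) := integral_nonneg fun N =>
            le_trans (div_nonneg (add_nonneg (hf₁0 N) (hf₂0 N)) (by norm_num)) (hg2 N)
          rw [← ENNReal.ofReal_one, ← ENNReal.ofReal_add (by norm_num) h0]
          exact ENNReal.ofReal_le_ofReal hg3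

lemma lintegral_closeCost_le {W : List Letter} {c : ℝ≥0∞}
    (h : ∀ r : ℕ, ∫⁻ x, cappedCost W r x ∂(wordLaw p) ≤ c) :
    ∫⁻ x, closeCost W x ∂(wordLaw p) ≤ c := by
  have h1 : ∀ x, closeCost W x = ⨆ r : ℕ, cappedCost W r x := fun x => by
    simp only [cappedCost]
    rw [← inf_iSup_eq, ENNReal.iSup_natCast, inf_top_eq]
  rw [lintegral_congr h1, lintegral_iSup fun r => measurable_cappedCost W r]
  · exact iSup_le h
  · intro r s hrs x
    exact min_le_min_left _ (by exact_mod_cast hrs)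

/-- The least number of burgers in the past of a reducible interval around `0`. -/
noncomputable def firstCost (x : ℤ → Letter) : ℝ≥0∞ :=
  ⨅ (m : ℕ) (n : ℕ) (_ : 1 ≤ n ∧ Closed x m n), ((netCount (pw x m)).toNat : ℝ≥0∞)

/-- The exploration starts with a forward search, which reads at least one letter, so that the
interval found contains time $0$. Linear growth of the bound and integrability of the forward search
finish the estimate. -/
lemma lintegral_firstCost_lt_top : ∫⁻ x, firstCost x ∂(wordLaw p) < ∞ := by
  obtain ⟨LB, C, hC, hlin, hLB⟩ := exists_closeCost_bound p
  refine ((lintegral_le_of_foreBlock (p := p) (F := fun O => closeCost (O ++ [.F]))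
    (fun O => measurable_closeCost _) (fun x n O hb => ?_)
    (G := fun i j => ENNReal.ofReal (C * (1 + ((i : ℝ) + j)))) (fun O hO => ?_)).trans
      (lintegral_half_le (g := fun q => C * (1 + (q.1 + q.2 : ℝ))) (fun q => by positivity)
        (fun q => by positivity) ?_ fun q => le_of_eq (by ring))).trans_lt ENNReal.ofReal_lt_top
  · refine le_iInf fun m' => le_iInf fun n' => le_iInf fun h' => ?_
    have hn : n ≠ 0 := by
      rintro rfl
      have := hb.1; simp [fw] at this
    have hpw := pw_add_collapse x 0 n m'
    rw [add_zero] at hpw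
    refine iInf_le_of_le m' (iInf_le_of_le (n + n') (iInf_le_of_le ⟨by omega, ?_⟩ ?_))
    · rw [closed_iff_cls, hpw, fw_add_collapse x 0 n n', cls_append, cls_append,
        cls_eq_red (fw x n), hb.1]
      simpa [pw, mul_assoc] using h'
    · rw [hpw]; simp [pw]
  · exact (lintegral_closeCost_le fun r => hLB r O hO).trans
      (ENNReal.ofReal_le_ofReal (hlin _ _))
  · exact ((integrable_const (1 : ℝ)).add integrable_foreLaw).const_mul C

/-- An infimum over no interval would be $\infty$, which an integrable cost excludes almost surely.
-/
lemma ae_exists_isFirst : ∀ᵐ x ∂(wordLaw p), ∃ q, IsFirst x q := by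
  have hm : Measurable firstCost := by
    refine Measurable.iInf fun m => Measurable.iInf fun n => ?_
    refine LocalOn.measurable (m := m) (n := n) fun x x' h => ?_
    simp only [Closed]
    rw [pw_congr (X := x) (X' := x') fun k h1 h2 => h k h1 (by omega),
      fw_congr (X := x) (X' := x') fun k h1 h2 => h k (by omega) h2]
  filter_upwards [ae_lt_top hm (lintegral_firstCost_lt_top (p := p)).ne] with x hx
  apply exists_isFirst
  by_contra hcon
  push Not at hcon
  refine hx.ne ?_
  simp only [firstCost, iInf_eq_top]
  intro m n h
  exact absurd h.2 (hcon m n h.1)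

end

lemma netCount_nonneg_of_closed {x : ℤ → Letter} {m n k : ℕ} (h : Closed x m n) (hk : k ≤ m) :
    0 ≤ netCount (wd x (-m) k) := by
  have h1 : (red (wd x (-m) k)).1 = [] :=
    fst_nil_of_le (n := m + n) (by omega) (by rw [wd_neg_eq, h])
  rw [netCount_eq, h1]
  simp

/-- A prefix of a word reducing to the empty word has no unserved order, so the letters older than
$-k$ have nonnegative net count. -/
lemma netCount_pw_le_of_closed {x : ℤ → Letter} {m n k : ℕ} (h : Closed x m n) (hk : k ≤ m) :
    netCount (pw x k) ≤ netCount (pw x m) := by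
  obtain ⟨j, rfl⟩ := Nat.exists_eq_add_of_le' hk
  have h1 := netCount_nonneg_of_closed h (show j ≤ j + k by omega)
  have h2 : pw x (j + k) = wd x (-(j + k : ℕ)) j ++ pw x k := by
    rw [pw, wd_add, pw]
    congr 2
    push_cast; ring
  rw [h2, netCount_append]
  linarith

lemma rootDist_true_le (x : ℤ → Letter) : rootDist true x ≤ rootDist false x := by
  unfold rootDist
  rcases h : firstInterval x with _ | ⟨m, n, d⟩
  · simp
  · obtain ⟨-, rfl⟩ := firstInterval_eq_some.1 h
    exact gdist_true_le _ _ _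

/-- The smallest interval lies inside any other, and its height bound at time $0$ is at most the net
count of the past of the larger one. -/
lemma rootDist_false_le (x : ℤ → Letter) : (rootDist false x : ℝ≥0∞) ≤ firstCost x := by
  refine le_iInf fun m => le_iInf fun n => le_iInf fun hc => ?_
  unfold rootDist
  rcases h : firstInterval x with _ | ⟨m₁, n₁, d⟩
  · simp
  obtain ⟨h1, rfl⟩ := firstInterval_eq_some.1 h
  simp only [Option.elim_some]
  have hle : m₁ ≤ m := (h1.le hc.1 hc.2).1
  have h2 := netCount_pw_le_of_closed hc.2 hle
  have h3 : (red (wd x (-m₁) m₁)).1 = [] :=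
    fst_nil_of_le (n := m₁ + n₁) (by omega) (by rw [wd_neg_eq, h1.2.1])
  have h4 := gdist_false_le m₁ h3
  rw [neg_add_cancel, gdist_comm] at h4
  have h5 : netCount (wd x (-m₁) m₁) = netCount (pw x m₁) := rfl
  exact_mod_cast (by omega : gdist false x 0 (-m₁) ≤ (netCount (pw x m)).toNat)

end BurgerWord

namespace BurgerWord

/-! ### Renewal at the pinch points -/

lemma isExploration_firstInterval : IsExploration firstInterval :=
  fun _ _ _ _ _ h hx => firstInterval_congr h hx

open Classical in
/-- The window of the `k`-th reducible interval around `0`, with the distances from the root to its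
pinch point. -/
noncomputable def kthInterval (k : ℕ) (x : ℤ → Letter) : Option (ℕ × ℕ × (Bool → ℕ)) :=
  if h : ∃ I, IsKthReducible x 0 k I then
    some ((h.choose.2 - h.choose.1).toNat, (h.choose.2 - h.choose.1).toNat + 1,
      fun b => gdist b x 0 h.choose.1) else none

lemma kthInterval_eq_some {x : ℤ → Letter} {k : ℕ} {I : ℤ × ℤ} (h : IsKthReducible x 0 k I) :
    kthInterval k x = some ((I.2 - I.1).toNat, (I.2 - I.1).toNat + 1, fun b => gdist b x 0 I.1) := by
  have hex : ∃ I, IsKthReducible x 0 k I := ⟨I, h⟩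
  rw [kthInterval, dif_pos hex, hex.choose_spec.unique h]

/-- The symmetric window of radius the length contains every reducible interval around $0$ that is
no longer. This exploration serves only to prove measurability. -/
lemma isExploration_kthInterval (k : ℕ) : IsExploration (kthInterval k) := by
  intro x x' m n d h hx
  have hex : ∃ I, IsKthReducible x 0 k I := by
    by_contra hne
    rw [kthInterval, dif_neg hne] at h
    cases h
  obtain ⟨I, hI⟩ := hex
  have h1 := hI.1.1
  have h2 := hI.1.2.1
  rw [kthInterval_eq_some hI, Option.some.injEq, Prod.mk.injEq, Prod.mk.injEq] at h
  obtain ⟨rfl, rfl, rfl⟩ := h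
  have hx' : ∀ i, -(I.2 - I.1) ≤ i → i ≤ I.2 - I.1 → x i = x' i := fun i h3 h4 =>
    hx i (by omega) (by omega)
  rw [kthInterval_eq_some (hI.congr hx'), Option.some.injEq, Prod.mk.injEq, Prod.mk.injEq]
  refine ⟨rfl, rfl, funext fun b => ?_⟩
  exact gdist_eq_of_agree b hI.1.2.2 (fun i h3 h4 => hx' i (by omega) (by omega))
    (by omega) (by omega)

lemma pinchDist_eq_elim (b : Bool) (k : ℕ) (x : ℤ → Letter) :
    pinchDist b k x = (kthInterval k x).elim 0 fun q => q.2.2 b := by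
  by_cases h : ∃ I, IsKthReducible x 0 k I
  · obtain ⟨I, hI⟩ := h
    rw [hI.pinchDist_eq, kthInterval_eq_some hI]; rfl
  · rw [pinchDist_eq_zero h, kthInterval, dif_neg h]; rfl

section
variable {p : ℝ} [hp : Fact (p ∈ Set.Ioo (1 / 2 : ℝ) 1)]

lemma measurable_pinchDist (b : Bool) (k : ℕ) : Measurable (pinchDist b k) := by
  have := (isExploration_kthInterval k).measurable fun o => o.elim 0 fun q => q.2.2 b
  convert this using 1
  funext x
  exact pinchDist_eq_elim b k x

lemma measurable_rootDist (b : Bool) : Measurable (rootDist b) :=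
  isExploration_firstInterval.measurable fun o => o.elim 0 fun q => q.2.2 b

lemma ae_firstInterval : ∀ᵐ x ∂(wordLaw p), ∃ q, firstInterval x = some q := by
  filter_upwards [ae_exists_isFirst (p := p)] with x ⟨⟨m, n⟩, h⟩
  exact ⟨_, firstInterval_eq_some.2 ⟨h, rfl⟩⟩

lemma measurable_shrink : Measurable shrink := by
  classical
  intro s hs
  have : shrink ⁻¹' s = ({x | (firstInterval x).isSome} ᶜ ∩ s) ∪
      ⋃ q : ℕ × ℕ × (Bool → ℕ), {x | firstInterval x = some q} ∩ (collapse q.1 q.2.1) ⁻¹' s := by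
    ext x
    simp only [Set.mem_preimage, shrink, Set.mem_union, Set.mem_inter_iff, Set.mem_compl_iff,
      Set.mem_iUnion]
    rcases h : firstInterval x with _ | q
    · simp [h]
    · simp [h]
  rw [this]
  refine MeasurableSet.union (MeasurableSet.inter (MeasurableSet.compl ?_) hs)
    (MeasurableSet.iUnion fun q => (isExploration_firstInterval.measurableSet q).inter
      (measurable_collapse _ _ hs))
  have h1 := isExploration_firstInterval.measurable fun o => o.isSome
  exact h1 (measurableSet_singleton true)

/-- The word in which the first reducible interval is deleted is independent of the distances in
that interval. -/
lemma wordLaw_inter_shrink (D : Set (Bool → ℕ)) {s : Set (ℤ → Letter)} (hs : MeasurableSet s) :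
    wordLaw p ({x | (fun b => rootDist b x) ∈ D} ∩ shrink ⁻¹' s) =
      wordLaw p {x | (fun b => rootDist b x) ∈ D} * wordLaw p s := by
  classical
  have hD : MeasurableSet {x | (fun b => rootDist b x) ∈ D} :=
    (measurable_pi_lambda _ fun b => measurable_rootDist b) (Set.to_countable D).measurableSet
  -- The datum of the exploration is the pair of distances; the event in `D` depends on it and the
  -- event in `s` on the fresh word.
  have h := isExploration_firstInterval.lintegral_eq (p := p)
    (F := fun d y => D.indicator 1 d * s.indicator 1 y)
    fun d => (measurable_one.indicator hs).const_mul _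
  have h1 : wordLaw p ({x | (fun b => rootDist b x) ∈ D} ∩ shrink ⁻¹' s) =
      ∫⁻ x, (firstInterval x).elim 0 (fun q => D.indicator 1 q.2.2 *
        s.indicator 1 (collapse q.1 q.2.1 x)) ∂(wordLaw p) := by
    rw [← lintegral_indicator_one (hD.inter (measurable_shrink hs))]
    refine lintegral_congr_ae ?_
    filter_upwards [ae_firstInterval (p := p)] with x ⟨q, hx⟩
    have e1 : (fun b => rootDist b x) = q.2.2 := by funext b; rw [rootDist, hx]; rfl
    have e2 : shrink x = collapse q.1 q.2.1 x := by rw [shrink, hx]; rfl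
    rw [hx, Option.elim_some, Set.inter_indicator_one]
    simp only [Pi.mul_apply, Set.indicator_apply, Set.mem_ofPred_eq, Set.mem_preimage, e1, e2,
      Pi.one_apply]
  have h2 : wordLaw p {x | (fun b => rootDist b x) ∈ D} * wordLaw p s =
      ∫⁻ x, (firstInterval x).elim 0 (fun q => ∫⁻ y, D.indicator 1 q.2.2 *
        s.indicator 1 y ∂(wordLaw p)) ∂(wordLaw p) := by
    rw [← lintegral_indicator_one hD, ← lintegral_mul_const _ (measurable_one.indicator hD)]
    refine lintegral_congr_ae ?_
    filter_upwards [ae_firstInterval (p := p)] with x ⟨q, hx⟩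
    have e1 : (fun b => rootDist b x) = q.2.2 := by funext b; rw [rootDist, hx]; rfl
    rw [hx, Option.elim_some, lintegral_const_mul _ (measurable_one.indicator hs),
      lintegral_indicator_one hs]
    simp only [Set.indicator_apply, Set.mem_ofPred_eq, e1, Pi.one_apply]
  rw [h1, h2, h]

lemma measurePreserving_shrink : MeasurePreserving shrink (wordLaw p) (wordLaw p) := by
  refine ⟨measurable_shrink, Measure.ext fun s hs => ?_⟩
  rw [Measure.map_apply measurable_shrink hs]
  have := wordLaw_inter_shrink (p := p) Set.univ hs
  simpa using this

lemma ae_good : ∀ᵐ x ∂(wordLaw p), Good x := by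
  rw [show (∀ᵐ x ∂(wordLaw p), Good x) ↔ ∀ᵐ x ∂(wordLaw p), ∀ i : ℕ,
    (firstInterval (shrink^[i] x)).isSome from Iff.rfl, ae_all_iff]
  intro i
  have h0 : ∀ᵐ x ∂(wordLaw p), (firstInterval x).isSome = true := by
    filter_upwards [ae_firstInterval (p := p)] with x ⟨q, hx⟩
    rw [hx]; rfl
  exact ((measurePreserving_shrink (p := p)).iterate i).quasiMeasurePreserving.ae h0

lemma integrable_rootDist (b : Bool) : Integrable (fun x => (rootDist b x : ℝ)) (wordLaw p) := by
  refine ⟨(measurable_from_top.comp (measurable_rootDist b)).aestronglyMeasurable, ?_⟩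
  rw [hasFiniteIntegral_iff_ofReal (Eventually.of_forall fun x => by positivity)]
  refine lt_of_le_of_lt (lintegral_mono fun x => ?_) (lintegral_firstCost_lt_top (p := p))
  rw [ENNReal.ofReal_natCast]
  refine le_trans ?_ (rootDist_false_le x)
  cases b
  · exact le_rfl
  · exact_mod_cast rootDist_true_le x

/-- Here the smallest interval is $[-1,0]$, and its arc separates the root from the pinch point. The
event has positive probability, which makes the denominator of $\mathfrak a$ positive. -/
lemma rootDist_pos {x : ℤ → Letter} (h1 : x (-1) = .a) (h2 : x 0 = .A) : 0 < rootDist true x := by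
  have hpw : pw x 1 = [.a] := by rw [← h1]; rfl
  have hfw : fw x 1 = [.A] := by rw [← h2]; rfl
  have hF : IsFirst x (1, 1) := by
    refine ⟨le_rfl, ?_, fun k hk l hl hl1 hc => ?_⟩
    · rw [Closed, hpw, hfw]; rfl
    · obtain rfl : l = 1 := le_antisymm hl hl1
      rcases Nat.eq_zero_or_pos k with rfl | hk0
      · rw [Closed, hfw] at hc
        simp [pw, red, act, consStep, Letter.isBurger] at hc
      · exact ⟨le_antisymm hk hk0, rfl⟩
  rw [rootDist, firstInterval_eq_some.2 ⟨hF, rfl⟩, Option.elim_some]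
  simp only
  have harc : HamburgerArc x (-1) 0 := by
    refine ⟨⟨by norm_num, ?_⟩, h1⟩
    have : stack x (-1) 1 = [-1] := by simp [stack, h1, Letter.isBurger]
    rw [show ((0 : ℤ) - -1).toNat = 1 by norm_num, this]
    simp [h1, h2, Letter.serves]
  have hne : V x 0 ≠ V x (-1) := fun h => by
    have := (V_eq_iff.1 h (-1) 0 harc).1 (by omega)
    omega
  rw [Nat.pos_iff_ne_zero, gdist, Ne, (graph_preconnected true x _ _).dist_eq_zero_iff]
  exact hne

lemma integral_rootDist_true_pos : 0 < ∫ x, (rootDist true x : ℝ) ∂(wordLaw p) := by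
  rw [integral_pos_iff_support_of_nonneg (fun x => by positivity) (integrable_rootDist true)]
  have hloc : LocalOn 1 0 fun x : ℤ → Letter => if x (-1) = .a then (1 : ℝ≥0∞) else 0 :=
    fun x x' h => by simp only; rw [h (-1) (by simp) (by simp)]
  have hm : Measurable fun x : ℤ → Letter => if x 0 = .A then (1 : ℝ≥0∞) else 0 :=
    (measurable_of_countable fun c => if c = Letter.A then (1 : ℝ≥0∞) else 0).comp
      (measurable_pi_apply 0)
  have h := lintegral_local_mul (p := p) hloc hm
  rw [lintegral_letter (p := p) (-1) fun c => if c = .a then 1 else 0,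
    lintegral_letter (p := p) 0 fun c => if c = .A then 1 else 0] at h
  have hpos : 0 < ∫⁻ x, (if x (-1) = .a then (1 : ℝ≥0∞) else 0) *
      (if collapse 1 0 x 0 = .A then 1 else 0) ∂(wordLaw p) := by
    rw [h]
    simp only [mul_ite, mul_one, mul_zero, Finset.sum_ite_eq', Finset.mem_univ, if_true]
    refine ENNReal.mul_pos ?_ ?_ <;> simp only [ne_eq, ENNReal.ofReal_eq_zero, not_le, Letter.prob]
    · norm_num
    · linarith [hp.out.2]
  refine hpos.trans_le ?_
  have hmeas : Measurable fun x => (rootDist true x : ℝ) :=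
    measurable_from_top.comp (measurable_rootDist true)
  rw [← lintegral_indicator_one (measurableSet_support hmeas)]
  refine lintegral_mono fun x => ?_
  by_cases h1 : x (-1) = .a
  · by_cases h2 : collapse 1 0 x 0 = .A
    · have h3 := rootDist_pos h1 (show x 0 = .A from h2)
      rw [Set.indicator_of_mem (by simp; omega)]
      simp [h1, h2]
    · simp [h2]
  · simp [h1]

/-- The successive contributions to a linear combination of the two distances are pairwise
independent. -/
lemma pairwise_indepFun (φ : (Bool → ℕ) → ℝ) : Pairwise fun i j : ℕ =>
    IndepFun (fun x => φ fun b => rootDist b (shrink^[i] x))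
      (fun x => φ fun b => rootDist b (shrink^[j] x)) (wordLaw p) := by
  have hm : Measurable fun x => φ fun b => rootDist b x :=
    (measurable_of_countable φ).comp (measurable_pi_lambda _ fun b => measurable_rootDist b)
  have key : ∀ i k : ℕ, IndepFun (fun x => φ fun b => rootDist b (shrink^[i] x))
      (fun x => φ fun b => rootDist b (shrink^[i + (k + 1)] x)) (wordLaw p) := by
    intro i k
    rw [indepFun_iff_measure_inter_preimage_eq_mul]
    intro s t hs ht
    have hi := (measurePreserving_shrink (p := p)).iterate i
    have hk := (measurePreserving_shrink (p := p)).iterate k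
    have hik := (measurePreserving_shrink (p := p)).iterate (i + (k + 1))
    have hA : MeasurableSet {x | (fun b => rootDist b x) ∈ φ ⁻¹' s} := hm hs
    have hB : MeasurableSet ((fun x => φ fun b => rootDist b (shrink^[k] x)) ⁻¹' t) :=
      (hm.comp hk.measurable) ht
    -- Invariance under the first $i$ deletions reduces to the case where the first variable is read
    -- off the deleted interval and the second off the remaining word.
    have e1 : (fun x => φ fun b => rootDist b (shrink^[i] x)) ⁻¹' s ∩
        (fun x => φ fun b => rootDist b (shrink^[i + (k + 1)] x)) ⁻¹' t =
        shrink^[i] ⁻¹' ({x | (fun b => rootDist b x) ∈ φ ⁻¹' s} ∩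
          shrink ⁻¹' ((fun x => φ fun b => rootDist b (shrink^[k] x)) ⁻¹' t)) := by
      ext x
      simp only [Set.mem_inter_iff, Set.mem_preimage, Set.mem_ofPred_eq]
      rw [add_comm, Function.iterate_add_apply, Function.iterate_succ_apply]
    rw [e1, hi.measure_preimage (hA.inter (measurable_shrink hB)).nullMeasurableSet,
      wordLaw_inter_shrink _ hB]
    congr 1
    · exact (hi.measure_preimage hA.nullMeasurableSet).symm
    · exact ((hk.measure_preimage (hm ht).nullMeasurableSet).trans
        (hik.measure_preimage (hm ht).nullMeasurableSet).symm)
  intro i j hij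
  rcases lt_or_gt_of_ne hij with h | h
  · obtain ⟨k, rfl⟩ := Nat.exists_eq_add_of_lt h
    exact key i k
  · obtain ⟨k, rfl⟩ := Nat.exists_eq_add_of_lt h
    exact (key j k).symm

lemma identDistrib_shrink (φ : (Bool → ℕ) → ℝ) (i : ℕ) :
    IdentDistrib (fun x => φ fun b => rootDist b (shrink^[i] x))
      (fun x => φ fun b => rootDist b (shrink^[0] x)) (wordLaw p) (wordLaw p) := by
  have hm : Measurable fun x => φ fun b => rootDist b x :=
    (measurable_of_countable φ).comp (measurable_pi_lambda _ fun b => measurable_rootDist b)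
  have hi := (measurePreserving_shrink (p := p)).iterate i
  refine ⟨(hm.comp hi.measurable).aemeasurable, hm.aemeasurable, ?_⟩
  have := Measure.map_map (μ := wordLaw p) hm hi.measurable
  rw [hi.map_eq] at this
  exact this.symm

end

end BurgerWord

namespace BurgerWord

/-! ### The law of large numbers -/

/-- The indices $j(n)$ need not tend to infinity: large ones are controlled by $|S_j|\le\delta
j/(2\varepsilon)$, and the finitely many small ones by a constant divided by $n$. -/
lemma tendsto_div_of_sublinear {S : ℕ → ℝ} (hS : Tendsto (fun n : ℕ => S n / n) atTop (𝓝 0))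
    {j : ℕ → ℕ} {ε : ℝ} (hε : 0 < ε) (hj : ∀ n, (j n : ℝ) ≤ n * ε) :
    Tendsto (fun n : ℕ => S (j n) / n) atTop (𝓝 0) := by
  rw [Metric.tendsto_atTop] at hS ⊢
  intro δ hδ
  obtain ⟨J, hJ⟩ := hS (δ / (2 * ε)) (by positivity)
  set C := ∑ i ∈ Finset.range (J + 1), |S i|
  have hC : ∀ i ≤ J, |S i| ≤ C := fun i hi =>
    Finset.single_le_sum (f := fun i => |S i|) (fun i _ => abs_nonneg _)
      (Finset.mem_range.2 (by omega))
  have hC0 : 0 ≤ C := Finset.sum_nonneg fun i _ => abs_nonneg _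
  obtain ⟨N, hN⟩ := exists_nat_gt (C / δ)
  refine ⟨N + 1, fun n hn => ?_⟩
  have hn0 : (0 : ℝ) < n := by exact_mod_cast (by omega : 0 < n)
  rw [Real.dist_0_eq_abs, abs_div, abs_of_pos hn0, div_lt_iff₀ hn0]
  rcases le_total (j n) J with h | h
  · rw [div_lt_iff₀ hδ] at hN
    have h1 : (N : ℝ) ≤ n := by exact_mod_cast (by omega : N ≤ n)
    nlinarith [hC _ h]
  · have h1 := hJ _ h
    rw [Real.dist_0_eq_abs, abs_div, Nat.abs_cast] at h1
    rcases Nat.eq_zero_or_pos (j n) with h0 | h0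
    · have h3 := hC 0 (by omega)
      rw [div_lt_iff₀ hδ] at hN
      have h2 : (N : ℝ) ≤ n := by exact_mod_cast (by omega : N ≤ n)
      rw [h0]
      nlinarith
    · have h0' : (0 : ℝ) < j n := by exact_mod_cast h0
      rw [div_lt_iff₀ h0', div_mul_eq_mul_div, lt_div_iff₀ (by positivity)] at h1
      have h2 := mul_le_mul_of_nonneg_left (hj n) hδ.le
      have h3 : 0 < δ * n * ε := by positivity
      nlinarith

section
variable {p : ℝ} [hp : Fact (p ∈ Set.Ioo (1 / 2 : ℝ) 1)]

lemma integrable_pinchDist (b : Bool) (k : ℕ) :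
    Integrable (fun x => (pinchDist b k x : ℝ)) (wordLaw p) := by
  have h1 : Integrable (fun x => ∑ i ∈ Finset.range k, (rootDist b (shrink^[i] x) : ℝ)) (wordLaw p) :=
    integrable_finsetSum _ fun i _ =>
      ((measurePreserving_shrink (p := p)).iterate i).integrable_comp_of_integrable
        (integrable_rootDist b)
  refine h1.mono' (measurable_from_top.comp (measurable_pinchDist b k)).aestronglyMeasurable ?_
  filter_upwards [ae_good (p := p)] with x hx
  obtain ⟨j, hj, -, hs⟩ := hx.pinchDist_eq_sum k
  rw [Real.norm_of_nonneg (by positivity), hs]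
  push_cast
  exact Finset.sum_le_sum_of_subset_of_nonneg (Finset.range_subset_range.2 hj)
    fun i _ _ => by positivity

variable (p) in
/-- The ratio of the mean distances between the root and its first pinch point. -/
noncomputable def meanRatio : ℝ :=
  (∫ x, (rootDist false x : ℝ) ∂(wordLaw p)) / ∫ x, (rootDist true x : ℝ) ∂(wordLaw p)

variable (p) in
/-- The balanced combination of the two distances. -/
noncomputable def balance (d : Bool → ℕ) : ℝ := meanRatio p * d true - d false

lemma integrable_balance : Integrable (fun x => balance p fun b => rootDist b x) (wordLaw p) :=
  ((integrable_rootDist true).const_mul _).sub (integrable_rootDist false)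

lemma integral_balance : ∫ x, balance p (fun b => rootDist b x) ∂(wordLaw p) = 0 := by
  unfold balance
  rw [integral_sub ((integrable_rootDist true).const_mul _) (integrable_rootDist false),
    integral_const_mul, meanRatio, div_mul_cancel₀ _ integral_rootDist_true_pos.ne', sub_self]

/-- The distances from the root to the pinch points are balanced. -/
theorem tendsto_balance {ε : ℝ} (hε : 0 < ε) :
    (∀ᵐ x ∂(wordLaw p), Tendsto (fun n : ℕ =>
      balance p (fun b => pinchDist b ⌊n * ε⌋₊ x) / n) atTop (𝓝 0)) ∧
    (∀ n : ℕ, MemLp (fun x => balance p (fun b => pinchDist b ⌊n * ε⌋₊ x) / n) 1 (wordLaw p)) ∧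
    Tendsto (fun n : ℕ => eLpNorm (fun x => balance p (fun b => pinchDist b ⌊n * ε⌋₊ x) / n) 1
      (wordLaw p)) atTop (𝓝 0) := by
  set ξ : ℕ → (ℤ → Letter) → ℝ := fun i x => balance p fun b => rootDist b (shrink^[i] x) with hξ
  set k : ℕ → ℕ := fun n => ⌊n * ε⌋₊ with hk
  have hkle : ∀ n, (k n : ℝ) ≤ n * ε := fun n => Nat.floor_le (by positivity)
  set G : ℕ → (ℤ → Letter) → ℝ := fun n x => balance p (fun b => pinchDist b (k n) x) / n with hG
  have hsum : ∀ x, Good x → ∀ k, ∃ j ≤ k,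
      balance p (fun b => pinchDist b k x) = ∑ i ∈ Finset.range j, ξ i x := by
    intro x hx k
    obtain ⟨j, hj, -, hs⟩ := hx.pinchDist_eq_sum k
    refine ⟨j, hj, ?_⟩
    simp only [hξ, balance, hs]
    push_cast
    rw [Finset.mul_sum, Finset.sum_sub_distrib]
  have hae : ∀ᵐ x ∂(wordLaw p), Tendsto (fun n => G n x) atTop (𝓝 0) := by
    have hlln := strong_law_ae_real ξ integrable_balance (pairwise_indepFun (balance p))
      (identDistrib_shrink (balance p))
    rw [show ∫ x, ξ 0 x ∂(wordLaw p) = 0 from integral_balance] at hlln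
    filter_upwards [hlln, ae_good (p := p)] with x hx hgood
    choose j hj hs using hsum x hgood
    simp only [hG, hs]
    exact tendsto_div_of_sublinear hx hε fun n => (Nat.cast_le.2 (hj (k n))).trans (hkle n)
  have hmem : ∀ n, MemLp (G n) 1 (wordLaw p) := fun n => memLp_one_iff_integrable.2
    ((((integrable_pinchDist true _).const_mul _).sub (integrable_pinchDist false _)).div_const _)
  refine ⟨hae, hmem, ?_⟩
  -- the averages of the absolute values of the contributions
  set η : ℕ → (ℤ → Letter) → ℝ := fun i x => |ξ i x| with hη
  have hη0 : Integrable (η 0) (wordLaw p) := integrable_balance.abs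
  -- The averages of the absolute values converge in $L^1$ to a constant $c$. As they dominate the
  -- quantity of interest up to the factor $\varepsilon$, they supply the missing uniform
  -- integrability.
  have hL := strong_law_Lp (μ := wordLaw p) (p := 1) le_rfl (by norm_num) η
    (memLp_one_iff_integrable.2 hη0) (pairwise_indepFun fun d => |balance p d|)
    (identDistrib_shrink fun d => |balance p d|)
  set c := ∫ x, η 0 x ∂(wordLaw p) with hc
  have hc0 : 0 ≤ c := integral_nonneg fun x => abs_nonneg _
  set A : ℕ → (ℤ → Letter) → ℝ := fun m x => (m : ℝ)⁻¹ • ∑ i ∈ Finset.range m, η i x with hA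
  have hkt : Tendsto k atTop atTop := tendsto_nat_floor_atTop.comp
    (tendsto_natCast_atTop_atTop.atTop_mul_const hε)
  have hL' : Tendsto (fun n => eLpNorm (fun x => A (k n) x - c) 1 (wordLaw p)) atTop (𝓝 0) :=
    hL.comp hkt
  have hbound : ∀ᵐ x ∂(wordLaw p), ∀ n, |G n x| ≤ ε * A (k n) x := by
    filter_upwards [ae_good (p := p)] with x hx n
    obtain ⟨j, hj, hs⟩ := hsum x hx (k n)
    have h1 : |balance p (fun b => pinchDist b (k n) x)| ≤ ∑ i ∈ Finset.range (k n), η i x := by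
      rw [hs]
      exact (Finset.abs_sum_le_sum_abs _ _).trans (Finset.sum_le_sum_of_subset_of_nonneg
        (Finset.range_subset_range.2 hj) fun i _ _ => abs_nonneg _)
    have h0 : 0 ≤ ∑ i ∈ Finset.range (k n), η i x := Finset.sum_nonneg fun i _ => abs_nonneg _
    simp only [hG, hA, smul_eq_mul]
    rw [abs_div, Nat.abs_cast]
    rcases Nat.eq_zero_or_pos (k n) with h2 | h2
    · rw [h2, Finset.range_zero, Finset.sum_empty] at h1
      rw [h2]
      simp [le_antisymm h1 (abs_nonneg _)]
    · have h3 : (0 : ℝ) < k n := by exact_mod_cast h2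
      have h4 : (0 : ℝ) < n := by
        by_contra h4
        have h5 := hkle n
        have h6 : (n : ℝ) = 0 := le_antisymm (not_lt.1 h4) (by positivity)
        rw [h6, zero_mul] at h5
        linarith
      rw [div_le_iff₀ h4]
      refine h1.trans ?_
      rw [show ε * ((k n : ℝ)⁻¹ * ∑ i ∈ Finset.range (k n), η i x) * n =
        (n * ε) / k n * ∑ i ∈ Finset.range (k n), η i x by field_simp]
      exact le_mul_of_one_le_left h0 ((one_le_div h3).2 (hkle n))
  have hmeasG : ∀ n, AEMeasurable (G n) (wordLaw p) := fun n => (hmem n).1.aemeasurable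
  have hmeas : ∀ n, AEMeasurable (fun x => ENNReal.ofReal (min |G n x| (ε * c))) (wordLaw p) :=
    fun n => ((hmeasG n).norm.min aemeasurable_const).ennreal_ofReal
  -- Truncated at the constant $\varepsilon c$, the almost sure limit passes to the integral by
  -- dominated convergence.
  have h1 : Tendsto (fun n => ∫⁻ x, ENNReal.ofReal (min |G n x| (ε * c)) ∂(wordLaw p)) atTop
      (𝓝 0) := by
    have := tendsto_lintegral_of_dominated_convergence' (μ := wordLaw p)
      (F := fun n x => ENNReal.ofReal (min |G n x| (ε * c))) (f := fun _ => 0)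
      (fun _ => ENNReal.ofReal (ε * c))
      hmeas
      (fun n => Eventually.of_forall fun x => ENNReal.ofReal_le_ofReal (min_le_right _ _))
      (by simp [lintegral_const])
      (by
        filter_upwards [hae] with x hx
        have h2 : Tendsto (fun n => min |G n x| (ε * c)) atTop (𝓝 0) := by
          have := (hx.abs).min (tendsto_const_nhds (x := ε * c))
          rwa [abs_zero, min_eq_left (by positivity)] at this
        simpa using ENNReal.tendsto_ofReal h2)
    simpa using this
  have h2 : Tendsto (fun n => ENNReal.ofReal ε * eLpNorm (fun x => A (k n) x - c) 1 (wordLaw p)) atTop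
      (𝓝 0) := by
    simpa using ENNReal.Tendsto.const_mul hL' (Or.inr ENNReal.ofReal_ne_top)
  refine tendsto_of_tendsto_of_tendsto_of_le_of_le tendsto_const_nhds (by simpa only [add_zero] using h1.add h2)
    (fun _ => zero_le) fun n => ?_
  change eLpNorm (G n) 1 (wordLaw p) ≤ _
  rw [eLpNorm_one_eq_lintegral_enorm, eLpNorm_one_eq_lintegral_enorm,
    ← lintegral_const_mul' _ _ ENNReal.ofReal_ne_top, ← lintegral_add_left' (hmeas n)]
  refine lintegral_mono_ae ?_
  filter_upwards [hbound] with x hx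
  rw [Real.enorm_eq_ofReal_abs, Real.enorm_eq_ofReal_abs, ← ENNReal.ofReal_mul hε.le,
    ← ENNReal.ofReal_add (le_min (abs_nonneg _) (by positivity)) (by positivity)]
  refine ENNReal.ofReal_le_ofReal ?_
  have h3 := hx n
  have h4 := mul_le_mul_of_nonneg_left (le_abs_self (A (k n) x - c)) hε.le
  have h5 : 0 ≤ ε * |A (k n) x - c| := by positivity
  -- The inequality is $|G|\le\min(|G|,\varepsilon c)+\varepsilon|A-c|$, which follows from
  -- $|G|\le\varepsilon A$.
  rcases min_cases |G n x| (ε * c) with ⟨h6, -⟩ | ⟨h6, -⟩ <;> rw [h6] <;> linarith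

end

end BurgerWord


















/-! ### Transfer to an arbitrary probability space -/

namespace BurgerWord

/-- Independence and the one-letter laws determine the joint law as the product measure, so every
statement can be proved for the canonical word and pulled back. -/
lemma IsRandomWord.map_eq {Ω : Type*} [MeasurableSpace Ω] {P : Measure Ω} [IsProbabilityMeasure P]
    {p : ℝ} {X : Ω → ℤ → Letter} (hX : IsRandomWord P p X) : P.map X = wordLaw p := by
  have h1 := (iIndepFun_iff_map_fun_eq_infinitePi_map (P := P) (X := fun n ω => X ω n)
    hX.measurable).1 hX.indep
  have h2 : ∀ n : ℤ, P.map (fun ω => X ω n) = letterLaw p := fun n => by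
    refine Measure.ext_of_singleton fun c => ?_
    rw [Measure.map_apply (hX.measurable n) (measurableSet_singleton c), letterLaw_singleton,
      ← hX.law n c]
    rfl
  simp_rw [h2] at h1
  exact h1

lemma IsRandomWord.measurePreserving {Ω : Type*} [MeasurableSpace Ω] {P : Measure Ω}
    [IsProbabilityMeasure P] {p : ℝ} {X : Ω → ℤ → Letter} (hX : IsRandomWord P p X) :
    MeasurePreserving X P (wordLaw p) :=
  ⟨measurable_pi_iff.2 hX.measurable, hX.map_eq⟩

lemma integral_pinchDist_one {p : ℝ} [Fact (p ∈ Set.Ioo (1 / 2 : ℝ) 1)] (b : Bool) :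
    ∫ x, (pinchDist b 1 x : ℝ) ∂(wordLaw p) = ∫ x, (rootDist b x : ℝ) ∂(wordLaw p) := by
  refine integral_congr_ae ?_
  filter_upwards [ae_good (p := p)] with x hx
  rw [hx.pinchDist_one]

lemma IsRandomWord.integral_pinchDist {Ω : Type*} [MeasurableSpace Ω] {P : Measure Ω}
    [IsProbabilityMeasure P] {p : ℝ} [Fact (p ∈ Set.Ioo (1 / 2 : ℝ) 1)] {X : Ω → ℤ → Letter}
    (hX : IsRandomWord P p X) (b : Bool) :
    ∫ ω, (pinchDist b 1 (X ω) : ℝ) ∂P = ∫ x, (rootDist b x : ℝ) ∂(wordLaw p) := by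
  rw [← integral_pinchDist_one, ← hX.map_eq,
    integral_map hX.measurePreserving.measurable.aemeasurable]
  exact (measurable_from_top.comp (measurable_pinchDist b 1)).aestronglyMeasurable

end BurgerWord

theorem proposition4p5 {Ω : Type*} [MeasurableSpace Ω] (P : Measure Ω) [IsProbabilityMeasure P]
    (p : ℝ) (hp : 1 / 2 < p) (hp' : p < 1)
    (X : Ω → ℤ → Letter) (hX : BurgerWord.IsRandomWord P p X) :
    -- almost surely, all the pinch points of the root exist
    (∀ᵐ ω ∂P, ∀ k : ℕ, 1 ≤ k → ∃ I, BurgerWord.IsKthReducible (X ω) 0 k I) ∧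
    -- the constant `𝔞` is a quotient of finite positive expectations
    Integrable (fun ω => BurgerWord.dT (X ω) (BurgerWord.root (X ω))
      (BurgerWord.pinchPoint (X ω) 0 1)) P ∧
    Integrable (fun ω => BurgerWord.dM (X ω) (BurgerWord.root (X ω))
      (BurgerWord.pinchPoint (X ω) 0 1)) P ∧
    0 < ∫ ω, BurgerWord.dM (X ω) (BurgerWord.root (X ω)) (BurgerWord.pinchPoint (X ω) 0 1) ∂P ∧
    ∀ ε : ℝ, 0 < ε →
      -- almost sure convergence
      (∀ᵐ ω ∂P, Tendsto (fun n : ℕ =>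
        BurgerWord.D (BurgerWord.distortion P X) (X ω) (BurgerWord.root (X ω))
          (BurgerWord.pinchPoint (X ω) 0 ⌊n * ε⌋₊) / n) atTop (𝓝 0)) ∧
      -- convergence in `L¹`
      (∀ n : ℕ, MemLp (fun ω =>
        BurgerWord.D (BurgerWord.distortion P X) (X ω) (BurgerWord.root (X ω))
          (BurgerWord.pinchPoint (X ω) 0 ⌊n * ε⌋₊) / n) 1 P) ∧
      Tendsto (fun n : ℕ => eLpNorm (fun ω =>
        BurgerWord.D (BurgerWord.distortion P X) (X ω) (BurgerWord.root (X ω))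
          (BurgerWord.pinchPoint (X ω) 0 ⌊n * ε⌋₊) / n) 1 P) atTop (𝓝 0) := by
  have : Fact (p ∈ Set.Ioo (1 / 2 : ℝ) 1) := ⟨⟨hp, hp'⟩⟩
  have hm := hX.measurePreserving
  -- Both expectations depend only on the law of the word, so the constant is the one that centres
  -- the increments of the canonical word.
  have hdist : BurgerWord.distortion P X = BurgerWord.meanRatio p := by
    unfold BurgerWord.distortion BurgerWord.meanRatio
    simp_rw [BurgerWord.dT_pinchPoint, BurgerWord.dM_pinchPoint]
    rw [hX.integral_pinchDist, hX.integral_pinchDist]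
  refine ⟨?_, ?_, ?_, ?_, fun ε hε => ?_⟩
  · filter_upwards [hm.quasiMeasurePreserving.ae (BurgerWord.ae_good (p := p))] with ω hω k hk
    exact hω.exists_isKthReducible hk
  · simp_rw [BurgerWord.dT_pinchPoint]
    exact hm.integrable_comp_of_integrable (BurgerWord.integrable_pinchDist false 1)
  · simp_rw [BurgerWord.dM_pinchPoint]
    exact hm.integrable_comp_of_integrable (BurgerWord.integrable_pinchDist true 1)
  · simp_rw [BurgerWord.dM_pinchPoint]
    rw [hX.integral_pinchDist]
    exact BurgerWord.integral_rootDist_true_pos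
  · simp_rw [hdist, BurgerWord.D, BurgerWord.dT_pinchPoint, BurgerWord.dM_pinchPoint]
    obtain ⟨h1, h2, h3⟩ := BurgerWord.tendsto_balance (p := p) hε
    refine ⟨hm.quasiMeasurePreserving.ae h1, fun n => (h2 n).comp_measurePreserving hm, ?_⟩
    have h4 : ∀ n : ℕ, _ := fun n => eLpNorm_comp_measurePreserving (p := 1) (h2 n).1 hm
    exact h3.congr fun n => (h4 n).symm
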